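/- **Problem and assumptions.** Let $B,n_1,\dots,n_B,l$ be nonnegative integers, $x=(x_1,\dots,x_B)\in\mathbb R^{n}=\mathbb R^{n_1}\times\cdots\times\mathbb R^{n_B}$ with the Euclidean norm, and consider $$\min\{\phi(x):=f(x)+h(x): Ax=d\},\qquad h(x)=\sum_{t=1}^B h_t(x_t),\quad Ax=\sum_{t=1}^B A_tx_t\in\mathbb R^l .$$ Assume: (A1) each $h_t:\mathbb R^{n_t}\to(-\infty,\infty]$ is proper, lower semicontinuous and convex with compact domain $\mathcal H_t$; put $\mathcal H=\mathcal H_1\times\cdots\times\mathcal H_B$; (A2) $A\neq0$ and $\mathcal F:=\{x\in\mathcal H:Ax=d\}\neq\emptyset$; (A3) $h$ is $K_h$-Lipschitz on $\mathcal H$, $K_h\ge0$; (A4) for every $t$ there is $m_t\ge0$ such that $u\mapsto f(x_{<t},u,x_{>t})+\frac{m_t}{2}\|u\|^2$ is convex on $\mathcal H_t$ for all $x\in\mathcal H$; (A5) $f$ is differentiable on $\mathcal H$, $\nabla f$ is bounded on $\mathcal H$, and for every $t$ there is $M_t\ge0$ with $\|\nabla_{x_t}f(x_{\le t},\tilde x_{>t})-\nabla_{x_t}f(x_{\le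 t},x_{>t})\|\le M_t\|\tilde x_{>t}-x_{>t}\|$ for all $x,\tilde x\in\mathcal H$ (for $t=B$ this is vacuous); (A6) there is $z_\dagger\in\mathcal F$ with $d_\dagger:=\mathrm{dist}(z_\dagger,\partial\mathcal H)>0$. A pair $(z,q)\in\mathcal H\times\mathbb R^l$ is $(\rho,\eta)$-stationary if $\mathrm{dist}(0,\nabla f(z)+A^*q+\partial h(z))\le\rho$ and $\|Az-d\|\le\eta$. **Method.** Put $m=\max_tm_t$, $M=\max_tM_t$. Let $\lambda\in(0,1/(2m)]$ (any $\lambda>0$ if $m=0$), $c_1>0$, $\bar z^0\in\mathcal H$, $(\rho,\eta)\in(0,1)^2$ and $(\chi,\theta)\in(0,1]^2$ with $2\chi B(2-\theta)(1-\theta)\le\theta^2$. Let $\mathcal L_c^\theta(x;p)=\phi(x)+(1-\theta)\langle p,Ax-d\rangle+\frac c2\|Ax-d\|^2$. *Static method* with input $(x^0,p^0,c)$: for $k=1,2,\dots$ compute successively, for $t=1,\dots,B$, $$x_t^k=\operatorname*{argmin}_{u}\{\lambda\mathcal L_c^\theta(x_{<t}^k,u,x_{>t}^{k-1};p^{k-1})+\tfrac12\|u-x_t^{k-1}\|^2\};$$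 set $q^k=(1-\theta)p^{k-1}+c(Ax^k-d)$, $p^k=(1-\theta)p^{k-1}+\chi c(Ax^k-d)$ and $$v_t^k=\nabla_{x_t}f(x^k)-\nabla_{x_t}f(x_{\le t}^k,x_{>t}^{k-1})+cA_t^*\sum_{s>t}A_s(x_s^k-x_s^{k-1})-\tfrac1\lambda(x_t^k-x_t^{k-1}).$$ Return $(x^k,p^k,q^k,v^k)$ successfully if $\|v^k\|\le\rho$ and $\|Ax^k-d\|\le\eta$; otherwise return it unsuccessfully if $k\ge3$ is even and $$\frac1\rho\cdot\frac2{k+2}\sum_{i=k/2}^k\|v^i\|+\frac1\eta\sqrt{\frac{c^3}{k}}\cdot\frac2{k+2}\sum_{i=k/2}^k\|Ax^i-d\|\le1 .$$ *Dynamic method (DP.ADMM)*: $\bar p^0=0$; for $\ell=1,2,\dots$ call the static method with input $(\bar z^{\ell-1},\bar p^{\ell-1},c_\ell)$ to obtain $(\bar z^\ell,\bar p^\ell,\bar q^\ell,\bar v^\ell)$; stop with output $(\bar z^\ell,\bar q^\ell)$ if the call is successful, and otherwise set $c_{\ell+1}=2c_\ell$. **Constants.** $D_\dagger=\sup_{\mathcal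 H}\|z-z_\dagger\|$, $G_f=\sup_{\mathcal H}\|\nabla f\|$, $\Delta_\phi=\sup_{\mathcal H}\phi-\inf_{\mathcal H}\phi$, $\sigma_A^+$ the smallest positive singular value of $A$, $\|A\|_\dagger=\sum_t\|A_t\|$, $$\kappa_0=\frac{2B^2(\lambda M+1)}{\sqrt\lambda},\quad \kappa_1=\frac{\chi\|A\|D_\dagger}{\theta},\quad \kappa_2=\frac1\theta\Big[1+\frac{2\chi D_\dagger(K_h+G_f)}{\theta d_\dagger\sigma_A^+}\Big]+1,\quad \kappa_3=\frac{108\kappa_2^2}{\chi^2},$$ $$\kappa_4=\frac{\theta d_\dagger\sigma_A^+}{\chi D_\dagger},\quad \kappa_5=8(B-1)\|A\|_\dagger^2,\quad \kappa_6=3+\frac{8\kappa_0^2\Delta_\phi}{\kappa_4^2},$$ $$\tilde\kappa^{(0)}=2\Big(\sqrt{\Delta_\phi}+\frac{5\kappa_2}{\chi\sqrt{c_1}}\Big),\quad \tilde\kappa^{(1)}=3\kappa_0^2[\tilde\kappa^{(0)}]^2,\quad \tilde\kappa^{(2)}=3\kappa_5[\tilde\kappa^{(0)}]^2,$$ $$\xi^{(0)}=\frac8{\kappa_4^2}\Big[\frac{81\kappa_0^2\kappa_1^2}{\chi^2}+\kappa_5\Delta_\phi\Big]+3(1-\theta)\kappa_1,\quad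 \xi^{(1)}=\frac{648\,\kappa_5\kappa_1^2}{\chi^2\kappa_4^2},$$ $$T_1=48\big(\kappa_6+\tilde\kappa^{(1)}+(\xi^{(0)}+\kappa_3+\tilde\kappa^{(2)})c_1+\xi^{(1)}c_1^2\big),\quad E_0=2\Big(1+\frac{T_1^2}{c_1^3}\Big),\quad E_1=2\sqrt{\frac{T_1}{c_1^3}}.$$ **Theorem.** Every subproblem met by DP.ADMM has a unique solution, and DP.ADMM stops and outputs a $(\rho,\eta)$-stationary pair. The total number of iterations of the static method over all calls is at most $$T_1\Big(2E_0^2+\frac{E_0+2E_1^2}{\varepsilon^2}+\frac{E_1}{\varepsilon^3}\Big),\qquad \varepsilon=\min\{\rho,\eta\}.$$ In particular it is at most $C\varepsilon^{-3}$ with a constant $C$ that does not depend on $(\rho,\eta)$ or $\bar z^0$. -/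

import Mathlib

open scoped BigOperators

noncomputable section

namespace DPADMM

/-- The product space `ℝ^{n_1} × ⋯ × ℝ^{n_B}` with its Euclidean (Hilbert) structure. -/
abbrev Blocks {B : ℕ} (n : Fin B → ℕ) : Type :=
  PiLp 2 (fun t : Fin B => EuclideanSpace ℝ (Fin (n t)))

/-- The data of `min { f(x) + ∑ t, h_t(x_t) : ∑ t, A_t x_t = d }`.
Only the values of `f` on the domain of `h` matter. -/
structure Problem (B : ℕ) (n : Fin B → ℕ) (l : ℕ) where
  f : Blocks n → ℝ
  hBlock : ∀ t : Fin B, EuclideanSpace ℝ (Fin (n t)) → EReal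
  ABlock : ∀ t : Fin B, EuclideanSpace ℝ (Fin (n t)) →L[ℝ] EuclideanSpace ℝ (Fin l)
  d : EuclideanSpace ℝ (Fin l)

/-- `(y_{<t}, u, x_{>t})`. -/
def splice {B : ℕ} {n : Fin B → ℕ} (y : Blocks n) (t : Fin B)
    (u : EuclideanSpace ℝ (Fin (n t))) (x : Blocks n) : Blocks n :=
  WithLp.toLp 2 (Function.update (fun s => if s < t then y s else x s) t u)

/-- `‖x_{>t} - y_{>t}‖`. -/
def tailDist {B : ℕ} {n : Fin B → ℕ} (t : Fin B) (x y : Blocks n) : ℝ :=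
  Real.sqrt (∑ s ∈ Finset.Ioi t, ‖x s - y s‖ ^ 2)

/-- `g` is a proper lower semicontinuous convex function with values in `(-∞, ∞]`. -/
structure IsClosedProperConvex {E : Type*} [NormedAddCommGroup E] [NormedSpace ℝ E]
    (g : E → EReal) : Prop where
  ne_bot : ∀ x, g x ≠ ⊥
  proper : ∃ x, g x < ⊤
  lsc : LowerSemicontinuous g
  convex_epigraph : Convex ℝ {z : E × ℝ | g z.1 ≤ (z.2 : EReal)}

/-- The subdifferential of `g` at `z`. -/
def subdiff {E : Type*} [NormedAddCommGroup E] [InnerProductSpace ℝ E]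
    (g : E → EReal) (z : E) : Set E :=
  {ξ | ∀ u, g z + ((inner ℝ ξ (u - z) : ℝ) : EReal) ≤ g u}

namespace Problem

variable {B : ℕ} {n : Fin B → ℕ} {l : ℕ} (P : Problem B n l)

/-- `h(x) = ∑ t, h_t(x_t)`. -/
def h (x : Blocks n) : EReal := ∑ t, P.hBlock t (x t)

/-- `A x = ∑ t, A_t x_t`. -/
def A : Blocks n →L[ℝ] EuclideanSpace ℝ (Fin l) :=
  ∑ t, (P.ABlock t).comp (PiLp.proj 2 (fun t : Fin B => EuclideanSpace ℝ (Fin (n t))) t)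

/-- `ℋ_t = dom h_t`. -/
def domBlock (t : Fin B) : Set (EuclideanSpace ℝ (Fin (n t))) := {u | P.hBlock t u < ⊤}

/-- `ℋ = ℋ_1 × ⋯ × ℋ_B`. -/
def dom : Set (Blocks n) := {x | ∀ t, x t ∈ P.domBlock t}

/-- The feasible set `ℱ = {x ∈ ℋ : A x = d}`. -/
def feasible : Set (Blocks n) := {x ∈ P.dom | P.A x = P.d}

/-- The gradient of `f` relative to `ℋ`. It is the usual gradient wherever `f` is differentiable
in a neighbourhood, and is uniquely determined when `ℋ` is convex with nonempty interior. -/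
def grad (x : Blocks n) : Blocks n := gradientWithin P.f P.dom x

/-- `φ = f + h` on `ℋ`. -/
def phi (x : Blocks n) : ℝ := P.f x + (P.h x).toReal

/-- `(z, q)` is a `(ρ, η)`-stationary pair: `z ∈ ℋ`,
`dist(0, ∇f(z) + A^* q + ∂h(z)) ≤ ρ` and `‖A z - d‖ ≤ η`. -/
def IsStationaryPair (ρ η : ℝ) (z : Blocks n) (q : EuclideanSpace ℝ (Fin l)) : Prop :=
  z ∈ P.dom ∧
  Metric.infEDist (0 : Blocks n)
      ((fun ξ => P.grad z + ContinuousLinearMap.adjoint P.A q + ξ) '' subdiff P.h z)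
    ≤ ENNReal.ofReal ρ ∧
  ‖P.A z - P.d‖ ≤ η

/-- The dampened augmented Lagrangian
`φ(x) + (1 - θ) ⟨p, A x - d⟩ + (c / 2) ‖A x - d‖²`, equal to `⊤` off `ℋ`. -/
def lagrangian (θ c : ℝ) (x : Blocks n) (p : EuclideanSpace ℝ (Fin l)) : EReal :=
  (P.f x : EReal) + P.h x +
    (((1 - θ) * inner ℝ p (P.A x - P.d) + c / 2 * ‖P.A x - P.d‖ ^ 2 : ℝ) : EReal)

end Problem

/-- The constants named in the assumptions: `K_h`, `m_t`, `M_t` and the point `z_†`.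
(`M_t` for the last block is unconstrained apart from its sign.) -/
structure Moduli {B : ℕ} (n : Fin B → ℕ) where
  Kh : ℝ
  mBlock : Fin B → ℝ
  MBlock : Fin B → ℝ
  zdag : Blocks n

/-- The standing assumptions on the problem. -/
structure Assumptions {B : ℕ} {n : Fin B → ℕ} {l : ℕ} (P : Problem B n l) (K : Moduli n) :
    Prop where
  closedConvex : ∀ t, IsClosedProperConvex (P.hBlock t)
  compactDom : ∀ t, IsCompact (P.domBlock t)
  A_ne_zero : P.A ≠ 0
  feasible_nonempty : P.feasible.Nonempty
  Kh_nonneg : 0 ≤ K.Kh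
  h_lipschitz : ∀ x ∈ P.dom, ∀ y ∈ P.dom,
    |(P.h x).toReal - (P.h y).toReal| ≤ K.Kh * ‖x - y‖
  m_nonneg : ∀ t, 0 ≤ K.mBlock t
  weaklyConvex : ∀ t, ∀ x ∈ P.dom, ConvexOn ℝ (P.domBlock t)
    (fun u => P.f (splice x t u x) + K.mBlock t / 2 * ‖u‖ ^ 2)
  f_differentiable : DifferentiableOn ℝ P.f P.dom
  M_nonneg : ∀ t, 0 ≤ K.MBlock t
  grad_lipschitz : ∀ t, ∀ x ∈ P.dom, ∀ y ∈ P.dom,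
    ‖P.grad (splice x t (x t) y) t - P.grad x t‖ ≤ K.MBlock t * tailDist t y x
  /-- `sup_ℋ ‖∇f‖` is finite; this holds in particular if `∇f` is Lipschitz on `ℋ`. -/
  grad_bounded : BddAbove ((fun x => ‖P.grad x‖) '' P.dom)
  zdag_feasible : K.zdag ∈ P.feasible
  zdag_interior : 0 < Metric.infDist K.zdag (frontier P.dom)

/-- Prox stepsize `λ`, under-relaxation parameter `χ`, dampening parameter `θ`. -/
structure Params where
  lam : ℝ
  chi : ℝ
  theta : ℝ

/-- `m = max_t m_t`. -/
def Moduli.m {B : ℕ} {n : Fin B → ℕ} (K : Moduli n) : ℝ := ⨆ t, K.mBlock t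

/-- `M = max_t M_t`. -/
def Moduli.M {B : ℕ} {n : Fin B → ℕ} (K : Moduli n) : ℝ := ⨆ t, K.MBlock t

/-- `λ ∈ (0, 1/(2m)]` (any `λ > 0` if `m = 0`), `(χ, θ) ∈ (0,1]²` and
`2 χ B (2 - θ)(1 - θ) ≤ θ²`. -/
structure Params.Admissible {B : ℕ} {n : Fin B → ℕ} (S : Params) (K : Moduli n) : Prop where
  lam_pos : 0 < S.lam
  lam_le : 2 * K.m * S.lam ≤ 1
  chi_pos : 0 < S.chi
  chi_le : S.chi ≤ 1
  theta_pos : 0 < S.theta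
  theta_le : S.theta ≤ 1
  chi_theta : 2 * S.chi * B * (2 - S.theta) * (1 - S.theta) ≤ S.theta ^ 2

section Constants

variable {B : ℕ} {n : Fin B → ℕ} {l : ℕ} (P : Problem B n l) (K : Moduli n) (S : Params)

/-- `D_† = sup_{z ∈ ℋ} ‖z - z_†‖`. -/
def Ddag : ℝ := sSup ((fun z => ‖z - K.zdag‖) '' P.dom)

/-- `d_† = dist(z_†, ∂ℋ)`. -/
def ddag : ℝ := Metric.infDist K.zdag (frontier P.dom)

/-- `G_f = sup_{x ∈ ℋ} ‖∇f(x)‖`. -/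
def Gf : ℝ := sSup ((fun x => ‖P.grad x‖) '' P.dom)

/-- `Δ_φ = sup_ℋ φ - inf_ℋ φ`. -/
def deltaPhi : ℝ := sSup (P.phi '' P.dom) - sInf (P.phi '' P.dom)

/-- The smallest positive singular value of `A`. -/
def sigmaPlus : ℝ :=
  sInf {s : ℝ | 0 < s ∧ ∃ i : ℕ,
    (P.A : Blocks n →ₗ[ℝ] EuclideanSpace ℝ (Fin l)).singularValues i = s}

/-- `‖A‖_† = ∑ t, ‖A_t‖`. -/
def normADag : ℝ := ∑ t, ‖P.ABlock t‖

def kappa0 : ℝ := 2 * (B : ℝ) ^ 2 * (S.lam * K.M + 1) / Real.sqrt S.lam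

def kappa1 : ℝ := S.chi * ‖P.A‖ * Ddag P K / S.theta

def kappa2 : ℝ :=
  1 / S.theta *
    (1 + 2 * S.chi * Ddag P K * (K.Kh + Gf P) / (S.theta * ddag P K * sigmaPlus P)) + 1

def kappa3 : ℝ := 108 * kappa2 P K S ^ 2 / S.chi ^ 2

def kappa4 : ℝ := S.theta * ddag P K * sigmaPlus P / (S.chi * Ddag P K)

def kappa5 : ℝ := 8 * ((B : ℝ) - 1) * normADag P ^ 2

def kappa6 : ℝ := 3 + 8 * kappa0 K S ^ 2 * deltaPhi P / kappa4 P K S ^ 2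

def kappaTilde0 (cLow : ℝ) : ℝ :=
  2 * (Real.sqrt (deltaPhi P) + 5 * kappa2 P K S / (S.chi * Real.sqrt cLow))

def kappaTilde1 (cLow : ℝ) : ℝ := 3 * kappa0 K S ^ 2 * kappaTilde0 P K S cLow ^ 2

def kappaTilde2 (cLow : ℝ) : ℝ := 3 * kappa5 P * kappaTilde0 P K S cLow ^ 2

def xi0 (R : ℝ) : ℝ :=
  8 / kappa4 P K S ^ 2 *
      (9 * kappa0 K S ^ 2 * (R + kappa1 P K S) ^ 2 / S.chi ^ 2 + kappa5 P * deltaPhi P)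
    + (1 - S.theta) * (R + kappa1 P K S)

def xi1 (R : ℝ) : ℝ :=
  72 * kappa5 P * (R + kappa1 P K S) ^ 2 / (S.chi ^ 2 * kappa4 P K S ^ 2)

/-- `𝒯_c(ρ, η | c̲, R)`. -/
def iterBound (c ρ η cLow R : ℝ) : ℝ :=
  48 * ((kappa6 P K S + kappaTilde1 P K S cLow / ρ ^ 2)
    + (xi0 P K S R + kappa3 P K S / η ^ 2 + kappaTilde2 P K S cLow / ρ ^ 2) * c
    + xi1 P K S R * c ^ 2)

/-- `T_1 = 𝒯_{c₁}(1, 1 | c₁, 2 κ₁)`. -/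
def T1 (c₁ : ℝ) : ℝ := iterBound P K S c₁ 1 1 c₁ (2 * kappa1 P K S)

def E0 (c₁ : ℝ) : ℝ := 2 * (1 + T1 P K S c₁ ^ 2 / c₁ ^ 3)

def E1 (c₁ : ℝ) : ℝ := 2 * Real.sqrt (T1 P K S c₁ / c₁ ^ 3)

/-- `T₁ (2 E₀² + (E₀ + 2 E₁²)/ε² + E₁/ε³)`. -/
def totalBound (c₁ ε : ℝ) : ℝ :=
  T1 P K S c₁ *
    (2 * E0 P K S c₁ ^ 2 + (E0 P K S c₁ + 2 * E1 P K S c₁ ^ 2) / ε ^ 2 + E1 P K S c₁ / ε ^ 3)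

end Constants

/-- A state of the dynamic method: the penalty parameter `c` of the current call of the static
method, the number `k` of iterations performed in this call so far, and the iterates
`x^0, …, x^k` and `p^0, …, p^k` of this call (entries with index above `k` are irrelevant). -/
structure State {B : ℕ} (n : Fin B → ℕ) (l : ℕ) where
  c : ℝ
  k : ℕ
  x : ℕ → Blocks n
  p : ℕ → EuclideanSpace ℝ (Fin l)

section Algorithm

variable {B : ℕ} {n : Fin B → ℕ} {l : ℕ} (P : Problem B n l) (S : Params)

/-- Step 1: `y` results from `x` by one cyclic sweep of exact block prox minimizations, i.e.
`y_t ∈ argmin_u { λ L_c^θ(y_{<t}, u, x_{>t}; p) + ½ ‖u - x_t‖² }` for every `t`. -/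
def IsProxSweep (c : ℝ) (x : Blocks n) (p : EuclideanSpace ℝ (Fin l)) (y : Blocks n) : Prop :=
  ∀ t, IsMinOn
    (fun u => (S.lam : EReal) * P.lagrangian S.theta c (splice y t u x) p
      + ((1 / 2 * ‖u - x t‖ ^ 2 : ℝ) : EReal)) Set.univ (y t)

/-- `q^i = (1 - θ) p^{i-1} + c (A x^i - d)`, for `i ≥ 1`. -/
def State.q (s : State n l) (i : ℕ) : EuclideanSpace ℝ (Fin l) :=
  (1 - S.theta) • s.p (i - 1) + s.c • (P.A (s.x i) - P.d)

/-- The residual `v^i`, for `i ≥ 1`. -/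
def State.v (s : State n l) (i : ℕ) : Blocks n :=
  WithLp.toLp 2 fun t =>
    (P.grad (s.x i) t - P.grad (splice (s.x i) t (s.x i t) (s.x (i - 1))) t)
      + s.c • ContinuousLinearMap.adjoint (P.ABlock t)
          (∑ j ∈ Finset.Ioi t, P.ABlock j (s.x i j - s.x (i - 1) j))
      - (1 / S.lam) • (s.x i t - s.x (i - 1) t)

/-- Step 2a: iteration `k` of the current call passes the successful termination test. -/
def State.Successful (ρ η : ℝ) (s : State n l) : Prop :=
  1 ≤ s.k ∧ ‖s.v P S s.k‖ ≤ ρ ∧ ‖P.A (s.x s.k) - P.d‖ ≤ η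

/-- Step 2b: iteration `k` of the current call passes the unsuccessful termination test. -/
def State.PassesErgodicTest (ρ η : ℝ) (s : State n l) : Prop :=
  Even s.k ∧ 3 ≤ s.k ∧
  1 / ρ * (2 / ((s.k : ℝ) + 2) * ∑ i ∈ Finset.Icc (s.k / 2) s.k, ‖s.v P S i‖)
    + 1 / η * Real.sqrt (s.c ^ 3 / (s.k : ℝ)) *
      (2 / ((s.k : ℝ) + 2) * ∑ i ∈ Finset.Icc (s.k / 2) s.k, ‖P.A (s.x i) - P.d‖) ≤ 1

/-- The current call of the static method returns at iteration `k`. -/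
def State.Returns (ρ η : ℝ) (s : State n l) : Prop :=
  s.Successful P S ρ η ∨ s.PassesErgodicTest P S ρ η

/-- The state at the start of a call with penalty parameter `c` and initial pair `(z, p)`. -/
def State.start (c : ℝ) (z : Blocks n) (p : EuclideanSpace ℝ (Fin l)) : State n l :=
  ⟨c, 0, fun _ => z, fun _ => p⟩

/-- The state after one more iteration, with new primal iterate `y` and the multiplier update
`p^{k+1} = (1 - θ) p^k + χ c (A y - d)`. -/
def State.next (s : State n l) (y : Blocks n) : State n l :=
  ⟨s.c, s.k + 1, Function.update s.x (s.k + 1) y,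
    Function.update s.p (s.k + 1)
      ((1 - S.theta) • s.p s.k + (S.chi * s.c) • (P.A y - P.d))⟩

/-- `Reach P S ρ η c₁ z₀ N s`: the dynamic method started with penalty parameter `c₁` at `z₀`
(and zero multiplier) can be in state `s` after a total of `N` iterations of the static method,
summed over all its calls. -/
inductive Reach (ρ η c₁ : ℝ) (z₀ : Blocks n) : ℕ → State n l → Prop
  | init : Reach ρ η c₁ z₀ 0 (State.start c₁ z₀ 0)
  | iterate {N : ℕ} {s : State n l} {y : Blocks n} :
      Reach ρ η c₁ z₀ N s → ¬ s.Returns P S ρ η → IsProxSweep P S s.c (s.x s.k) (s.p s.k) y →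
      Reach ρ η c₁ z₀ (N + 1) (s.next P S y)
  | newCall {N : ℕ} {s : State n l} :
      Reach ρ η c₁ z₀ N s → s.Returns P S ρ η → ¬ s.Successful P S ρ η →
      Reach ρ η c₁ z₀ N (State.start (2 * s.c) (s.x s.k) (s.p s.k))

end Algorithm

end DPADMM

end

/-!
Every block subproblem is strongly convex since `λ m ≤ 1 / 2`, so a sweep is well defined, and it
decreases a potential (the augmented Lagrangian corrected by a multiple of `‖p‖²`) by at least a
multiple of `‖v‖² / (κ₀² + κ₅ c)`. The residual `v` makes `∇f + A^* q + v` a subgradient condition;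
testing it at the interior feasible point `z_†` bounds the component of `q` in the range of `A` by
`K_h + G_f + ‖v‖` up to the factor `D_† / (d_† σ_A^+)`. Hence the multipliers are at first of order
`c`, but, once the decrease of the potential has made the residuals small on average, of order `1`
on average; from there on the potential varies by `O(Δ_φ + 1 / c)` only, and both averages in the
ergodic test become small after `O(1 + c / ε² + c²)` iterations.

When a call fails, the ergodic test at its last iteration `k` has infeasibility weight
`√(c³ / k) < 1`, for otherwise one of the averaged iterates would have been successful. So
`c³ < k` bounds the largest penalty parameter, and the costs of the calls form a geometric sum.
-/

noncomputable section

namespace DPADMM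

/-! ### Scalar analysis of one call -/

section WindowSums

theorem sum_le_card_mul_of_sum_sq_le {ι : Type*} (s : Finset ι) (V : ι → ℝ) {r : ℝ}
    (hr : 0 ≤ r) (h : ∑ i ∈ s, V i ^ 2 ≤ s.card * r ^ 2) : ∑ i ∈ s, V i ≤ s.card * r := by
  refine (abs_le_of_sq_le_sq' ?_ (by positivity)).2
  calc (∑ i ∈ s, V i) ^ 2 ≤ s.card * ∑ i ∈ s, V i ^ 2 := sq_sum_le_card_mul_sum_sq
    _ ≤ s.card * (s.card * r ^ 2) := by gcongr
    _ = (s.card * r) ^ 2 := by ring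

theorem theta_mul_sum_le_of_succ_le {a b : ℕ → ℝ} {θ : ℝ}
    (h : ∀ i, a (i + 1) ≤ (1 - θ) * a i + b (i + 1)) (j L : ℕ) :
    θ * ∑ i ∈ Finset.range L, a (j + i + 1) ≤
      (1 - θ) * (a j - a (j + L)) + ∑ i ∈ Finset.range L, b (j + i + 1) := by
  induction L with
  | zero => simp
  | succ L ih =>
    rw [Finset.sum_range_succ, Finset.sum_range_succ, ← add_assoc j L 1]
    linarith [h (j + L)]

theorem sum_range_two_mul {M : Type*} [AddCommMonoid M] (f : ℕ → M) (m : ℕ) :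
    ∑ i ∈ Finset.range (2 * m), f i = ∑ i ∈ Finset.range m, (f (2 * i) + f (2 * i + 1)) := by
  induction m with
  | zero => simp
  | succ m ih => rw [mul_add_one, Finset.sum_range_succ, Finset.sum_range_succ,
      Finset.sum_range_succ, ih, add_assoc]

/-- The mean over the window `k / 2, …, k` that enters the unsuccessful termination test; it is a
mean only for even `k`, when the window has `k / 2 + 1` elements. -/
def windowMean (g : ℕ → ℝ) (k : ℕ) : ℝ :=
  2 / ((k : ℝ) + 2) * ∑ i ∈ Finset.Icc (k / 2) k, g i

theorem windowMean_two_mul (g : ℕ → ℝ) (j : ℕ) :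
    windowMean g (2 * (j + 1)) =
      (∑ i ∈ Finset.range (j + 2), g (j + i + 1)) / ((j + 2 : ℕ) : ℝ) := by
  have hwindow : ∑ i ∈ Finset.Icc (2 * (j + 1) / 2) (2 * (j + 1)), g i =
      ∑ i ∈ Finset.range (j + 2), g (j + i + 1) := by
    rw [Nat.mul_div_cancel_left _ two_pos, ← Finset.Ico_succ_right_eq_Icc,
      Finset.sum_Ico_eq_sum_range, Nat.succ_eq_succ, Nat.succ_eq_add_one,
      show 2 * (j + 1) + 1 - (j + 1) = j + 2 by omega]
    exact Finset.sum_congr rfl fun i _ => by rw [add_right_comm]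
  rw [windowMean, hwindow]
  push_cast
  field_simp
  ring

theorem windowMean_two_mul_le {g : ℕ → ℝ} {j : ℕ} {r : ℝ}
    (h : ∑ i ∈ Finset.range (j + 2), g (j + i + 1) ≤ ((j + 2 : ℕ) : ℝ) * r) :
    windowMean g (2 * (j + 1)) ≤ r := by
  rw [windowMean_two_mul, div_le_iff₀' (by positivity)]
  exact h

theorem windowMean_nonneg {g : ℕ → ℝ} (hg : ∀ i, 0 ≤ g i) (k : ℕ) : 0 ≤ windowMean g k :=
  mul_nonneg (by positivity) (Finset.sum_nonneg fun i _ => hg i)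

theorem windowMean_add_smul (a b : ℝ) (f g : ℕ → ℝ) (k : ℕ) :
    windowMean (fun i => a * f i + b * g i) k = a * windowMean f k + b * windowMean g k := by
  simp only [windowMean, Finset.sum_add_distrib, ← Finset.mul_sum]
  ring

theorem exists_le_windowMean (g : ℕ → ℝ) {k : ℕ} (hk : Even k) :
    ∃ i ∈ Finset.Icc (k / 2) k, g i ≤ windowMean g k := by
  obtain ⟨m, rfl⟩ := even_iff_exists_two_mul.1 hk
  refine Finset.exists_le_of_sum_le (Finset.nonempty_Icc.2 (by omega)) (le_of_eq ?_)
  rw [Finset.sum_const, Nat.card_Icc, nsmul_eq_mul, windowMean,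
    show 2 * m + 1 - 2 * m / 2 = m + 1 by omega]
  push_cast
  field_simp

end WindowSums

/-- The scalar data of one call of the static method, run without its termination tests:
`multiplier i = ‖p^i‖`, `residual i = ‖v^i‖`, `infeasibility i = ‖A x^i - d‖` and the potential,
together with the estimates that couple them. Here `κ = κ₀² + κ₅ c`, `G = K_h + G_f`, and
`[lo, hi]` contains the values of `φ` on `ℋ`. -/
structure CallSequence where
  (θ χ c κ κ₁ κ₄ G lo hi : ℝ)
  (multiplier residual infeasibility potential : ℕ → ℝ)
  theta_pos : 0 < θ
  theta_le : θ ≤ 1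
  chi_pos : 0 < χ
  c_pos : 0 < c
  kappa_pos : 0 < κ
  kappa4_pos : 0 < κ₄
  G_nonneg : 0 ≤ G
  multiplier_nonneg : ∀ i, 0 ≤ multiplier i
  multiplier_le : ∀ i, multiplier i ≤ κ₁ * c
  multiplier_succ_le : ∀ i,
    multiplier (i + 1) ≤ (1 - θ) * multiplier i + 2 * θ / κ₄ * (residual (i + 1) + G)
  residual_sq_le : ∀ i, 1 ≤ i →
    residual (i + 1) ^ 2 ≤ κ / 2 * (potential i - potential (i + 1))
  infeasibility_le : ∀ i,
    χ * c * infeasibility (i + 1) ≤ multiplier i + multiplier (i + 1)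
  potential_le : ∀ i R, multiplier i ≤ R → multiplier (i + 1) ≤ R →
    potential (i + 1) ≤ hi + 2 * R ^ 2 / (χ ^ 2 * c)
  le_potential : ∀ i, lo - multiplier (i + 1) ^ 2 / (2 * χ ^ 2 * c) ≤ potential (i + 1)

namespace CallSequence

variable (T : CallSequence) {j k L m : ℕ}

/-- The bound `κ₂` on the average multiplier over a long window. -/
def κ₂ : ℝ := 1 / T.θ * (1 + 2 * T.G / T.κ₄) + 1

/-- The bound on the total decrease of the potential that follows from the a priori bound
`κ₁ c` on the multipliers alone. -/
def crudeGap : ℝ := T.hi - T.lo + 5 / 2 * T.κ₁ ^ 2 * T.c / T.χ ^ 2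

/-- The bound on the decrease of the potential after a long window, where the multipliers have
become of the order of `κ₂`. -/
def sharpGap : ℝ := T.hi - T.lo + 9 * T.κ₂ ^ 2 / (T.χ ^ 2 * T.c)

/-- A number of consecutive iterations over which the multipliers are at most `κ₂` on average. -/
def IsLongWindow (L : ℕ) : Prop :=
  2 * T.κ * T.crudeGap ≤ L * T.κ₄ ^ 2 ∧ (1 - T.θ) * (T.κ₁ * T.c) ≤ L

variable {T}

theorem IsLongWindow.mono (h : T.IsLongWindow m) (hmL : m ≤ L) : T.IsLongWindow L := by
  have hcast : (m : ℝ) ≤ L := by exact_mod_cast hmL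
  exact ⟨h.1.trans (by gcongr), h.2.trans hcast⟩

variable (T)

theorem κ₂_pos : 0 < T.κ₂ := by
  have := T.theta_pos
  have := T.kappa4_pos
  have := T.G_nonneg
  unfold κ₂
  positivity

theorem potential_antitoneOn : AntitoneOn T.potential (Set.Ici 1) :=
  antitoneOn_nat_Ici_of_succ_le fun i hi => by
    have hdecrease := (sq_nonneg _).trans (T.residual_sq_le i hi)
    exact sub_nonneg.1 (nonneg_of_mul_nonneg_right hdecrease (half_pos T.kappa_pos))

theorem sum_residual_sq_le (hj : 1 ≤ j) (L : ℕ) :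
    ∑ i ∈ Finset.range L, T.residual (j + i + 1) ^ 2 ≤
      T.κ / 2 * (T.potential j - T.potential (j + L)) :=
  calc ∑ i ∈ Finset.range L, T.residual (j + i + 1) ^ 2
      ≤ ∑ i ∈ Finset.range L, T.κ / 2 * (T.potential (j + i) - T.potential (j + (i + 1))) :=
        Finset.sum_le_sum fun i _ => T.residual_sq_le (j + i) (by omega)
    _ = T.κ / 2 * (T.potential j - T.potential (j + L)) := by
        rw [← Finset.mul_sum, Finset.sum_range_sub' (fun i => T.potential (j + i)), add_zero]

theorem sum_residual_le (hj : 1 ≤ j) {D r : ℝ} (hr : 0 ≤ r)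
    (hD : T.potential j - T.potential (j + L) ≤ D) (hL : T.κ / 2 * D ≤ L * r ^ 2) :
    ∑ i ∈ Finset.range L, T.residual (j + i + 1) ≤ L * r := by
  have hsq : ∑ i ∈ Finset.range L, T.residual (j + i + 1) ^ 2 ≤ L * r ^ 2 :=
    (T.sum_residual_sq_le hj L).trans <|
      (mul_le_mul_of_nonneg_left hD (half_pos T.kappa_pos).le).trans hL
  simpa only [Finset.card_range] using
    sum_le_card_mul_of_sum_sq_le (Finset.range L) (fun i => T.residual (j + i + 1)) hr
      (by simpa only [Finset.card_range] using hsq)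

theorem potential_sub_le_crudeGap (hj : 1 ≤ j) (hk : 1 ≤ k) :
    T.potential j - T.potential k ≤ T.crudeGap := by
  obtain ⟨j, rfl⟩ := Nat.exists_eq_add_of_le' hj
  obtain ⟨k, rfl⟩ := Nat.exists_eq_add_of_le' hk
  have hχ := T.chi_pos
  have hc := T.c_pos
  have hlower : T.lo - (T.κ₁ * T.c) ^ 2 / (2 * T.χ ^ 2 * T.c) ≤ T.potential (k + 1) := by
    refine le_trans ?_ (T.le_potential k)
    gcongr
    · exact T.multiplier_nonneg _
    · exact T.multiplier_le _
  have hupper := T.potential_le j _ (T.multiplier_le _) (T.multiplier_le _)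
  have hgap : T.crudeGap = T.hi + 2 * (T.κ₁ * T.c) ^ 2 / (T.χ ^ 2 * T.c)
      - (T.lo - (T.κ₁ * T.c) ^ 2 / (2 * T.χ ^ 2 * T.c)) := by
    unfold crudeGap
    field_simp
    ring
  linarith

theorem sum_multiplier_le (hL : T.IsLongWindow L) (hj : 1 ≤ j) :
    ∑ i ∈ Finset.range L, T.multiplier (j + i + 1) ≤ L * T.κ₂ := by
  have hθ := T.theta_pos
  have hκ₄ := T.kappa4_pos
  have hresidual : ∑ i ∈ Finset.range L, T.residual (j + i + 1) ≤ L * (T.κ₄ / 2) :=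
    T.sum_residual_le hj (half_pos hκ₄).le (T.potential_sub_le_crudeGap hj (by omega))
      (by linarith [hL.1])
  have hboundary : (1 - T.θ) * (T.multiplier j - T.multiplier (j + L)) ≤ L := by
    refine le_trans (mul_le_mul_of_nonneg_left ?_ (sub_nonneg.2 T.theta_le)) hL.2
    linarith [T.multiplier_le j, T.multiplier_nonneg (j + L)]
  have hsource : ∑ i ∈ Finset.range L, 2 * T.θ / T.κ₄ * (T.residual (j + i + 1) + T.G) ≤
      T.θ * L + T.θ * L * (2 * T.G / T.κ₄) := by
    rw [← Finset.mul_sum, Finset.sum_add_distrib, Finset.sum_const, Finset.card_range,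
      nsmul_eq_mul]
    calc _ ≤ 2 * T.θ / T.κ₄ * (L * (T.κ₄ / 2) + L * T.G) := by gcongr
      _ = _ := by field_simp
  have hG : T.θ * L * (2 * T.G / T.κ₄) ≤ L * (2 * T.G / T.κ₄) := by
    have := T.G_nonneg
    gcongr
    exact mul_le_of_le_one_left (Nat.cast_nonneg L) T.theta_le
  refine le_of_mul_le_mul_left ?_ hθ
  calc _ ≤ _ := theta_mul_sum_le_of_succ_le
        (b := fun i => 2 * T.θ / T.κ₄ * (T.residual i + T.G)) T.multiplier_succ_le j L
    _ ≤ L + (T.θ * L + L * (2 * T.G / T.κ₄)) := by linarith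
    _ = T.θ * (L * T.κ₂) := by unfold κ₂; field_simp; ring

theorem exists_isLongWindow : ∃ L, 1 ≤ L ∧ T.IsLongWindow L := by
  have hκ₄ := T.kappa4_pos
  obtain ⟨L, hL⟩ := exists_nat_ge
    (max (2 * T.κ * T.crudeGap / T.κ₄ ^ 2) ((1 - T.θ) * (T.κ₁ * T.c)))
  have hlong : T.IsLongWindow L :=
    ⟨(div_le_iff₀ (by positivity)).1 ((le_max_left _ _).trans hL), (le_max_right _ _).trans hL⟩
  exact ⟨L + 1, by omega, hlong.mono (by omega)⟩

theorem le_potential_of_one_le (hj : 1 ≤ j) :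
    T.lo - T.κ₂ ^ 2 / (2 * T.χ ^ 2 * T.c) ≤ T.potential j := by
  obtain ⟨L, hL1, hL⟩ := T.exists_isLongWindow
  obtain ⟨i, -, hsmall⟩ : ∃ i ∈ Finset.range L, T.multiplier (j + i + 1) ≤ T.κ₂ :=
    Finset.exists_le_of_sum_le (Finset.nonempty_range_iff.2 (by omega)) <| by
      simpa only [Finset.sum_const, Finset.card_range, nsmul_eq_mul]
        using T.sum_multiplier_le hL hj
  have hc := T.c_pos
  have hχ := T.chi_pos
  calc T.lo - T.κ₂ ^ 2 / (2 * T.χ ^ 2 * T.c)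
      ≤ T.lo - T.multiplier (j + i + 1) ^ 2 / (2 * T.χ ^ 2 * T.c) := by
        gcongr
        exact T.multiplier_nonneg _
    _ ≤ T.potential (j + i + 1) := T.le_potential (j + i)
    _ ≤ T.potential j := T.potential_antitoneOn (Set.mem_Ici.2 hj)
        (Set.mem_Ici.2 (by omega)) (by omega)

/-- The upper bound for the potential needs two consecutive small multipliers, which is why the
window `2, …, 2 m + 1` is cut into pairs. -/
theorem potential_le_of_isLongWindow (hm : 1 ≤ m) (hlong : T.IsLongWindow m)
    (hk : 2 * m + 1 ≤ k) : T.potential k ≤ T.hi + 8 * T.κ₂ ^ 2 / (T.χ ^ 2 * T.c) := by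
  have hsum := T.sum_multiplier_le (hlong.mono (show m ≤ 2 * m by omega)) le_rfl
  rw [sum_range_two_mul] at hsum
  obtain ⟨i, hi, hsmall⟩ : ∃ i ∈ Finset.range m,
      T.multiplier (1 + 2 * i + 1) + T.multiplier (1 + (2 * i + 1) + 1) ≤ 2 * T.κ₂ := by
    refine Finset.exists_le_of_sum_le (Finset.nonempty_range_iff.2 (by omega))
      (hsum.trans (le_of_eq ?_))
    rw [Finset.sum_const, Finset.card_range, nsmul_eq_mul]
    push_cast
    ring
  have hi := Finset.mem_range.1 hi
  have hpair := T.potential_le (1 + 2 * i + 1) (2 * T.κ₂)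
    (by linarith [T.multiplier_nonneg (1 + (2 * i + 1) + 1)])
    (by
      rw [show 1 + 2 * i + 1 + 1 = 1 + (2 * i + 1) + 1 by ring]
      linarith [T.multiplier_nonneg (1 + 2 * i + 1)])
  calc T.potential k ≤ T.potential (1 + 2 * i + 1 + 1) :=
        T.potential_antitoneOn (Set.mem_Ici.2 (by omega)) (Set.mem_Ici.2 (by omega)) (by omega)
    _ ≤ _ := hpair
    _ = _ := by ring

theorem potential_sub_le_sharpGap (hm : 1 ≤ m) (hlong : T.IsLongWindow m) (hj : 2 * m + 1 ≤ j)
    (hk : 1 ≤ k) : T.potential j - T.potential k ≤ T.sharpGap := by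
  have hc := T.c_pos
  have hχ := T.chi_pos
  have hupper := T.potential_le_of_isLongWindow hm hlong hj
  have hlower := T.le_potential_of_one_le hk
  have hslack : T.κ₂ ^ 2 / (2 * T.χ ^ 2 * T.c) ≤ T.κ₂ ^ 2 / (T.χ ^ 2 * T.c) := by
    gcongr
    linarith [sq_nonneg T.χ]
  rw [mul_div_assoc] at hupper
  rw [sharpGap, mul_div_assoc]
  linarith

theorem windowMean_residual_le (hm : 1 ≤ m) (hlong : T.IsLongWindow m) (hj : 2 * m + 1 ≤ j)
    {r : ℝ} (hr : 0 ≤ r) (hjr : T.κ / 2 * T.sharpGap ≤ (j + 1 : ℕ) * r ^ 2) :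
    windowMean T.residual (2 * (j + 1)) ≤ r := by
  refine windowMean_two_mul_le (T.sum_residual_le (by omega) hr
    (T.potential_sub_le_sharpGap hm hlong hj (by omega)) (hjr.trans ?_))
  gcongr
  omega

theorem windowMean_infeasibility_le (hm : T.IsLongWindow m) (hj : 2 ≤ j) (hmj : m ≤ j + 2) :
    windowMean T.infeasibility (2 * (j + 1)) ≤ 2 * T.κ₂ / (T.χ * T.c) := by
  have hc := T.c_pos
  have hχ := T.chi_pos
  obtain ⟨j, rfl⟩ := Nat.exists_eq_add_of_le' (show 1 ≤ j by omega)
  have hlong := hm.mono hmj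
  have hsum : T.χ * T.c * ∑ i ∈ Finset.range (j + 1 + 2), T.infeasibility (j + 1 + i + 1) ≤
      ∑ i ∈ Finset.range (j + 1 + 2), T.multiplier (j + i + 1) +
        ∑ i ∈ Finset.range (j + 1 + 2), T.multiplier (j + 1 + i + 1) := by
    rw [Finset.mul_sum, ← Finset.sum_add_distrib]
    refine Finset.sum_le_sum fun i _ => ?_
    rw [add_right_comm j i 1]
    exact T.infeasibility_le (j + 1 + i)
  refine windowMean_two_mul_le ?_
  rw [← mul_div_assoc, le_div_iff₀ (by positivity)]
  linarith [T.sum_multiplier_le hlong (show 1 ≤ j by omega),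
    T.sum_multiplier_le hlong (show 1 ≤ j + 1 by omega)]

theorem sqrt_c_cube_div_le {η : ℝ} (hη : 0 < η) {k : ℕ} (hk : 1 ≤ k)
    (hkη : 8 * T.κ₂ ^ 2 * T.c ≤ k * (T.χ ^ 2 * η ^ 2)) :
    Real.sqrt (T.c ^ 3 / ((2 * k : ℕ) : ℝ)) ≤ η * T.χ * T.c / (4 * T.κ₂) := by
  have hc := T.c_pos
  have hχ := T.chi_pos
  have hκ₂ := T.κ₂_pos
  have : (0 : ℝ) < k := by exact_mod_cast hk
  rw [Real.sqrt_le_left (by positivity), Nat.cast_mul, Nat.cast_two, div_le_iff₀ (by positivity),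
    div_pow, div_mul_eq_mul_div, le_div_iff₀ (by positivity)]
  linarith [mul_le_mul_of_nonneg_right hkη (by positivity : 0 ≤ 2 * T.c ^ 2)]

theorem ergodic_test_le_one (hm : 1 ≤ m) (hlong : T.IsLongWindow m) (hk : 2 * m + 2 ≤ k)
    {ρ η : ℝ} (hρ : 0 < ρ) (hη : 0 < η)
    (hkρ : 2 * T.κ * T.sharpGap ≤ k * ρ ^ 2)
    (hkη : 8 * T.κ₂ ^ 2 * T.c ≤ k * (T.χ ^ 2 * η ^ 2)) :
    1 / ρ * windowMean T.residual (2 * k)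
      + 1 / η * Real.sqrt (T.c ^ 3 / ((2 * k : ℕ) : ℝ)) * windowMean T.infeasibility (2 * k)
      ≤ 1 := by
  have hc := T.c_pos
  have hχ := T.chi_pos
  have hκ₂ := T.κ₂_pos
  obtain ⟨j, rfl⟩ := Nat.exists_eq_add_of_le' (show 1 ≤ k by omega)
  have hresidual : windowMean T.residual (2 * (j + 1)) ≤ ρ / 2 :=
    T.windowMean_residual_le hm hlong (by omega) (half_pos hρ).le (by linarith)
  have hinfeasibility := T.windowMean_infeasibility_le hlong (show 2 ≤ j by omega) (by omega)
  have hsqrt := T.sqrt_c_cube_div_le hη (by omega) hkη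
  calc _ ≤ 1 / ρ * (ρ / 2) + 1 / η * Real.sqrt (T.c ^ 3 / ((2 * (j + 1) : ℕ) : ℝ)) *
          (2 * T.κ₂ / (T.χ * T.c)) := by gcongr
    _ ≤ 1 / ρ * (ρ / 2)
        + 1 / η * (η * T.χ * T.c / (4 * T.κ₂)) * (2 * T.κ₂ / (T.χ * T.c)) := by gcongr
    _ = 1 := by
        field_simp
        norm_num

theorem crudeGap_nonneg : 0 ≤ T.crudeGap := by
  simpa only [sub_self] using T.potential_sub_le_crudeGap (le_refl 1) (le_refl 1)

theorem sharpGap_nonneg : 0 ≤ T.sharpGap := by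
  obtain ⟨m, hm, hlong⟩ := T.exists_isLongWindow
  simpa only [sub_self] using
    T.potential_sub_le_sharpGap hm hlong le_rfl (show 1 ≤ 2 * m + 1 by omega)

theorem exists_even_ergodic_test_le_one {ρ η : ℝ} (hρ : 0 < ρ) (hη : 0 < η) :
    ∃ k : ℕ, Even k ∧ 3 ≤ k ∧
      1 / ρ * windowMean T.residual k
        + 1 / η * Real.sqrt (T.c ^ 3 / (k : ℝ)) * windowMean T.infeasibility k ≤ 1 ∧
      (k : ℝ) ≤ 18
        + 4 * (2 * T.κ * T.crudeGap / T.κ₄ ^ 2 + (1 - T.θ) * (T.κ₁ * T.c))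
        + 2 * (2 * T.κ * T.sharpGap / ρ ^ 2)
        + 2 * (8 * T.κ₂ ^ 2 * T.c / (T.χ ^ 2 * η ^ 2)) := by
  have hχ := T.chi_pos
  have hc := T.c_pos
  have hκ := T.kappa_pos
  have hκ₄ := T.kappa4_pos
  have hgap := T.crudeGap_nonneg
  have hgap' := T.sharpGap_nonneg
  have hY₀ : 0 ≤ 2 * T.κ * T.sharpGap / ρ ^ 2 := by positivity
  have hW₀ : 0 ≤ 8 * T.κ₂ ^ 2 * T.c / (T.χ ^ 2 * η ^ 2) := by positivity
  set X₁ := 2 * T.κ * T.crudeGap / T.κ₄ ^ 2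
  set X₂ := (1 - T.θ) * (T.κ₁ * T.c)
  set Y := 2 * T.κ * T.sharpGap / ρ ^ 2
  set W := 8 * T.κ₂ ^ 2 * T.c / (T.χ ^ 2 * η ^ 2)
  have hX₁ : 0 ≤ X₁ := by positivity
  have hX₂ : 0 ≤ X₂ := mul_nonneg (sub_nonneg.2 T.theta_le)
    ((T.multiplier_nonneg 0).trans (T.multiplier_le 0))
  have hX_ceil := (Nat.ceil_lt_add_one (add_nonneg hX₁ hX₂)).le
  have hY_ceil := (Nat.ceil_lt_add_one hY₀).le
  have hW_ceil := (Nat.ceil_lt_add_one hW₀).le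
  obtain ⟨m, hm⟩ : ∃ m, m = ⌈X₁ + X₂⌉₊ + 1 := ⟨_, rfl⟩
  obtain ⟨k, hk⟩ : ∃ k, k = 2 * m + 3 + ⌈Y⌉₊ + ⌈W⌉₊ := ⟨_, rfl⟩
  have hmX : X₁ + X₂ ≤ m := Nat.ceil_le.1 (by omega)
  have hkY : Y ≤ k := Nat.ceil_le.1 (by omega)
  have hkW : W ≤ k := Nat.ceil_le.1 (by omega)
  have hlong : T.IsLongWindow m :=
    ⟨(div_le_iff₀ (by positivity)).1 (by linarith), by linarith⟩
  refine ⟨2 * k, even_two_mul k, by omega,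
    T.ergodic_test_le_one (by omega) hlong (by omega) hρ hη
      ((div_le_iff₀ (by positivity)).1 hkY) ((div_le_iff₀ (by positivity)).1 hkW), ?_⟩
  rw [hk, hm]
  push_cast
  linarith

end CallSequence

/-! ### Linear algebra and convex analysis -/

section SingularValues

variable {E F : Type*} [NormedAddCommGroup E] [InnerProductSpace ℝ E] [FiniteDimensional ℝ E]
  [NormedAddCommGroup F] [InnerProductSpace ℝ F] [FiniteDimensional ℝ F]

theorem mul_norm_le_norm_adjoint_of_le_singularValues (T : E →ₗ[ℝ] F) {σ : ℝ} (hσ : 0 ≤ σ)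
    (h : ∀ i, 0 < T.singularValues i → σ ≤ T.singularValues i) (x : E) :
    σ * ‖T x‖ ≤ ‖LinearMap.adjoint T (T x)‖ := by
  set hT := T.isSymmetric_adjoint_comp_self
  set b := hT.eigenvectorBasis rfl
  set μ := hT.eigenvalues rfl
  have hinner : ∀ i, inner ℝ (b i) (LinearMap.adjoint T (T x)) = μ i * inner ℝ (b i) x := by
    intro i
    have hrepr := hT.eigenvectorBasis_apply_self_apply rfl x i
    rw [OrthonormalBasis.repr_apply_apply, OrthonormalBasis.repr_apply_apply] at hrepr
    simpa using hrepr
  have hadjoint : ‖LinearMap.adjoint T (T x)‖ ^ 2 = ∑ i, (μ i * inner ℝ (b i) x) ^ 2 := by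
    simp only [← b.sum_sq_norm_inner_right, hinner, Real.norm_eq_abs, sq_abs]
  have himage : ‖T x‖ ^ 2 = ∑ i, μ i * inner ℝ (b i) x ^ 2 := by
    rw [← real_inner_self_eq_norm_sq, ← LinearMap.adjoint_inner_right, ← b.sum_inner_mul_inner]
    refine Finset.sum_congr rfl fun i _ => ?_
    rw [hinner, real_inner_comm]
    ring
  refine (abs_le_of_sq_le_sq' ?_ (norm_nonneg _)).2
  rw [mul_pow, hadjoint, himage, Finset.mul_sum]
  refine Finset.sum_le_sum fun i _ => ?_
  have hsq : T.singularValues i ^ 2 = μ i := T.sq_singularValues_fin rfl i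
  rcases (T.singularValues_nonneg i).eq_or_lt with hzero | hpos
  · simp [← hsq, ← hzero]
  · have hσμ : σ ^ 2 ≤ μ i := hsq ▸ pow_le_pow_left₀ hσ (h i hpos) 2
    have hμ : 0 ≤ μ i := hsq ▸ sq_nonneg _
    calc σ ^ 2 * (μ i * inner ℝ (b i) x ^ 2) ≤ μ i * (μ i * inner ℝ (b i) x ^ 2) := by gcongr
      _ = (μ i * inner ℝ (b i) x) ^ 2 := by ring

end SingularValues

section ConvexAnalysis

variable {E : Type*} [NormedAddCommGroup E] [InnerProductSpace ℝ E]

/-- Test the subgradient inequality at the point `z + r ξ / ‖ξ‖` of the ball. -/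
theorem mul_norm_subgradient_le {g : E → ℝ} {s : Set E} {K r : ℝ} {z x ξ : E}
    (hr : 0 ≤ r) (hball : Metric.closedBall z r ⊆ s) (hK : 0 ≤ K)
    (hlip : ∀ u ∈ s, g u - g x ≤ K * ‖u - x‖)
    (hξ : ∀ u ∈ s, g x + inner ℝ ξ (u - x) ≤ g u) :
    r * ‖ξ‖ ≤ (r + ‖x - z‖) * K + inner ℝ ξ (x - z) := by
  rcases eq_or_ne ξ 0 with rfl | hξ0
  · rw [norm_zero, mul_zero, inner_zero_left, add_zero]
    positivity
  have hξpos : 0 < ‖ξ‖ := norm_pos_iff.2 hξ0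
  set δ := (r / ‖ξ‖) • ξ with hδ
  have hδnorm : ‖δ‖ = r := by
    rw [hδ, norm_smul, Real.norm_of_nonneg (by positivity), div_mul_cancel₀ _ hξpos.ne']
  have hmem : z + δ ∈ s := hball (by rw [mem_closedBall_iff_norm, add_sub_cancel_left, hδnorm])
  have hsplit : z + δ - x = δ - (x - z) := by abel
  have hdist : K * ‖z + δ - x‖ ≤ K * (r + ‖x - z‖) := by
    gcongr
    rw [hsplit]
    exact (norm_sub_le _ _).trans_eq (by rw [hδnorm])
  have hinner : inner ℝ ξ (z + δ - x) = r * ‖ξ‖ - inner ℝ ξ (x - z) := by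
    rw [hsplit, inner_sub_right, hδ, inner_smul_right, real_inner_self_eq_norm_sq]
    field_simp
  linarith [hlip _ hmem, hξ _ hmem]

theorem ball_infDist_frontier_subset {E : Type*} [SeminormedAddCommGroup E] [NormedSpace ℝ E]
    {s : Set E} {z : E} (hz : z ∈ s) : Metric.ball z (Metric.infDist z (frontier s)) ⊆ s := by
  set b := Metric.ball z (Metric.infDist z (frontier s))
  rcases b.eq_empty_or_nonempty with hempty | hne
  · exact hempty ▸ Set.empty_subset s
  have havoid : ∀ w ∈ b, w ∉ frontier s := fun w hw => Metric.ball_infDist_subset_compl hw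
  have hcover : b ⊆ interior s ∪ (closure s)ᶜ := fun w hw =>
    or_iff_not_imp_right.2 fun hw' => by_contra fun hint => havoid w hw ⟨not_not.1 hw', hint⟩
  have hzb : z ∈ b := Metric.mem_ball_self (Metric.nonempty_ball.1 hne)
  have hdisjoint : Disjoint (interior s) (closure s)ᶜ :=
    Set.disjoint_compl_right_iff_subset.2 (interior_subset.trans subset_closure)
  refine ((convex_ball _ _).isPreconnected.subset_left_of_subset_union isOpen_interior
    isClosed_closure.isOpen_compl hdisjoint hcover ⟨z, hzb, ?_⟩).trans interior_subset
  exact (hcover hzb).resolve_right (not_not.2 (subset_closure hz))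

theorem sum_ne_bot {ι : Type*} (s : Finset ι) {g : ι → EReal} (h : ∀ i, g i ≠ ⊥) :
    ∑ i ∈ s, g i ≠ ⊥ :=
  Finset.sum_induction g (· ≠ ⊥) (fun _ _ ha hb => by simp [EReal.add_eq_bot_iff, ha, hb])
    EReal.zero_ne_bot fun i _ => h i

theorem coe_sum_ereal {ι : Type*} (s : Finset ι) (g : ι → ℝ) :
    ((∑ i ∈ s, g i : ℝ) : EReal) = ∑ i ∈ s, (g i : EReal) :=
  map_sum (⟨⟨Real.toEReal, EReal.coe_zero⟩, EReal.coe_add⟩ : ℝ →+ EReal) g s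

namespace IsClosedProperConvex

variable {E : Type*} [NormedAddCommGroup E] [NormedSpace ℝ E] {g : E → EReal}

theorem coe_toReal (hg : IsClosedProperConvex g) {u : E} (hu : g u < ⊤) :
    ((g u).toReal : EReal) = g u :=
  EReal.coe_toReal hu.ne (hg.ne_bot u)

theorem convexOn_toReal (hg : IsClosedProperConvex g) :
    ConvexOn ℝ {u | g u < ⊤} fun u => (g u).toReal := by
  have hle : ∀ u, g u < ⊤ → ∀ v, g v < ⊤ → ∀ a b : ℝ, 0 ≤ a → 0 ≤ b → a + b = 1 →
      g (a • u + b • v) ≤ ((a * (g u).toReal + b * (g v).toReal : ℝ) : EReal) := by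
    intro u hu v hv a b ha hb hab
    simpa using hg.convex_epigraph (x := (u, (g u).toReal)) (y := (v, (g v).toReal))
      (hg.coe_toReal hu).ge (hg.coe_toReal hv).ge ha hb hab
  have hconvex : Convex ℝ {u | g u < ⊤} := fun u hu v hv a b ha hb hab =>
    (hle u hu v hv a b ha hb hab).trans_lt (EReal.coe_lt_top _)
  refine ⟨hconvex, fun u hu v hv a b ha hb hab => EReal.coe_le_coe_iff.1 ?_⟩
  rw [hg.coe_toReal (hconvex hu hv ha hb hab)]
  exact hle u hu v hv a b ha hb hab

end IsClosedProperConvex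

end ConvexAnalysis

/-! ### Block vectors -/

section Splice

variable {B : ℕ} {n : Fin B → ℕ} {l : ℕ}

theorem splice_apply_self (y : Blocks n) (t : Fin B) (u) (x : Blocks n) :
    splice y t u x t = u := by
  simp [splice]

theorem splice_self_apply_ne (w : Blocks n) {s t : Fin B} (h : s ≠ t) (u) :
    splice w t u w s = w s := by
  simp [splice, h]

theorem splice_self_self (w : Blocks n) (t : Fin B) : splice w t (w t) w = w := by
  ext s : 1
  by_cases h : s = t
  · subst h; exact splice_apply_self ..
  · exact splice_self_apply_ne w h _

/-- The intermediate iterate `(y_1, …, y_j, x_{j+1}, …, x_B)` of a sweep from `x` to `y`. -/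
def headTail (y x : Blocks n) (j : ℕ) : Blocks n :=
  WithLp.toLp 2 fun s => if (s : ℕ) < j then y s else x s

theorem headTail_apply (y x : Blocks n) (j : ℕ) (s : Fin B) :
    headTail y x j s = if (s : ℕ) < j then y s else x s := rfl

theorem headTail_zero (y x : Blocks n) : headTail y x 0 = x := by
  ext s : 1
  simp [headTail_apply]

theorem headTail_card (y x : Blocks n) : headTail y x B = y := by
  ext s : 1
  simp [headTail_apply]

theorem headTail_apply_self (y x : Blocks n) (t : Fin B) : headTail y x t t = x t := by
  simp [headTail_apply]

theorem headTail_congr {y y' x : Blocks n} {j : ℕ} (h : ∀ s : Fin B, (s : ℕ) < j → y s = y' s) :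
    headTail y x j = headTail y' x j := by
  ext s : 1
  simp only [headTail_apply]
  split_ifs with hs
  exacts [h s hs, rfl]

theorem splice_eq_splice_headTail (y x : Blocks n) (t : Fin B) (u) :
    splice y t u x = splice (headTail y x t) t u (headTail y x t) := by
  ext s : 1
  by_cases h : s = t
  · subst h; simp [splice]
  · simp [splice, h, headTail_apply]

theorem headTail_succ (y x : Blocks n) (t : Fin B) :
    headTail y x (t + 1) = splice y t (y t) x := by
  ext s : 1
  by_cases h : s = t
  · subst h; simp [splice, headTail_apply]
  · have hle : (s : ℕ) < t + 1 ↔ s < t := by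
      rw [Nat.lt_succ_iff_lt_or_eq, Fin.lt_def, or_iff_left (fun h' => h (Fin.ext h'))]
    simp [splice, headTail_apply, h, hle]

theorem splice_eq_add_single (w : Blocks n) (t : Fin B) (u v) :
    splice w t u w = splice w t v w + PiLp.single 2 t (u - v) := by
  ext s : 1
  by_cases h : s = t
  · subst h; simp [splice]
  · simp [splice, h]

theorem inner_single_right (x : Blocks n) (t : Fin B) (δ) :
    inner ℝ x (PiLp.single 2 t δ) = inner ℝ (x t) δ := by
  rw [PiLp.inner_apply, Finset.sum_eq_single t]
  · rw [PiLp.single_eq_same]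
  · intro s _ h
    rw [PiLp.single_eq_of_ne 2 h, inner_zero_right]
  · simp

end Splice

namespace Problem

variable {B : ℕ} {n : Fin B → ℕ} {l : ℕ} (P : Problem B n l)

theorem A_apply (x : Blocks n) : P.A x = ∑ t, P.ABlock t (x t) := by
  simp [Problem.A]

theorem A_single (t : Fin B) (δ) : P.A (PiLp.single 2 t δ) = P.ABlock t δ := by
  rw [P.A_apply, Finset.sum_eq_single t]
  · rw [PiLp.single_eq_same]
  · intro s _ h
    rw [PiLp.single_eq_of_ne 2 h, map_zero]
  · simp

theorem A_splice (w : Blocks n) (t : Fin B) (u v) :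
    P.A (splice w t u w) = P.A (splice w t v w) + P.ABlock t (u - v) := by
  rw [splice_eq_add_single w t u v, map_add, P.A_single]

theorem adjoint_A_apply (q) (t : Fin B) :
    ContinuousLinearMap.adjoint P.A q t = ContinuousLinearMap.adjoint (P.ABlock t) q := by
  refine ext_inner_right ℝ fun δ => ?_
  rw [← inner_single_right, ContinuousLinearMap.adjoint_inner_left, P.A_single,
    ContinuousLinearMap.adjoint_inner_left]

theorem norm_A_sq_le (x : Blocks n) : ‖P.A x‖ ^ 2 ≤ B * ∑ t, ‖P.ABlock t (x t)‖ ^ 2 := by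
  rw [P.A_apply]
  calc ‖∑ t, P.ABlock t (x t)‖ ^ 2 ≤ (∑ t, ‖P.ABlock t (x t)‖) ^ 2 :=
        pow_le_pow_left₀ (norm_nonneg _) (norm_sum_le _ _) 2
    _ ≤ B * ∑ t, ‖P.ABlock t (x t)‖ ^ 2 := by
        simpa using sq_sum_le_card_mul_sum_sq (s := Finset.univ) (f := fun t => ‖P.ABlock t (x t)‖)

variable {P}

theorem splice_mem_dom {w : Blocks n} {t : Fin B} {u} (hw : w ∈ P.dom) (hu : u ∈ P.domBlock t) :
    splice w t u w ∈ P.dom := by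
  intro s
  by_cases hs : s = t
  · subst hs; rwa [splice_apply_self]
  · rw [splice_self_apply_ne w hs]
    exact hw s

theorem headTail_mem_dom {y x : Blocks n} (hy : y ∈ P.dom) (hx : x ∈ P.dom) (j : ℕ) :
    headTail y x j ∈ P.dom := by
  intro s
  rw [headTail_apply]
  split_ifs
  exacts [hy s, hx s]

theorem dom_eq_image_pi : P.dom = WithLp.toLp 2 '' Set.univ.pi P.domBlock := by
  ext x
  refine ⟨fun hx => ⟨x.ofLp, fun t _ => hx t, rfl⟩, ?_⟩
  rintro ⟨y, hy, rfl⟩ t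
  exact hy t trivial

end Problem

/-! ### Consequences of the standing assumptions -/

section Domain

variable {B : ℕ} {n : Fin B → ℕ} {l : ℕ} {P : Problem B n l} {K : Moduli n}

theorem Moduli.mBlock_le (K : Moduli n) (t : Fin B) : K.mBlock t ≤ K.m :=
  le_ciSup (Set.finite_range K.mBlock).bddAbove t

theorem Moduli.MBlock_le (K : Moduli n) (t : Fin B) : K.MBlock t ≤ K.M :=
  le_ciSup (Set.finite_range K.MBlock).bddAbove t

section SigmaPlus

variable (P)

theorem sigmaPlus_nonneg : 0 ≤ sigmaPlus P :=
  Real.sInf_nonneg fun _ hs => hs.1.le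

theorem sigmaPlus_le {i : ℕ}
    (hi : 0 < (P.A : Blocks n →ₗ[ℝ] EuclideanSpace ℝ (Fin l)).singularValues i) :
    sigmaPlus P ≤ (P.A : Blocks n →ₗ[ℝ] EuclideanSpace ℝ (Fin l)).singularValues i :=
  csInf_le ⟨0, fun _ hs => hs.1.le⟩ ⟨hi, i, rfl⟩

theorem sigmaPlus_mul_norm_le (x : Blocks n) :
    sigmaPlus P * ‖P.A x‖ ≤ ‖ContinuousLinearMap.adjoint P.A (P.A x)‖ :=
  mul_norm_le_norm_adjoint_of_le_singularValues
    (P.A : Blocks n →ₗ[ℝ] EuclideanSpace ℝ (Fin l)) (sigmaPlus_nonneg P)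
    (fun _ => sigmaPlus_le P) x

variable {P}

/-- The singular values have finite support, so the infimum defining `σ_A^+` is attained. -/
theorem sigmaPlus_pos (hA : P.A ≠ 0) : 0 < sigmaPlus P := by
  set T := (P.A : Blocks n →ₗ[ℝ] EuclideanSpace ℝ (Fin l)) with hT
  have hfinite : {s : ℝ | 0 < s ∧ ∃ i : ℕ, T.singularValues i = s}.Finite := by
    refine (T.singularValues.support.finite_toSet.image T.singularValues).subset ?_
    rintro _ ⟨hpos, i, rfl⟩
    exact ⟨i, Finsupp.mem_support_iff.2 hpos.ne', rfl⟩
  have hT0 : T.singularValues ≠ 0 := by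
    rw [Ne, LinearMap.singularValues_eq_zero_iff, hT]
    exact fun h => hA (ContinuousLinearMap.coe_injective h)
  obtain ⟨i, hi⟩ := Finsupp.ne_iff.1 hT0
  have hnonempty : {s : ℝ | 0 < s ∧ ∃ i : ℕ, T.singularValues i = s}.Nonempty :=
    ⟨_, (T.singularValues_pos_iff_ne_zero i).2 hi, i, rfl⟩
  exact (hnonempty.csInf_mem hfinite).1

end SigmaPlus

namespace Assumptions

theorem coe_toReal_hBlock (hP : Assumptions P K) {t : Fin B} {u} (hu : u ∈ P.domBlock t) :
    ((P.hBlock t u).toReal : EReal) = P.hBlock t u :=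
  (hP.closedConvex t).coe_toReal hu

theorem convexOn_hBlock (hP : Assumptions P K) (t : Fin B) :
    ConvexOn ℝ (P.domBlock t) fun u => (P.hBlock t u).toReal :=
  (hP.closedConvex t).convexOn_toReal

theorem h_eq (hP : Assumptions P K) {x : Blocks n} (hx : x ∈ P.dom) :
    P.h x = ((∑ t, (P.hBlock t (x t)).toReal : ℝ) : EReal) := by
  rw [Problem.h, coe_sum_ereal]
  exact Finset.sum_congr rfl fun t _ => (hP.coe_toReal_hBlock (hx t)).symm

theorem toReal_h (hP : Assumptions P K) {x : Blocks n} (hx : x ∈ P.dom) :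
    (P.h x).toReal = ∑ t, (P.hBlock t (x t)).toReal := by
  rw [hP.h_eq hx, EReal.toReal_coe]

theorem coe_toReal_h (hP : Assumptions P K) {x : Blocks n} (hx : x ∈ P.dom) :
    ((P.h x).toReal : EReal) = P.h x := by
  rw [hP.toReal_h hx, hP.h_eq hx]

theorem h_eq_top (hP : Assumptions P K) {x : Blocks n} (hx : x ∉ P.dom) : P.h x = ⊤ := by
  obtain ⟨t, ht⟩ := not_forall.1 hx
  have htop : P.hBlock t (x t) = ⊤ := not_lt_top_iff.1 ht
  rw [Problem.h, ← Finset.add_sum_erase _ _ (Finset.mem_univ t), htop]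
  exact EReal.top_add_of_ne_bot (sum_ne_bot _ fun i => (hP.closedConvex i).ne_bot _)

theorem isCompact_dom (hP : Assumptions P K) : IsCompact P.dom := by
  rw [Problem.dom_eq_image_pi]
  exact (isCompact_univ_pi hP.compactDom).image (PiLp.continuous_toLp 2 _)

theorem zdag_mem_dom (hP : Assumptions P K) : K.zdag ∈ P.dom := hP.zdag_feasible.1

theorem ddag_pos (hP : Assumptions P K) : 0 < ddag P K := hP.zdag_interior

theorem closedBall_subset_dom (hP : Assumptions P K) :
    Metric.closedBall K.zdag (ddag P K) ⊆ P.dom := by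
  rw [← closure_ball _ hP.ddag_pos.ne']
  exact closure_minimal (ball_infDist_frontier_subset hP.zdag_mem_dom) hP.isCompact_dom.isClosed

theorem hasFDerivWithinAt_f (hP : Assumptions P K) {x : Blocks n} (hx : x ∈ P.dom) :
    HasFDerivWithinAt P.f (InnerProductSpace.toDual ℝ _ (P.grad x)) P.dom x :=
  (hP.f_differentiable x hx).hasGradientWithinAt.hasFDerivWithinAt

theorem continuousOn_toReal_h (hP : Assumptions P K) :
    ContinuousOn (fun x => (P.h x).toReal) P.dom :=
  (LipschitzOnWith.of_dist_le_mul (K := ⟨K.Kh, hP.Kh_nonneg⟩) fun x hx y hy => by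
    rw [Real.dist_eq, dist_eq_norm]
    exact hP.h_lipschitz x hx y hy).continuousOn

theorem continuousOn_phi (hP : Assumptions P K) : ContinuousOn P.phi P.dom :=
  hP.f_differentiable.continuousOn.add hP.continuousOn_toReal_h

theorem phi_le_sSup (hP : Assumptions P K) {x : Blocks n} (hx : x ∈ P.dom) :
    P.phi x ≤ sSup (P.phi '' P.dom) :=
  le_csSup (hP.isCompact_dom.image_of_continuousOn hP.continuousOn_phi).bddAbove
    (Set.mem_image_of_mem _ hx)

theorem sInf_le_phi (hP : Assumptions P K) {x : Blocks n} (hx : x ∈ P.dom) :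
    sInf (P.phi '' P.dom) ≤ P.phi x :=
  csInf_le (hP.isCompact_dom.image_of_continuousOn hP.continuousOn_phi).bddBelow
    (Set.mem_image_of_mem _ hx)

theorem deltaPhi_nonneg (hP : Assumptions P K) : 0 ≤ deltaPhi P :=
  sub_nonneg.2 ((hP.sInf_le_phi hP.zdag_mem_dom).trans (hP.phi_le_sSup hP.zdag_mem_dom))

theorem norm_sub_zdag_le (hP : Assumptions P K) {x : Blocks n} (hx : x ∈ P.dom) :
    ‖x - K.zdag‖ ≤ Ddag P K :=
  le_csSup (hP.isCompact_dom.image (by fun_prop)).bddAbove ⟨x, hx, rfl⟩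

theorem norm_grad_le (hP : Assumptions P K) {x : Blocks n} (hx : x ∈ P.dom) :
    ‖P.grad x‖ ≤ Gf P :=
  le_csSup hP.grad_bounded ⟨x, hx, rfl⟩

theorem Gf_nonneg (hP : Assumptions P K) : 0 ≤ Gf P :=
  (norm_nonneg _).trans (hP.norm_grad_le hP.zdag_mem_dom)

theorem nontrivial_blocks (hP : Assumptions P K) : Nontrivial (Blocks n) := by
  obtain ⟨x, hx⟩ := DFunLike.ne_iff.1 hP.A_ne_zero
  exact ⟨x, 0, fun h => hx (by simp [h])⟩

theorem ddag_le_Ddag (hP : Assumptions P K) : ddag P K ≤ Ddag P K := by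
  have := hP.nontrivial_blocks
  obtain ⟨δ, hδ⟩ := exists_norm_eq (Blocks n) hP.ddag_pos.le
  have hmem : K.zdag + δ ∈ P.dom :=
    hP.closedBall_subset_dom (by rw [mem_closedBall_iff_norm, add_sub_cancel_left, hδ])
  simpa only [add_sub_cancel_left, hδ] using hP.norm_sub_zdag_le hmem

theorem Ddag_pos (hP : Assumptions P K) : 0 < Ddag P K := hP.ddag_pos.trans_le hP.ddag_le_Ddag

theorem one_le_B (hP : Assumptions P K) : 1 ≤ B := by
  have := hP.nontrivial_blocks
  by_contra! h
  obtain rfl : B = 0 := by omega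
  exact not_subsingleton (Blocks n) ⟨fun x y => by ext s; exact s.elim0⟩

theorem iSup_M_nonneg (hP : Assumptions P K) : 0 ≤ K.M :=
  (hP.M_nonneg ⟨0, hP.one_le_B⟩).trans (K.MBlock_le _)

end Assumptions

end Domain

/-! ### The block subproblems -/

section Minimizers

theorem norm_sq_combo {E : Type*} [NormedAddCommGroup E] [InnerProductSpace ℝ E] (x y : E)
    {a b : ℝ} (hab : a + b = 1) :
    ‖a • x + b • y‖ ^ 2 = a * ‖x‖ ^ 2 + b * ‖y‖ ^ 2 - a * b * ‖x - y‖ ^ 2 := by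
  obtain rfl : a = 1 - b := by linarith
  rw [norm_add_sq_real, norm_sub_sq_real, norm_smul, norm_smul, inner_smul_left, inner_smul_right,
    mul_pow, mul_pow, Real.norm_eq_abs, Real.norm_eq_abs, sq_abs, sq_abs, conj_trivial]
  ring

theorem isMinOn_univ_iff_of_coe {α : Type*} {g : α → EReal} {φ : α → ℝ} {s : Set α}
    (hs : s.Nonempty) (hcoe : ∀ u ∈ s, g u = φ u) (htop : ∀ u ∉ s, g u = ⊤) {u : α} :
    IsMinOn g Set.univ u ↔ u ∈ s ∧ IsMinOn φ s u := by
  simp only [isMinOn_iff, Set.mem_univ, true_implies]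
  constructor
  · intro h
    have hu : u ∈ s := by
      by_contra hu
      obtain ⟨v, hv⟩ := hs
      have huv := h v
      rw [htop u hu, hcoe v hv] at huv
      exact huv.not_gt (EReal.coe_lt_top _)
    refine ⟨hu, fun v hv => EReal.coe_le_coe_iff.1 ?_⟩
    rw [← hcoe u hu, ← hcoe v hv]
    exact h v
  · rintro ⟨hu, h⟩ v
    by_cases hv : v ∈ s
    · rw [hcoe u hu, hcoe v hv]
      exact EReal.coe_le_coe_iff.2 (h v hv)
    · exact (htop v hv).symm ▸ le_top

variable {E : Type*} [AddCommGroup E] [Module ℝ E]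

theorem add_le_of_isMinOn_of_combo_le {g : E → ℝ} {s : Set E} {u₀ u : E} {Q : ℝ}
    (hs : Convex ℝ s) (hu₀ : u₀ ∈ s) (hu : u ∈ s) (hmin : IsMinOn g s u₀)
    (hcombo : ∀ a b : ℝ, 0 ≤ a → 0 ≤ b → a + b = 1 →
      g (a • u₀ + b • u) ≤ a * g u₀ + b * g u - a * b * Q) :
    g u₀ + Q ≤ g u := by
  have hscaled : ∀ b ∈ Set.Ioo (0 : ℝ) 1, (1 - b) * Q ≤ g u - g u₀ := by
    rintro b ⟨hb, hb1⟩
    have hle := hcombo (1 - b) b (by linarith) hb.le (by ring)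
    have hmin' : g u₀ ≤ g ((1 - b) • u₀ + b • u) :=
      hmin (hs hu₀ hu (by linarith) hb.le (by ring))
    refine le_of_mul_le_mul_left ?_ hb
    linarith
  have hlim : Filter.Tendsto (fun b : ℝ => (1 - b) * Q) (nhdsWithin 0 (Set.Ioi 0)) (nhds Q) := by
    have hcont : Continuous fun b : ℝ => (1 - b) * Q := by fun_prop
    simpa using (hcont.tendsto 0).mono_left nhdsWithin_le_nhds
  have hQ : Q ≤ g u - g u₀ :=
    le_of_tendsto hlim (Filter.mem_of_superset (Ioo_mem_nhdsGT one_pos) hscaled)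
  linarith

theorem lineDeriv_add_sub_nonneg_of_isMinOn {f g : E → ℝ} {f' : ℝ} {s : Set E} {u₀ u : E}
    (hf : HasLineDerivWithinAt ℝ f f' s u₀ (u - u₀)) (hg : ConvexOn ℝ s g) (hu₀ : u₀ ∈ s)
    (hu : u ∈ s) (hmin : IsMinOn (fun v => f v + g v) s u₀) : 0 ≤ f' + (g u - g u₀) := by
  have hcombo : ∀ b : ℝ, u₀ + b • (u - u₀) = (1 - b) • u₀ + b • u := fun b => by module
  have hmem : ∀ b ∈ Set.Icc (0 : ℝ) 1, u₀ + b • (u - u₀) ∈ s := fun b hb =>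
    hcombo b ▸ hg.1 hu₀ hu (by linarith [hb.2]) hb.1 (by ring)
  set ψ : ℝ → ℝ := fun b => f (u₀ + b • (u - u₀)) + b * (g u - g u₀) with hψ
  have hψmin : IsMinOn ψ (Set.Icc 0 1) 0 := by
    intro b hb
    have hconv : g (u₀ + b • (u - u₀)) ≤ (1 - b) * g u₀ + b * g u :=
      hcombo b ▸ hg.2 hu₀ hu (by linarith [hb.2]) hb.1 (by ring)
    have hle : f u₀ + g u₀ ≤ f (u₀ + b • (u - u₀)) + g (u₀ + b • (u - u₀)) := hmin (hmem b hb)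
    simp only [hψ, Set.mem_ofPred_eq, zero_smul, add_zero, zero_mul]
    linarith
  have hψ' : HasDerivWithinAt ψ (f' + 1 * (g u - g u₀)) (Set.Icc 0 1) 0 :=
    (HasDerivWithinAt.mono hf hmem).add ((hasDerivWithinAt_id _ _).mul_const _)
  have hcone : (1 : ℝ) ∈ posTangentConeAt (Set.Icc 0 1) (0 : ℝ) :=
    mem_posTangentConeAt_of_segment_subset (by rw [zero_add, segment_eq_Icc zero_le_one])
  simpa using hψmin.localize.hasFDerivWithinAt_nonneg hψ'.hasFDerivWithinAt hcone

end Minimizers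

section BlockSubproblem

variable {B : ℕ} {n : Fin B → ℕ} {l : ℕ} {P : Problem B n l} {K : Moduli n} {S : Params}

theorem splice_combo (w : Blocks n) (t : Fin B) (u v) {a b : ℝ} (hab : a + b = 1) :
    splice w t (a • u + b • v) w = a • splice w t u w + b • splice w t v w := by
  obtain rfl : a = 1 - b := by linarith
  rw [splice_eq_add_single w t u v, splice_eq_add_single w t _ v,
    show (1 - b) • u + b • v - v = (1 - b) • (u - v) by module, ← PiLp.toLp_single, Pi.single_smul,
    WithLp.toLp_smul, PiLp.toLp_single]
  module

/-- The value of the dampened augmented Lagrangian on `ℋ`, as a real number. -/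
def Problem.lagReal (P : Problem B n l) (θ c : ℝ) (x : Blocks n) (p : EuclideanSpace ℝ (Fin l)) :
    ℝ :=
  P.phi x + ((1 - θ) * inner ℝ p (P.A x - P.d) + c / 2 * ‖P.A x - P.d‖ ^ 2)

/-- The objective of the subproblem for block `t` on `ℋ_t`, when the other blocks are those of
`w`. -/
def blockReal (P : Problem B n l) (S : Params) (c : ℝ) (p : EuclideanSpace ℝ (Fin l))
    (w : Blocks n) (t : Fin B) (u : EuclideanSpace ℝ (Fin (n t))) : ℝ :=
  S.lam * P.lagReal S.theta c (splice w t u w) p + 1 / 2 * ‖u - w t‖ ^ 2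

/-- `blockReal` without its nonsmooth part `λ h`. -/
def blockSmooth (P : Problem B n l) (S : Params) (c : ℝ) (p : EuclideanSpace ℝ (Fin l))
    (w : Blocks n) (t : Fin B) (u : EuclideanSpace ℝ (Fin (n t))) : ℝ :=
  S.lam * (P.f (splice w t u w) + ((1 - S.theta) * inner ℝ p (P.A (splice w t u w) - P.d)
    + c / 2 * ‖P.A (splice w t u w) - P.d‖ ^ 2)) + 1 / 2 * ‖u - w t‖ ^ 2

/-- `u` solves the subproblem for block `t` with base point `w`. -/
def IsBlockMin (P : Problem B n l) (S : Params) (c : ℝ) (p : EuclideanSpace ℝ (Fin l))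
    (w : Blocks n) (t : Fin B) (u : EuclideanSpace ℝ (Fin (n t))) : Prop :=
  u ∈ P.domBlock t ∧ IsMinOn (blockReal P S c p w t) (P.domBlock t) u

variable {c : ℝ} {p : EuclideanSpace ℝ (Fin l)} {w : Blocks n} {t : Fin B}
  {u v u₀ : EuclideanSpace ℝ (Fin (n t))}

namespace Assumptions

theorem coe_lagReal (hP : Assumptions P K) (θ : ℝ) {x : Blocks n} (hx : x ∈ P.dom) :
    (P.lagReal θ c x p : EReal) = P.lagrangian θ c x p := by
  rw [Problem.lagrangian, Problem.lagReal, Problem.phi, ← hP.coe_toReal_h hx, ← EReal.coe_add,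
    ← EReal.coe_add, EReal.toReal_coe]

theorem lagrangian_eq_top (hP : Assumptions P K) (θ : ℝ) {x : Blocks n} (hx : x ∉ P.dom) :
    P.lagrangian θ c x p = ⊤ := by
  rw [Problem.lagrangian, hP.h_eq_top hx, EReal.coe_add_top, EReal.top_add_coe]

theorem isMinOn_lagrangian_iff (hP : Assumptions P K) (hlam : 0 < S.lam) (hw : w ∈ P.dom) :
    IsMinOn (fun u => (S.lam : EReal) * P.lagrangian S.theta c (splice w t u w) p
      + ((1 / 2 * ‖u - w t‖ ^ 2 : ℝ) : EReal)) Set.univ u₀ ↔ IsBlockMin P S c p w t u₀ := by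
  refine isMinOn_univ_iff_of_coe ⟨w t, hw t⟩ (fun u hu => ?_) (fun u hu => ?_)
  · rw [← hP.coe_lagReal _ (Problem.splice_mem_dom hw hu), blockReal, ← EReal.coe_mul,
      ← EReal.coe_add]
  · have hout : splice w t u w ∉ P.dom := fun h => hu (splice_apply_self w t u w ▸ h t)
    rw [hP.lagrangian_eq_top _ hout, EReal.coe_mul_top_of_pos hlam, EReal.top_add_coe]

theorem continuousOn_blockReal (hP : Assumptions P K) (hw : w ∈ P.dom) :
    ContinuousOn (blockReal P S c p w t) (P.domBlock t) := by
  have hsplice : Continuous fun u => splice w t u w :=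
    (PiLp.continuous_toLp 2 _).comp (continuous_const.update t continuous_id)
  have hphi : ContinuousOn (fun u => P.phi (splice w t u w)) (P.domBlock t) :=
    hP.continuousOn_phi.comp hsplice.continuousOn fun u hu => Problem.splice_mem_dom hw hu
  unfold blockReal Problem.lagReal
  fun_prop

theorem exists_isBlockMin (hP : Assumptions P K) (S : Params) (c : ℝ) (p) (hw : w ∈ P.dom)
    (t : Fin B) : ∃ u, IsBlockMin P S c p w t u :=
  (hP.compactDom t).exists_isMinOn ⟨w t, hw t⟩ (hP.continuousOn_blockReal hw)

theorem toReal_h_splice_sub (hP : Assumptions P K) (hw : w ∈ P.dom) (hu : u ∈ P.domBlock t)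
    (hv : v ∈ P.domBlock t) :
    (P.h (splice w t u w)).toReal - (P.h (splice w t v w)).toReal =
      (P.hBlock t u).toReal - (P.hBlock t v).toReal := by
  rw [hP.toReal_h (Problem.splice_mem_dom hw hu), hP.toReal_h (Problem.splice_mem_dom hw hv),
    ← Finset.sum_sub_distrib, Finset.sum_eq_single t]
  · rw [splice_apply_self, splice_apply_self]
  · intro s _ hs
    rw [splice_self_apply_ne w hs, splice_self_apply_ne w hs, sub_self]
  · simp

theorem phi_splice_combo_le (hP : Assumptions P K) (hw : w ∈ P.dom) (hu : u ∈ P.domBlock t)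
    (hv : v ∈ P.domBlock t) {a b : ℝ} (ha : 0 ≤ a) (hb : 0 ≤ b) (hab : a + b = 1) :
    P.phi (splice w t (a • u + b • v) w) ≤ a * P.phi (splice w t u w)
      + b * P.phi (splice w t v w) + a * b * (K.mBlock t / 2 * ‖u - v‖ ^ 2) := by
  have hf := (hP.weaklyConvex t w hw).2 hu hv ha hb hab
  have hh := (hP.convexOn_hBlock t).2 hu hv ha hb hab
  have hsum := hP.toReal_h_splice_sub hw ((hP.convexOn_hBlock t).1 hu hv ha hb hab) hv
  have hdiff := hP.toReal_h_splice_sub hw hu hv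
  simp only [smul_eq_mul] at hf hh
  rw [norm_sq_combo u v hab] at hf
  obtain rfl : b = 1 - a := by linarith
  unfold Problem.phi
  linear_combination hf + hh + hsum - a * hdiff

theorem blockReal_combo_le (hP : Assumptions P K) (hS : S.Admissible K) (hw : w ∈ P.dom)
    (hu : u ∈ P.domBlock t) (hv : v ∈ P.domBlock t) {a b : ℝ} (ha : 0 ≤ a) (hb : 0 ≤ b)
    (hab : a + b = 1) :
    blockReal P S c p w t (a • u + b • v) ≤ a * blockReal P S c p w t u
      + b * blockReal P S c p w t v
      - a * b * (1 / 4 * ‖u - v‖ ^ 2 + S.lam * c / 2 * ‖P.ABlock t (u - v)‖ ^ 2) := by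
  have hphi := mul_le_mul_of_nonneg_left (hP.phi_splice_combo_le hw hu hv ha hb hab) hS.lam_pos.le
  have hA : P.A (splice w t (a • u + b • v) w) - P.d =
      a • (P.A (splice w t u w) - P.d) + b • (P.A (splice w t v w) - P.d) := by
    obtain rfl : a = 1 - b := by linarith
    rw [splice_combo w t u v hab, map_add, map_smul, map_smul]
    module
  have hAsub : P.A (splice w t u w) - P.d - (P.A (splice w t v w) - P.d) = P.ABlock t (u - v) := by
    rw [P.A_splice w t u v]
    abel
  have hprox : a • u + b • v - w t = a • (u - w t) + b • (v - w t) := by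
    obtain rfl : a = 1 - b := by linarith
    module
  have hm : S.lam * K.mBlock t ≤ 1 / 2 := by
    linarith [mul_le_mul_of_nonneg_left (K.mBlock_le t) hS.lam_pos.le, hS.lam_le]
  have hweak := mul_le_mul_of_nonneg_right hm (mul_nonneg (mul_nonneg ha hb) (sq_nonneg ‖u - v‖))
  unfold blockReal Problem.lagReal
  rw [hA, norm_sq_combo _ _ hab, hAsub, hprox, norm_sq_combo (u - w t) _ hab, inner_add_right,
    inner_smul_right, inner_smul_right, sub_sub_sub_cancel_right]
  linarith

theorem hasLineDerivWithinAt_blockSmooth (hP : Assumptions P K) (hlam : 0 < S.lam)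
    (hw : w ∈ P.dom) (hu₀ : u₀ ∈ P.domBlock t) (δ : EuclideanSpace ℝ (Fin (n t))) :
    HasLineDerivWithinAt ℝ (blockSmooth P S c p w t)
      (S.lam * inner ℝ (P.grad (splice w t u₀ w) t
        + ContinuousLinearMap.adjoint (P.ABlock t)
          ((1 - S.theta) • p + c • (P.A (splice w t u₀ w) - P.d))
        + (1 / S.lam) • (u₀ - w t)) δ) (P.domBlock t) u₀ δ := by
  set r := P.A (splice w t u₀ w) - P.d with hr
  have hline : ∀ b : ℝ, splice w t (u₀ + b • δ) w =
      splice w t u₀ w + b • PiLp.single 2 t δ := fun b => by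
    rw [splice_eq_add_single w t _ u₀, add_sub_cancel_left, ← PiLp.toLp_single, Pi.single_smul,
      WithLp.toLp_smul, PiLp.toLp_single]
  have hresidual : ∀ b : ℝ, P.A (splice w t u₀ w + b • PiLp.single 2 t δ) - P.d =
      r + b • P.ABlock t δ := fun b => by rw [map_add, map_smul, P.A_single, hr]; abel
  have hprox : ∀ b : ℝ, u₀ + b • δ - w t = u₀ - w t + b • δ := fun b => by abel
  have hf : HasDerivWithinAt (fun b : ℝ => P.f (splice w t u₀ w + b • PiLp.single 2 t δ))
      (inner ℝ (P.grad (splice w t u₀ w) t) δ) ((fun b => u₀ + b • δ) ⁻¹' P.domBlock t) 0 := by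
    have hf' := (hP.hasFDerivWithinAt_f (Problem.splice_mem_dom hw hu₀)).hasLineDerivWithinAt
      (PiLp.single 2 t δ)
    rw [InnerProductSpace.toDual_apply_apply, inner_single_right] at hf'
    exact HasDerivWithinAt.mono hf' fun b hb =>
      Set.mem_preimage.2 (hline b ▸ Problem.splice_mem_dom hw hb)
  have haffine : ∀ {F : Type} [NormedAddCommGroup F] [InnerProductSpace ℝ F] (a e : F),
      HasDerivAt (fun b : ℝ => a + b • e) e 0 := fun a e => by
    simpa using ((hasDerivAt_id (0 : ℝ)).smul_const e).const_add a
  have hderiv := ((hf.add ((((hasDerivAt_const (0 : ℝ) p).inner ℝ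
      (haffine r (P.ABlock t δ))).const_mul (1 - S.theta)).add
      ((haffine r (P.ABlock t δ)).norm_sq.const_mul (c / 2))).hasDerivWithinAt).const_mul
      S.lam).add ((haffine (u₀ - w t) δ).norm_sq.const_mul (1 / 2)).hasDerivWithinAt
  unfold HasLineDerivWithinAt blockSmooth
  simp only [hline, hresidual, hprox]
  refine hderiv.congr_deriv ?_
  simp only [zero_smul, add_zero, inner_zero_left, inner_add_left, real_inner_smul_left,
    ContinuousLinearMap.adjoint_inner_left]
  field_simp

end Assumptions

namespace IsBlockMin

theorem growth (h : IsBlockMin P S c p w t u₀) (hP : Assumptions P K) (hS : S.Admissible K)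
    (hw : w ∈ P.dom) (hu : u ∈ P.domBlock t) :
    blockReal P S c p w t u₀
      + (1 / 4 * ‖u₀ - u‖ ^ 2 + S.lam * c / 2 * ‖P.ABlock t (u₀ - u)‖ ^ 2) ≤
      blockReal P S c p w t u :=
  add_le_of_isMinOn_of_combo_le (hP.convexOn_hBlock t).1 h.1 hu h.2
    fun _ _ ha hb hab => hP.blockReal_combo_le hS hw h.1 hu ha hb hab

theorem unique (hu : IsBlockMin P S c p w t u) (hv : IsBlockMin P S c p w t v)
    (hP : Assumptions P K) (hS : S.Admissible K) (hc : 0 ≤ c) (hw : w ∈ P.dom) : u = v := by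
  have hgrowth := hu.growth hP hS hw hv.1
  have hle : blockReal P S c p w t v ≤ blockReal P S c p w t u := hv.2 hu.1
  have hA : 0 ≤ S.lam * c / 2 * ‖P.ABlock t (u - v)‖ ^ 2 := by
    have := hS.lam_pos
    positivity
  have hsq : ‖u - v‖ ^ 2 = 0 := le_antisymm (by linarith) (sq_nonneg _)
  exact sub_eq_zero.1 (norm_eq_zero.1 (pow_eq_zero_iff two_ne_zero |>.1 hsq))

theorem variational_inequality (h : IsBlockMin P S c p w t u₀) (hP : Assumptions P K)
    (hlam : 0 < S.lam) (hw : w ∈ P.dom) (hu : u ∈ P.domBlock t) :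
    0 ≤ inner ℝ (P.grad (splice w t u₀ w) t
        + ContinuousLinearMap.adjoint (P.ABlock t)
          ((1 - S.theta) • p + c • (P.A (splice w t u₀ w) - P.d))
        + (1 / S.lam) • (u₀ - w t)) (u - u₀)
      + ((P.hBlock t u).toReal - (P.hBlock t u₀).toReal) := by
  have hmin : IsMinOn (fun v => blockSmooth P S c p w t v + S.lam * (P.hBlock t v).toReal)
      (P.domBlock t) u₀ := by
    intro v hv
    have hle : blockReal P S c p w t u₀ ≤ blockReal P S c p w t v := h.2 hv
    have hdiff := hP.toReal_h_splice_sub hw h.1 hv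
    simp only [blockReal, Problem.lagReal, Problem.phi] at hle
    simp only [blockSmooth, Set.mem_ofPred_eq]
    linear_combination hle - S.lam * hdiff
  have hnonneg := lineDeriv_add_sub_nonneg_of_isMinOn
    (hP.hasLineDerivWithinAt_blockSmooth hlam hw h.1 (u - u₀))
    ((hP.convexOn_hBlock t).smul hlam.le) h.1 hu hmin
  simp only [smul_eq_mul, ← mul_sub, ← mul_add] at hnonneg
  exact nonneg_of_mul_nonneg_right hnonneg hlam

end IsBlockMin

end BlockSubproblem

/-! ### Sweeps -/

section Norms

theorem add_sq_le_mul_add {X Y a b α β : ℝ} (ha : 0 ≤ a) (hb : 0 ≤ b) (hα : 0 ≤ α) (hβ : 0 ≤ β)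
    (hX : X ^ 2 ≤ a * α) (hY : Y ^ 2 ≤ b * β) : (X + Y) ^ 2 ≤ (a + b) * (α + β) := by
  simpa using Finset.univ.sum_sq_le_sum_mul_sum_of_sq_le_mul (r := ![X, Y]) (f := ![a, b])
    (g := ![α, β]) (by simp [Fin.forall_fin_two, *]) (by simp [Fin.forall_fin_two, *])
    (by simp [Fin.forall_fin_two, *])

theorem norm_piLp_two_le_sum {ι : Type*} [Fintype ι] {β : ι → Type*}
    [∀ i, SeminormedAddCommGroup (β i)] (x : PiLp 2 β) : ‖x‖ ≤ ∑ i, ‖x i‖ := by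
  refine (abs_le_of_sq_le_sq' ?_ (by positivity)).2
  rw [PiLp.norm_sq_eq_of_L2]
  exact Finset.sum_sq_le_sq_sum_of_nonneg fun i _ => norm_nonneg _

end Norms

section Sweep

variable {B : ℕ} {n : Fin B → ℕ} {l : ℕ} {P : Problem B n l} {K : Moduli n} {S : Params}

theorem tailDist_le (t : Fin B) (x y : Blocks n) : tailDist t x y ≤ ‖x - y‖ := by
  rw [tailDist, Real.sqrt_le_left (norm_nonneg _), PiLp.norm_sq_eq_of_L2]
  exact Finset.sum_le_sum_of_subset_of_nonneg (Finset.subset_univ _) fun _ _ _ => sq_nonneg _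

theorem Problem.sum_Ioi_ABlock_sub (P : Problem B n l) (x y : Blocks n) (t : Fin B) :
    ∑ j ∈ Finset.Ioi t, P.ABlock j (y j - x j) = P.A y - P.A (splice y t (y t) x) := by
  rw [← map_sub, P.A_apply, ← headTail_succ, ← Finset.sum_filter_add_sum_filter_not Finset.univ
    (fun j : Fin B => t < j)]
  have hhead : ∀ j ∈ Finset.univ.filter (fun j : Fin B => ¬ t < j),
      P.ABlock j ((y - headTail y x (t + 1)) j) = 0 := fun j hj => by
    have hjt : (j : ℕ) < t + 1 := Nat.lt_succ_of_le (not_lt.1 (Finset.mem_filter.1 hj).2)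
    rw [PiLp.sub_apply, headTail_apply, if_pos hjt, sub_self, map_zero]
  rw [Finset.sum_eq_zero hhead, add_zero]
  refine Finset.sum_congr (by ext; simp) fun j hj => ?_
  have hjt : ¬ (j : ℕ) < t + 1 :=
    not_lt.2 (Nat.succ_le_of_lt (Fin.lt_def.1 (Finset.mem_filter.1 hj).2))
  rw [PiLp.sub_apply, headTail_apply, if_neg hjt]

/-- The residual `v` of a sweep from `x` to `y`. -/
def sweepResidual (P : Problem B n l) (S : Params) (c : ℝ) (x y : Blocks n) : Blocks n :=
  WithLp.toLp 2 fun t =>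
    (P.grad y t - P.grad (splice y t (y t) x) t)
      + c • ContinuousLinearMap.adjoint (P.ABlock t)
          (∑ j ∈ Finset.Ioi t, P.ABlock j (y j - x j))
      - (1 / S.lam) • (y t - x t)

theorem sweepResidual_apply (P : Problem B n l) (S : Params) (c : ℝ) (x y : Blocks n) (t : Fin B) :
    sweepResidual P S c x y t = P.grad y t - P.grad (splice y t (y t) x) t
      + c • ContinuousLinearMap.adjoint (P.ABlock t) (P.A y - P.A (splice y t (y t) x))
      - (1 / S.lam) • (y t - x t) := by
  rw [← P.sum_Ioi_ABlock_sub]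
  rfl

theorem State.v_eq (s : State n l) (i : ℕ) :
    s.v P S i = sweepResidual P S s.c (s.x (i - 1)) (s.x i) := rfl

variable {c : ℝ} {p : EuclideanSpace ℝ (Fin l)} {x y : Blocks n}


theorem isMinOn_sweep_iff (hP : Assumptions P K) (hlam : 0 < S.lam) {t : Fin B}
    (hw : headTail y x t ∈ P.dom) :
    IsMinOn (fun u => (S.lam : EReal) * P.lagrangian S.theta c (splice y t u x) p
      + ((1 / 2 * ‖u - x t‖ ^ 2 : ℝ) : EReal)) Set.univ (y t) ↔
      IsBlockMin P S c p (headTail y x t) t (y t) := by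
  rw [← hP.isMinOn_lagrangian_iff hlam hw]
  simp only [← splice_eq_splice_headTail, headTail_apply_self]

theorem isProxSweep_iff (hP : Assumptions P K) (hlam : 0 < S.lam) (hx : x ∈ P.dom) :
    IsProxSweep P S c x p y ↔ ∀ t : Fin B, IsBlockMin P S c p (headTail y x t) t (y t) := by
  constructor
  · intro hy
    have hmem : ∀ j ≤ B, headTail y x j ∈ P.dom := by
      intro j
      induction j with
      | zero => exact fun _ => (headTail_zero y x).symm ▸ hx
      | succ j ih =>
        intro hj
        have hw := ih (Nat.le_of_succ_le hj)
        have hmin := (isMinOn_sweep_iff (t := ⟨j, hj⟩) hP hlam hw).1 (hy ⟨j, hj⟩)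
        rw [headTail_succ y x ⟨j, hj⟩, splice_eq_splice_headTail]
        exact Problem.splice_mem_dom hw hmin.1
    exact fun t => (isMinOn_sweep_iff hP hlam (hmem t t.2.le)).1 (hy t)
  · exact fun hy t => (isMinOn_sweep_iff hP hlam
      (Problem.headTail_mem_dom (fun s => (hy s).1) hx t)).2 (hy t)

namespace IsProxSweep

theorem isBlockMin (hy : IsProxSweep P S c x p y) (hP : Assumptions P K) (hlam : 0 < S.lam)
    (hx : x ∈ P.dom) (t : Fin B) : IsBlockMin P S c p (headTail y x t) t (y t) :=
  (isProxSweep_iff hP hlam hx).1 hy t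

theorem mem_dom (hy : IsProxSweep P S c x p y) (hP : Assumptions P K) (hlam : 0 < S.lam)
    (hx : x ∈ P.dom) : y ∈ P.dom :=
  fun t => (hy.isBlockMin hP hlam hx t).1

theorem unique {y' : Blocks n} (hy : IsProxSweep P S c x p y) (hy' : IsProxSweep P S c x p y')
    (hP : Assumptions P K) (hS : S.Admissible K) (hc : 0 ≤ c) (hx : x ∈ P.dom) : y = y' := by
  ext t : 1
  induction t using WellFoundedLT.induction with
  | ind t ih =>
    have hmin := hy.isBlockMin hP hS.lam_pos hx t
    rw [headTail_congr (y' := y') fun s hs => ih s hs] at hmin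
    exact hmin.unique (hy'.isBlockMin hP hS.lam_pos hx t) hP hS hc
      (Problem.headTail_mem_dom (hy'.mem_dom hP hS.lam_pos hx) hx t)

theorem lagReal_decrease (hy : IsProxSweep P S c x p y) (hP : Assumptions P K)
    (hS : S.Admissible K) (hx : x ∈ P.dom) :
    3 / 4 * ‖y - x‖ ^ 2 + S.lam * c / 2 * ∑ t, ‖P.ABlock t (y t - x t)‖ ^ 2 ≤
      S.lam * (P.lagReal S.theta c x p - P.lagReal S.theta c y p) := by
  set L : ℕ → ℝ := fun j => S.lam * P.lagReal S.theta c (headTail y x j) p with hL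
  have hblock : ∀ t : Fin B, 3 / 4 * ‖y t - x t‖ ^ 2
      + S.lam * c / 2 * ‖P.ABlock t (y t - x t)‖ ^ 2 ≤ L t - L (t + 1) := by
    intro t
    have hself : splice (headTail y x t) t (x t) (headTail y x t) = headTail y x t := by
      have := splice_self_self (headTail y x t) t
      rwa [headTail_apply_self] at this
    have hgrowth := (hy.isBlockMin hP hS.lam_pos hx t).growth hP hS
      (Problem.headTail_mem_dom (hy.mem_dom hP hS.lam_pos hx) hx t) (hx t)
    rw [blockReal, blockReal, ← splice_eq_splice_headTail, ← headTail_succ, headTail_apply_self,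
      sub_self, norm_zero, hself] at hgrowth
    linarith
  calc 3 / 4 * ‖y - x‖ ^ 2 + S.lam * c / 2 * ∑ t, ‖P.ABlock t (y t - x t)‖ ^ 2
      = ∑ t, (3 / 4 * ‖y t - x t‖ ^ 2 + S.lam * c / 2 * ‖P.ABlock t (y t - x t)‖ ^ 2) := by
        rw [PiLp.norm_sq_eq_of_L2, Finset.sum_add_distrib, Finset.mul_sum, Finset.mul_sum]
        rfl
    _ ≤ ∑ t : Fin B, (L t - L (t + 1)) := Finset.sum_le_sum fun t _ => hblock t
    _ = L 0 - L B := by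
        rw [Fin.sum_univ_eq_sum_range (fun j => L j - L (j + 1)), Finset.sum_range_sub']
    _ = S.lam * (P.lagReal S.theta c x p - P.lagReal S.theta c y p) := by
        simp only [hL, headTail_zero, headTail_card, mul_sub]

theorem h_add_inner_le (hy : IsProxSweep P S c x p y) (hP : Assumptions P K)
    (hlam : 0 < S.lam) (hx : x ∈ P.dom) {u : Blocks n} (hu : u ∈ P.dom) :
    (P.h y).toReal + inner ℝ (sweepResidual P S c x y - P.grad y
      - ContinuousLinearMap.adjoint P.A ((1 - S.theta) • p + c • (P.A y - P.d))) (u - y) ≤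
      (P.h u).toReal := by
  have hy_dom := hy.mem_dom hP hlam hx
  rw [hP.toReal_h hy_dom, hP.toReal_h hu, PiLp.inner_apply, ← Finset.sum_add_distrib]
  refine Finset.sum_le_sum fun t _ => ?_
  have hvar := (hy.isBlockMin hP hlam hx t).variational_inequality hP hlam
    (Problem.headTail_mem_dom hy_dom hx t) (hu t)
  rw [← splice_eq_splice_headTail, headTail_apply_self] at hvar
  have hsubgradient : (sweepResidual P S c x y - P.grad y
      - ContinuousLinearMap.adjoint P.A ((1 - S.theta) • p + c • (P.A y - P.d))) t =
      -(P.grad (splice y t (y t) x) t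
        + ContinuousLinearMap.adjoint (P.ABlock t)
          ((1 - S.theta) • p + c • (P.A (splice y t (y t) x) - P.d))
        + (1 / S.lam) • (y t - x t)) := by
    rw [PiLp.sub_apply, PiLp.sub_apply, P.adjoint_A_apply, sweepResidual_apply]
    simp only [map_add, map_smul, map_sub]
    module
  rw [hsubgradient, inner_neg_left]
  simp only [PiLp.sub_apply]
  linarith

end IsProxSweep

namespace Assumptions

theorem exists_sweep (hP : Assumptions P K) (hlam : 0 < S.lam) (c : ℝ) (p) (hx : x ∈ P.dom) :
    ∃ y, IsProxSweep P S c x p y := by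
  have hpartial : ∀ j ≤ B, ∃ y ∈ P.dom, ∀ t : Fin B, (t : ℕ) < j →
      IsBlockMin P S c p (headTail y x t) t (y t) := by
    intro j
    induction j with
    | zero => exact fun _ => ⟨x, hx, fun t ht => absurd ht (Nat.not_lt_zero _)⟩
    | succ j ih =>
      intro hj
      obtain ⟨y, hy, hmin⟩ := ih (Nat.le_of_succ_le hj)
      obtain ⟨u, hu⟩ := hP.exists_isBlockMin S c p (Problem.headTail_mem_dom hy hx j) ⟨j, hj⟩
      have hprefix : ∀ s : Fin B, (s : ℕ) < j → splice y ⟨j, hj⟩ u y s = y s := fun s hs =>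
        splice_self_apply_ne y (Fin.ne_of_lt hs) u
      refine ⟨splice y ⟨j, hj⟩ u y, Problem.splice_mem_dom hy hu.1, fun t ht => ?_⟩
      rw [headTail_congr (y' := y) fun s hs => hprefix s (by omega)]
      rcases Nat.lt_succ_iff_lt_or_eq.1 ht with hlt | heq
      · rw [hprefix t hlt]
        exact hmin t hlt
      · obtain rfl : t = ⟨j, hj⟩ := Fin.ext heq
        rwa [splice_apply_self]
  obtain ⟨y, -, hmin⟩ := hpartial B le_rfl
  exact ⟨y, (isProxSweep_iff hP hlam hx).2 fun t => hmin t t.2⟩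

theorem existsUnique_sweep (hP : Assumptions P K) (hS : S.Admissible K) (hc : 0 ≤ c)
    (hx : x ∈ P.dom) (p) : ∃! y, IsProxSweep P S c x p y := by
  obtain ⟨y, hy⟩ := hP.exists_sweep hS.lam_pos c p hx
  exact ⟨y, hy, fun y' hy' => hy'.unique hy hP hS hc hx⟩

end Assumptions

section Residual

theorem Problem.norm_sum_Ioi_ABlock_le (P : Problem B n l) (δ : Blocks n) (t : Fin B) :
    ‖∑ j ∈ Finset.Ioi t, P.ABlock j (δ j)‖ ≤
      Real.sqrt ((B - 1) * ∑ j, ‖P.ABlock j (δ j)‖ ^ 2) := by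
  have hcard : ((Finset.Ioi t).card : ℝ) ≤ B - 1 := by
    rw [Fin.card_Ioi, le_sub_iff_add_le]
    exact_mod_cast (by omega : B - 1 - (t : ℕ) + 1 ≤ B)
  refine (norm_sum_le _ _).trans (Real.le_sqrt_of_sq_le ?_)
  calc (∑ j ∈ Finset.Ioi t, ‖P.ABlock j (δ j)‖) ^ 2
      ≤ (Finset.Ioi t).card * ∑ j ∈ Finset.Ioi t, ‖P.ABlock j (δ j)‖ ^ 2 :=
        sq_sum_le_card_mul_sum_sq
    _ ≤ (B - 1) * ∑ j, ‖P.ABlock j (δ j)‖ ^ 2 := by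
        gcongr
        · exact (Nat.cast_nonneg _).trans hcard
        · exact Finset.subset_univ _

theorem norm_sweepResidual_apply_le (hP : Assumptions P K) (hlam : 0 < S.lam) (hc : 0 ≤ c)
    (hx : x ∈ P.dom) (hy : y ∈ P.dom) (t : Fin B) :
    ‖sweepResidual P S c x y t‖ ≤ (K.M + 1 / S.lam) * ‖y - x‖
      + c * Real.sqrt ((B - 1) * ∑ j, ‖P.ABlock j (y j - x j)‖ ^ 2) * ‖P.ABlock t‖ := by
  have hgrad : ‖P.grad y t - P.grad (splice y t (y t) x) t‖ ≤ K.M * ‖y - x‖ := by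
    have hM := hP.iSup_M_nonneg
    rw [norm_sub_rev, norm_sub_rev y]
    refine (hP.grad_lipschitz t y hy x hx).trans ?_
    gcongr
    · exact Real.sqrt_nonneg _
    · exact K.MBlock_le t
    · exact tailDist_le t x y
  have htail : ‖c • ContinuousLinearMap.adjoint (P.ABlock t)
        (∑ j ∈ Finset.Ioi t, P.ABlock j (y j - x j))‖ ≤
      c * Real.sqrt ((B - 1) * ∑ j, ‖P.ABlock j (y j - x j)‖ ^ 2) * ‖P.ABlock t‖ := by
    rw [norm_smul, Real.norm_of_nonneg hc, mul_assoc, mul_comm (Real.sqrt _)]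
    gcongr
    refine (ContinuousLinearMap.le_opNorm _ _).trans ?_
    rw [LinearIsometryEquiv.norm_map]
    gcongr
    exact P.norm_sum_Ioi_ABlock_le (y - x) t
  have hprox : ‖(1 / S.lam) • (y t - x t)‖ ≤ 1 / S.lam * ‖y - x‖ := by
    rw [norm_smul, Real.norm_of_nonneg (by positivity)]
    gcongr
    exact PiLp.norm_apply_le (y - x) t
  refine ((norm_sub_le _ _).trans (add_le_add ((norm_add_le _ _).trans
    (add_le_add hgrad htail)) hprox)).trans_eq ?_
  ring

theorem kappa5_nonneg (hP : Assumptions P K) : 0 ≤ kappa5 P := by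
  have hB : (1 : ℝ) ≤ B := by exact_mod_cast hP.one_le_B
  have : (0 : ℝ) ≤ B - 1 := sub_nonneg.2 hB
  unfold kappa5
  positivity

theorem sweepResidual_sq_le (hP : Assumptions P K) (hlam : 0 < S.lam) (hc : 0 ≤ c)
    (hx : x ∈ P.dom) (hy : y ∈ P.dom) :
    ‖sweepResidual P S c x y‖ ^ 2 ≤ (kappa0 K S ^ 2 + kappa5 P * c) *
      (‖y - x‖ ^ 2 / (4 * S.lam) + c / 8 * ∑ t, ‖P.ABlock t (y t - x t)‖ ^ 2) := by
  have hM := hP.iSup_M_nonneg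
  have hB : (1 : ℝ) ≤ B := by exact_mod_cast hP.one_le_B
  have : (0 : ℝ) ≤ B - 1 := sub_nonneg.2 hB
  have hκ₅ := kappa5_nonneg hP
  set Q := ∑ t, ‖P.ABlock t (y t - x t)‖ ^ 2
  have : 0 ≤ Q := Finset.sum_nonneg fun _ _ => sq_nonneg _
  have hnorm : ‖sweepResidual P S c x y‖ ≤ B * (K.M + 1 / S.lam) * ‖y - x‖
      + c * Real.sqrt ((B - 1) * Q) * normADag P := by
    refine (norm_piLp_two_le_sum _).trans ((Finset.sum_le_sum fun t _ =>
      norm_sweepResidual_apply_le hP hlam hc hx hy t).trans_eq ?_)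
    rw [Finset.sum_add_distrib, ← Finset.mul_sum (a := c * _), normADag, Finset.sum_const,
      Finset.card_univ, Fintype.card_fin, nsmul_eq_mul, ← mul_assoc]
  have hproximal : (B * (K.M + 1 / S.lam) * ‖y - x‖) ^ 2 ≤
      kappa0 K S ^ 2 * (‖y - x‖ ^ 2 / (4 * S.lam)) := by
    have hnonneg : 0 ≤ B * (K.M + 1 / S.lam) * ‖y - x‖ := by positivity
    calc (B * (K.M + 1 / S.lam) * ‖y - x‖) ^ 2
        ≤ ((B : ℝ) * (B * (K.M + 1 / S.lam) * ‖y - x‖)) ^ 2 :=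
          pow_le_pow_left₀ hnonneg (le_mul_of_one_le_left hnonneg hB) 2
      _ = kappa0 K S ^ 2 * (‖y - x‖ ^ 2 / (4 * S.lam)) := by
          rw [kappa0, div_pow, Real.sq_sqrt hlam.le]
          field_simp
          ring
  have hpenalty : (c * Real.sqrt ((B - 1) * Q) * normADag P) ^ 2 = kappa5 P * c * (c / 8 * Q) := by
    rw [mul_pow, mul_pow, Real.sq_sqrt (by positivity), kappa5]
    ring
  exact (pow_le_pow_left₀ (norm_nonneg _) hnorm 2).trans (add_sq_le_mul_add (sq_nonneg _)
    (by positivity) (by positivity) (by positivity) hproximal hpenalty.le)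

end Residual

end Sweep

/-! ### One call of the static method -/

section DualStep

variable {F : Type*} [NormedAddCommGroup F] [InnerProductSpace ℝ F] {θ χ c : ℝ} {p p' r : F}

theorem inner_dual_step (hχc : 0 < χ * c) (hp' : p' = (1 - θ) • p + (χ * c) • r) :
    inner ℝ (p' - p) r =
      ((2 - θ) * ‖p' - p‖ ^ 2 + θ * (‖p'‖ ^ 2 - ‖p‖ ^ 2)) / (2 * (χ * c)) := by
  have hr : (χ * c) • r = p' - (1 - θ) • p := by rw [hp', add_sub_cancel_left]
  rw [eq_div_iff (by positivity), mul_comm, mul_assoc, ← inner_smul_right, hr, norm_sub_sq_real]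
  simp only [inner_sub_left, inner_sub_right, inner_smul_right, real_inner_self_eq_norm_sq]
  rw [real_inner_comm p' p]
  ring

theorem norm_sq_smul_add_le (hθ : 0 < θ) (hθ₁ : θ ≤ 1) (e w : F) :
    ‖(1 - θ) • e + w‖ ^ 2 ≤ (1 - θ) * ‖e‖ ^ 2 + ‖w‖ ^ 2 / θ := by
  have hcombo := norm_sq_combo e ((1 / θ) • w) (a := 1 - θ) (b := θ) (by ring)
  have hcross : 0 ≤ (1 - θ) * θ * ‖e - (1 / θ) • w‖ ^ 2 :=
    mul_nonneg (mul_nonneg (sub_nonneg.2 hθ₁) hθ.le) (sq_nonneg _)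
  have hscale : θ * ((1 / θ) ^ 2 * ‖w‖ ^ 2) = ‖w‖ ^ 2 / θ := by field_simp
  rw [smul_smul, mul_one_div_cancel hθ.ne', one_smul, norm_smul,
    Real.norm_of_nonneg (by positivity), mul_pow, hscale] at hcombo
  linarith

theorem mul_norm_le_of_dual_step (hχc : 0 ≤ χ * c) (hθ₁ : θ ≤ 1)
    (hp' : p' = (1 - θ) • p + (χ * c) • r) : χ * c * ‖r‖ ≤ ‖p'‖ + (1 - θ) * ‖p‖ := by
  have hr : (χ * c) • r = p' - (1 - θ) • p := by rw [hp', add_sub_cancel_left]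
  rw [← Real.norm_of_nonneg hχc, ← norm_smul, hr, ← Real.norm_of_nonneg (sub_nonneg.2 hθ₁),
    ← norm_smul, Real.norm_of_nonneg (sub_nonneg.2 hθ₁)]
  exact norm_sub_le _ _

theorem norm_dual_sub_le (hχ : 0 ≤ χ) (hχ₁ : χ ≤ 1) (hθ₁ : θ ≤ 1)
    (hp' : p' = (1 - θ) • p + (χ * c) • r) :
    ‖p'‖ - (1 - θ) * ‖p‖ ≤ χ * ‖(1 - θ) • p + c • r‖ := by
  have hcombo : p' = ((1 - χ) * (1 - θ)) • p + χ • ((1 - θ) • p + c • r) := by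
    rw [hp']
    module
  have htriangle := norm_add_le (((1 - χ) * (1 - θ)) • p) (χ • ((1 - θ) • p + c • r))
  rw [← hcombo, norm_smul, norm_smul, Real.norm_of_nonneg hχ,
    Real.norm_of_nonneg (mul_nonneg (sub_nonneg.2 hχ₁) (sub_nonneg.2 hθ₁))] at htriangle
  have hdrop : 0 ≤ χ * (1 - θ) * ‖p‖ :=
    mul_nonneg (mul_nonneg hχ (sub_nonneg.2 hθ₁)) (norm_nonneg _)
  linarith

theorem inner_nonneg_of_lt_norm_dual (hχ : 0 < χ) (hχ₁ : χ ≤ 1) (hθ₁ : θ ≤ 1) (hc : 0 < c)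
    (hp' : p' = (1 - θ) • p + (χ * c) • r) (hlt : (1 - θ) * ‖p‖ ≤ ‖p'‖) :
    0 ≤ inner ℝ ((1 - θ) • p + c • r) r := by
  have hp'r : 0 ≤ inner ℝ p' r := by
    have hr : (χ * c) • r = p' - (1 - θ) • p := by rw [hp', add_sub_cancel_left]
    refine nonneg_of_mul_nonneg_right (a := χ * c) ?_ (by positivity)
    rw [← inner_smul_right, hr, inner_sub_right, inner_smul_right, real_inner_self_eq_norm_sq]
    have hcs := mul_le_mul_of_nonneg_left (real_inner_le_norm p' p) (sub_nonneg.2 hθ₁)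
    have hgain := mul_nonneg (norm_nonneg p') (sub_nonneg.2 hlt)
    linarith
  have hrest : 0 ≤ (1 - χ) * c * ‖r‖ ^ 2 :=
    mul_nonneg (mul_nonneg (sub_nonneg.2 hχ₁) hc.le) (sq_nonneg _)
  have hq : (1 - θ) • p + c • r = p' + ((1 - χ) * c) • r := by
    rw [hp']
    module
  rw [hq, inner_add_left, real_inner_smul_left, real_inner_self_eq_norm_sq]
  exact add_nonneg hp'r hrest

theorem neg_norm_sq_div_le_inner_add (hc : 0 < c) (w r : F) :
    -(‖w‖ ^ 2 / (2 * c)) ≤ inner ℝ w r + c / 2 * ‖r‖ ^ 2 := by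
  have hsq := sq_nonneg ‖w + c • r‖
  rw [norm_add_sq_real, norm_smul, mul_pow, inner_smul_right, Real.norm_of_nonneg hc.le] at hsq
  rw [← neg_div, div_le_iff₀ (by positivity)]
  linarith

end DualStep

section Call

variable {B : ℕ} {n : Fin B → ℕ} {l : ℕ} {P : Problem B n l} {K : Moduli n} {S : Params}

namespace Assumptions

theorem A_sub_d_eq (hP : Assumptions P K) (x : Blocks n) : P.A x - P.d = P.A (x - K.zdag) := by
  rw [map_sub, hP.zdag_feasible.2]

theorem norm_A_sub_d_le (hP : Assumptions P K) {x : Blocks n} (hx : x ∈ P.dom) :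
    ‖P.A x - P.d‖ ≤ ‖P.A‖ * Ddag P K := by
  rw [hP.A_sub_d_eq]
  exact P.A.le_opNorm_of_le (hP.norm_sub_zdag_le hx)

theorem smul_add_smul_mem_range (hP : Assumptions P K) {p : EuclideanSpace ℝ (Fin l)}
    (hp : p ∈ P.A.range) (a b : ℝ) (x : Blocks n) :
    a • p + b • (P.A x - P.d) ∈ P.A.range := by
  rw [hP.A_sub_d_eq]
  exact Submodule.add_mem _ (Submodule.smul_mem _ a hp)
    (Submodule.smul_mem _ b (LinearMap.mem_range_self P.A.toLinearMap _))

theorem chi_theta_le (hP : Assumptions P K) (hS : S.Admissible K) :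
    S.chi * ((1 - S.theta) * (2 - S.theta)) ≤ S.theta ^ 2 / 2 := by
  have hB : (1 : ℝ) ≤ B := by exact_mod_cast hP.one_le_B
  have hnonneg : 0 ≤ S.chi * ((1 - S.theta) * (2 - S.theta)) :=
    mul_nonneg hS.chi_pos.le (mul_nonneg (by linarith [hS.theta_le]) (by linarith [hS.theta_le]))
  linarith [hS.chi_theta, mul_le_mul_of_nonneg_right hB hnonneg]

theorem kappa0_pos (hP : Assumptions P K) (hlam : 0 < S.lam) : 0 < kappa0 K S := by
  have hB : (0 : ℝ) < B := by exact_mod_cast hP.one_le_B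
  have hM := hP.iSup_M_nonneg
  unfold kappa0
  positivity

theorem sigmaPlus_pos (hP : Assumptions P K) : 0 < sigmaPlus P :=
  DPADMM.sigmaPlus_pos hP.A_ne_zero

theorem kappa4_pos (hP : Assumptions P K) (hS : S.Admissible K) : 0 < kappa4 P K S := by
  have := hP.ddag_pos
  have := hP.Ddag_pos
  have := hP.sigmaPlus_pos
  have := hS.chi_pos
  have := hS.theta_pos
  unfold kappa4
  positivity

end Assumptions

section Multiplier

variable {c : ℝ} {p : EuclideanSpace ℝ (Fin l)} {x y : Blocks n}

theorem IsProxSweep.slater_bound (hy : IsProxSweep P S c x p y) (hP : Assumptions P K)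
    (hlam : 0 < S.lam) (hx : x ∈ P.dom) (hp : p ∈ P.A.range) :
    ddag P K * sigmaPlus P * ‖(1 - S.theta) • p + c • (P.A y - P.d)‖
      + inner ℝ ((1 - S.theta) • p + c • (P.A y - P.d)) (P.A y - P.d) ≤
      2 * Ddag P K * (‖sweepResidual P S c x y‖ + (K.Kh + Gf P)) := by
  have hy_dom := hy.mem_dom hP hlam hx
  have hσ := hP.smul_add_smul_mem_range hp (1 - S.theta) c y
  set q := (1 - S.theta) • p + c • (P.A y - P.d)
  set Aq := ContinuousLinearMap.adjoint P.A q with hAq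
  set w := sweepResidual P S c x y - P.grad y
  have hw_le : ‖w‖ ≤ ‖sweepResidual P S c x y‖ + Gf P :=
    (norm_sub_le _ _).trans (add_le_add_right (hP.norm_grad_le hy_dom) _)
  have hsing : sigmaPlus P * ‖q‖ ≤ ‖w‖ + ‖w - Aq‖ := by
    obtain ⟨z, hz⟩ := hσ
    have hle := sigmaPlus_mul_norm_le P z
    rw [show P.A z = q from hz] at hle
    calc sigmaPlus P * ‖q‖ ≤ ‖Aq‖ := hle
      _ = ‖w - (w - Aq)‖ := by rw [sub_sub_cancel]
      _ ≤ ‖w‖ + ‖w - Aq‖ := norm_sub_le _ _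
  have hsubgradient := mul_norm_subgradient_le (g := fun u => (P.h u).toReal) (x := y)
    (ξ := w - Aq) hP.ddag_pos.le hP.closedBall_subset_dom hP.Kh_nonneg
    (fun u hu => (le_abs_self _).trans (hP.h_lipschitz u hu y hy_dom))
    (fun u hu => hy.h_add_inner_le hP hlam hx hu)
  have hinner : inner ℝ (w - Aq) (y - K.zdag) ≤ ‖w‖ * Ddag P K - inner ℝ q (P.A y - P.d) := by
    rw [inner_sub_left, hAq, ContinuousLinearMap.adjoint_inner_left, hP.A_sub_d_eq]
    gcongr
    exact (real_inner_le_norm _ _).trans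
      (mul_le_mul_of_nonneg_left (hP.norm_sub_zdag_le hy_dom) (norm_nonneg _))
  have hDw := mul_le_mul_of_nonneg_left hw_le hP.Ddag_pos.le
  have hdw := mul_le_mul_of_nonneg_right hP.ddag_le_Ddag (norm_nonneg w)
  have hdK := mul_le_mul_of_nonneg_right
    (add_le_add hP.ddag_le_Ddag (hP.norm_sub_zdag_le hy_dom)) hP.Kh_nonneg
  linarith [mul_le_mul_of_nonneg_left hsing hP.ddag_pos.le]

theorem IsProxSweep.norm_dual_le {p' : EuclideanSpace ℝ (Fin l)} (hy : IsProxSweep P S c x p y)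
    (hP : Assumptions P K) (hS : S.Admissible K) (hc : 0 < c) (hx : x ∈ P.dom)
    (hp : p ∈ P.A.range)
    (hp' : p' = (1 - S.theta) • p + (S.chi * c) • (P.A y - P.d)) :
    ‖p'‖ ≤ (1 - S.theta) * ‖p‖
      + 2 * S.theta / kappa4 P K S * (‖sweepResidual P S c x y‖ + (K.Kh + Gf P)) := by
  have hχ := hS.chi_pos
  have hθ := hS.theta_pos
  have hd := hP.ddag_pos
  have hD := hP.Ddag_pos
  have hσ := hP.sigmaPlus_pos
  set V := ‖sweepResidual P S c x y‖ + (K.Kh + Gf P)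
  have hV : 0 ≤ V := add_nonneg (norm_nonneg _) (add_nonneg hP.Kh_nonneg hP.Gf_nonneg)
  rw [← sub_le_iff_le_add']
  rcases le_total ‖p'‖ ((1 - S.theta) * ‖p‖) with hle | hge
  · have h4 := hP.kappa4_pos hS
    exact (sub_nonpos.2 hle).trans (by positivity)
  have hinner := inner_nonneg_of_lt_norm_dual hχ hS.chi_le hS.theta_le hc hp' hge
  have hslater := hy.slater_bound hP hS.lam_pos hx hp
  set q := (1 - S.theta) • p + c • (P.A y - P.d)
  calc ‖p'‖ - (1 - S.theta) * ‖p‖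
      ≤ S.chi * ‖q‖ := norm_dual_sub_le hχ.le hS.chi_le hS.theta_le hp'
    _ ≤ S.chi * (2 * Ddag P K * V / (ddag P K * sigmaPlus P)) := by
        gcongr
        rw [le_div_iff₀ (by positivity)]
        linarith
    _ = 2 * S.theta / kappa4 P K S * V := by
        unfold kappa4
        field_simp

end Multiplier

/-- An infinite run of the static method with penalty `c`, its termination tests being ignored,
from an admissible starting pair. -/
structure IsTrajectory (P : Problem B n l) (S : Params) (c : ℝ) (x : ℕ → Blocks n)
    (p : ℕ → EuclideanSpace ℝ (Fin l)) : Prop where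
  primal_zero : x 0 ∈ P.dom
  dual_zero : p 0 ∈ P.A.range
  sweep : ∀ i, IsProxSweep P S c (x i) (p i) (x (i + 1))
  dual_succ : ∀ i, p (i + 1) = (1 - S.theta) • p i + (S.chi * c) • (P.A (x (i + 1)) - P.d)

/-- The Lyapunov function of the static method: the augmented Lagrangian, corrected by the
multiplier and by its last increment so as to absorb the ascent of the dual steps. -/
def potential (P : Problem B n l) (S : Params) (c : ℝ) (x : ℕ → Blocks n)
    (p : ℕ → EuclideanSpace ℝ (Fin l)) (i : ℕ) : ℝ :=
  P.lagReal S.theta c (x i) (p i)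
    - (1 - S.theta) / (2 * (S.chi * c)) * (S.theta * ‖p i‖ ^ 2
      - (1 - S.theta) * (2 - S.theta) / S.theta * ‖p i - p (i - 1)‖ ^ 2)

variable {c : ℝ} {x : ℕ → Blocks n} {p : ℕ → EuclideanSpace ℝ (Fin l)}

namespace IsTrajectory

theorem mem_dom (hT : IsTrajectory P S c x p) (hP : Assumptions P K) (hlam : 0 < S.lam) (i : ℕ) :
    x i ∈ P.dom := by
  induction i with
  | zero => exact hT.primal_zero
  | succ i ih => exact (hT.sweep i).mem_dom hP hlam ih

theorem mem_range (hT : IsTrajectory P S c x p) (hP : Assumptions P K) (i : ℕ) :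
    p i ∈ P.A.range := by
  induction i with
  | zero => exact hT.dual_zero
  | succ i ih => exact hT.dual_succ i ▸ hP.smul_add_smul_mem_range ih _ _ _

theorem norm_dual_le (hT : IsTrajectory P S c x p) (hP : Assumptions P K)
    (hS : S.Admissible K) (hc : 0 ≤ c) (hp : ‖p 0‖ ≤ kappa1 P K S * c) (i : ℕ) :
    ‖p i‖ ≤ kappa1 P K S * c := by
  have hθ := hS.theta_pos
  have hθ₁ := sub_nonneg.2 hS.theta_le
  have hχc : 0 ≤ S.chi * c := mul_nonneg hS.chi_pos.le hc
  induction i with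
  | zero => exact hp
  | succ i ih =>
    calc ‖p (i + 1)‖
        ≤ (1 - S.theta) * ‖p i‖ + S.chi * c * ‖P.A (x (i + 1)) - P.d‖ := by
          rw [hT.dual_succ, ← norm_smul_of_nonneg hθ₁, ← norm_smul_of_nonneg hχc]
          exact norm_add_le _ _
      _ ≤ (1 - S.theta) * (kappa1 P K S * c) + S.chi * c * (‖P.A‖ * Ddag P K) := by
          gcongr
          exact hP.norm_A_sub_d_le (hT.mem_dom hP hS.lam_pos _)
      _ = kappa1 P K S * c := by
          unfold kappa1
          field_simp
          ring

theorem potential_sub (hT : IsTrajectory P S c x p) (hχc : 0 < S.chi * c) (hθ : 0 < S.theta)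
    (i : ℕ) :
    potential P S c x p (i + 1) - potential P S c x p (i + 2) =
      P.lagReal S.theta c (x (i + 1)) (p (i + 1)) - P.lagReal S.theta c (x (i + 2)) (p (i + 1))
      - (1 - S.theta) * (2 - S.theta) / (2 * (S.chi * c) * S.theta)
        * (‖p (i + 2) - p (i + 1)‖ ^ 2 - (1 - S.theta) * ‖p (i + 1) - p i‖ ^ 2) := by
  have hascent : P.lagReal S.theta c (x (i + 2)) (p (i + 2))
      - P.lagReal S.theta c (x (i + 2)) (p (i + 1)) =
      (1 - S.theta) * inner ℝ (p (i + 2) - p (i + 1)) (P.A (x (i + 2)) - P.d) := by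
    unfold Problem.lagReal
    rw [inner_sub_left]
    ring
  rw [inner_dual_step hχc (hT.dual_succ (i + 1))] at hascent
  unfold potential
  rw [Nat.add_sub_cancel, show i + 2 - 1 = i + 1 from rfl, eq_add_of_sub_eq hascent]
  field_simp
  ring

theorem norm_sq_dual_increment_le (hT : IsTrajectory P S c x p) (hθ : 0 < S.theta)
    (hθ₁ : S.theta ≤ 1) (i : ℕ) :
    ‖p (i + 2) - p (i + 1)‖ ^ 2 - (1 - S.theta) * ‖p (i + 1) - p i‖ ^ 2 ≤
      (S.chi * c) ^ 2 * (B * ∑ t, ‖P.ABlock t (x (i + 2) t - x (i + 1) t)‖ ^ 2) / S.theta := by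
  have hincrement : p (i + 2) - p (i + 1) = (1 - S.theta) • (p (i + 1) - p i)
      + (S.chi * c) • P.A (x (i + 2) - x (i + 1)) := by
    rw [hT.dual_succ (i + 1)]
    nth_rewrite 2 [hT.dual_succ i]
    rw [map_sub]
    module
  have hstep := norm_sq_smul_add_le hθ hθ₁ (p (i + 1) - p i)
    ((S.chi * c) • P.A (x (i + 2) - x (i + 1)))
  rw [← hincrement, ← sub_le_iff_le_add'] at hstep
  refine hstep.trans ?_
  rw [norm_smul, mul_pow, Real.norm_eq_abs, sq_abs]
  gcongr
  exact P.norm_A_sq_le _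

theorem potential_decrease (hT : IsTrajectory P S c x p) (hP : Assumptions P K)
    (hS : S.Admissible K) (hc : 0 < c) (i : ℕ) :
    3 / (4 * S.lam) * ‖x (i + 2) - x (i + 1)‖ ^ 2
      + c / 4 * ∑ t, ‖P.ABlock t (x (i + 2) t - x (i + 1) t)‖ ^ 2 ≤
      potential P S c x p (i + 1) - potential P S c x p (i + 2) := by
  have hθ := hS.theta_pos
  have hχ := hS.chi_pos
  have hlam := hS.lam_pos
  have hdescent := (hT.sweep (i + 1)).lagReal_decrease hP hS (hT.mem_dom hP hlam (i + 1))
  have hascent := hT.norm_sq_dual_increment_le hθ hS.theta_le i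
  rw [hT.potential_sub (by positivity) hθ]
  set Q := ∑ t, ‖P.ABlock t (x (i + 2) t - x (i + 1) t)‖ ^ 2
  set γ := (1 - S.theta) * (2 - S.theta) / (2 * (S.chi * c) * S.theta) with hγ
  have hγ_nonneg : 0 ≤ γ := div_nonneg
    (mul_nonneg (by linarith [hS.theta_le]) (by linarith [hS.theta_le])) (by positivity)
  have : 0 ≤ Q := Finset.sum_nonneg fun _ _ => sq_nonneg _
  have hprimal : 3 / (4 * S.lam) * ‖x (i + 2) - x (i + 1)‖ ^ 2 + c / 2 * Q ≤
      P.lagReal S.theta c (x (i + 1)) (p (i + 1))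
        - P.lagReal S.theta c (x (i + 2)) (p (i + 1)) := by
    refine le_of_mul_le_mul_left (le_of_eq_of_le ?_ hdescent) hlam
    field_simp
  have hdual : γ * ((S.chi * c) ^ 2 * (B * Q) / S.theta) ≤ c / 4 * Q := by
    calc γ * ((S.chi * c) ^ 2 * (B * Q) / S.theta)
        = 2 * S.chi * B * (2 - S.theta) * (1 - S.theta) / S.theta ^ 2 * (c / 4 * Q) := by
          rw [hγ]
          field_simp
          ring
      _ ≤ 1 * (c / 4 * Q) := by
          gcongr
          exact div_le_one_of_le₀ hS.chi_theta (sq_nonneg _)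
      _ = c / 4 * Q := one_mul _
  linarith [mul_le_mul_of_nonneg_left hascent hγ_nonneg]

theorem mul_infeasibility_le (hT : IsTrajectory P S c x p) (hχc : 0 ≤ S.chi * c)
    (hθ₁ : S.theta ≤ 1) (i : ℕ) :
    S.chi * c * ‖P.A (x (i + 1)) - P.d‖ ≤ ‖p (i + 1)‖ + (1 - S.theta) * ‖p i‖ :=
  mul_norm_le_of_dual_step hχc hθ₁ (hT.dual_succ i)

theorem sum_multiplier_terms_le (hT : IsTrajectory P S c x p) (hP : Assumptions P K)
    (hS : S.Admissible K) (hc : 0 < c) (i : ℕ) {R : ℝ} (hR : ‖p i‖ ≤ R) (hR' : ‖p (i + 1)‖ ≤ R) :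
    (1 - S.theta) * inner ℝ (p (i + 1)) (P.A (x (i + 1)) - P.d)
      + c / 2 * ‖P.A (x (i + 1)) - P.d‖ ^ 2 ≤
      (S.theta ^ 2 / 2 + (2 - S.theta) ^ 2 / 2) * (R ^ 2 / (S.chi ^ 2 * c)) := by
  have hχ := hS.chi_pos
  have hR₀ : 0 ≤ R := (norm_nonneg _).trans hR
  have hθ₁ : 0 ≤ 1 - S.theta := sub_nonneg.2 hS.theta_le
  set r := P.A (x (i + 1)) - P.d
  set Z := R ^ 2 / (S.chi ^ 2 * c) with hZ
  have hr : ‖r‖ ≤ (2 - S.theta) * R / (S.chi * c) := by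
    rw [le_div_iff₀' (by positivity)]
    linarith [hT.mul_infeasibility_le (by positivity) hS.theta_le i,
      mul_le_mul_of_nonneg_left hR hθ₁]
  have hinner : (1 - S.theta) * inner ℝ (p (i + 1)) r ≤ S.theta ^ 2 / 2 * Z := by
    calc (1 - S.theta) * inner ℝ (p (i + 1)) r
        ≤ (1 - S.theta) * (R * ((2 - S.theta) * R / (S.chi * c))) := by
          gcongr
          exact (real_inner_le_norm _ _).trans (mul_le_mul hR' hr (norm_nonneg _) hR₀)
      _ = S.chi * ((1 - S.theta) * (2 - S.theta)) * Z := by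
          rw [hZ]
          field_simp
      _ ≤ S.theta ^ 2 / 2 * Z := by
          gcongr
          exact hP.chi_theta_le hS
  have hsq : c / 2 * ‖r‖ ^ 2 ≤ (2 - S.theta) ^ 2 / 2 * Z := by
    calc c / 2 * ‖r‖ ^ 2 ≤ c / 2 * ((2 - S.theta) * R / (S.chi * c)) ^ 2 := by gcongr
      _ = (2 - S.theta) ^ 2 / 2 * Z := by
          rw [hZ]
          field_simp
  linarith

theorem potential_le (hT : IsTrajectory P S c x p) (hP : Assumptions P K) (hS : S.Admissible K)
    (hc : 0 < c) (i : ℕ) {R : ℝ} (hR : ‖p i‖ ≤ R) (hR' : ‖p (i + 1)‖ ≤ R) :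
    potential P S c x p (i + 1) ≤ sSup (P.phi '' P.dom) + 2 * R ^ 2 / (S.chi ^ 2 * c) := by
  have hθ := hS.theta_pos
  have hχ := hS.chi_pos
  have hθ₁ : 0 ≤ 1 - S.theta := sub_nonneg.2 hS.theta_le
  have hθ₂ : 0 ≤ 2 - S.theta := by linarith
  set Z := R ^ 2 / (S.chi ^ 2 * c) with hZ
  have hincrement : (1 - S.theta) / (2 * (S.chi * c)) * ((1 - S.theta) * (2 - S.theta) / S.theta
      * ‖p (i + 1) - p i‖ ^ 2) ≤ (1 - S.theta) * S.theta * Z := by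
    have hnorm : ‖p (i + 1) - p i‖ ≤ 2 * R := (norm_sub_le _ _).trans (by linarith)
    calc _ ≤ (1 - S.theta) / (2 * (S.chi * c)) * ((1 - S.theta) * (2 - S.theta) / S.theta
            * (2 * R) ^ 2) := by gcongr
      _ = S.chi * ((1 - S.theta) * (2 - S.theta)) * (2 * (1 - S.theta) / S.theta * Z) := by
          rw [hZ]
          field_simp
      _ ≤ S.theta ^ 2 / 2 * (2 * (1 - S.theta) / S.theta * Z) := by
          gcongr
          exact hP.chi_theta_le hS
      _ = (1 - S.theta) * S.theta * Z := by field_simp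
  have hdrop : 0 ≤ (1 - S.theta) / (2 * (S.chi * c)) * (S.theta * ‖p (i + 1)‖ ^ 2) := by
    positivity
  have hZθ : 0 ≤ S.theta * Z := by positivity
  have hgoal : 2 * R ^ 2 / (S.chi ^ 2 * c) = 2 * Z := mul_div_assoc _ _ _
  rw [potential, Problem.lagReal, Nat.add_sub_cancel, hgoal]
  linarith [hT.sum_multiplier_terms_le hP hS hc i hR hR',
    hP.phi_le_sSup (hT.mem_dom hP hS.lam_pos (i + 1))]

theorem le_potential (hT : IsTrajectory P S c x p) (hP : Assumptions P K) (hS : S.Admissible K)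
    (hc : 0 < c) (i : ℕ) :
    sInf (P.phi '' P.dom) - ‖p i‖ ^ 2 / (2 * S.chi ^ 2 * c) ≤ potential P S c x p i := by
  have hθ := hS.theta_pos
  have hχ := hS.chi_pos
  have hθ₁ : 0 ≤ 1 - S.theta := sub_nonneg.2 hS.theta_le
  have hθ₂ : 0 ≤ 2 - S.theta := by linarith
  have hsquare := neg_norm_sq_div_le_inner_add hc ((1 - S.theta) • p i) (P.A (x i) - P.d)
  rw [norm_smul_of_nonneg hθ₁, mul_pow, real_inner_smul_left] at hsquare
  have hcoeff : (1 - S.theta) ^ 2 * S.chi ^ 2 + (1 - S.theta) * S.theta * S.chi ≤ 1 := by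
    have h₁ := mul_le_mul_of_nonneg_left (pow_le_one₀ (n := 2) hχ.le hS.chi_le)
      (sq_nonneg (1 - S.theta))
    have h₂ := mul_le_mul_of_nonneg_left hS.chi_le (mul_nonneg hθ₁ hθ.le)
    linarith
  have hmultiplier : (1 - S.theta) ^ 2 * ‖p i‖ ^ 2 / (2 * c)
      + (1 - S.theta) / (2 * (S.chi * c)) * (S.theta * ‖p i‖ ^ 2) ≤
      ‖p i‖ ^ 2 / (2 * S.chi ^ 2 * c) := by
    calc _ = ((1 - S.theta) ^ 2 * S.chi ^ 2 + (1 - S.theta) * S.theta * S.chi)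
            * (‖p i‖ ^ 2 / (2 * S.chi ^ 2 * c)) := by field_simp
      _ ≤ ‖p i‖ ^ 2 / (2 * S.chi ^ 2 * c) := mul_le_of_le_one_left (by positivity) hcoeff
  have hincrement : 0 ≤ (1 - S.theta) / (2 * (S.chi * c))
      * ((1 - S.theta) * (2 - S.theta) / S.theta * ‖p i - p (i - 1)‖ ^ 2) := by positivity
  unfold potential Problem.lagReal
  linarith [hP.sInf_le_phi (hT.mem_dom hP hS.lam_pos i)]

theorem sweepResidual_sq_le (hT : IsTrajectory P S c x p) (hP : Assumptions P K)
    (hS : S.Admissible K) (hc : 0 < c) (i : ℕ) :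
    ‖sweepResidual P S c (x (i + 1)) (x (i + 2))‖ ^ 2 ≤ (kappa0 K S ^ 2 + kappa5 P * c) / 2
      * (potential P S c x p (i + 1) - potential P S c x p (i + 2)) := by
  have hlam := hS.lam_pos
  have hκ₅ := kappa5_nonneg hP
  have hslack : 0 ≤ ‖x (i + 2) - x (i + 1)‖ ^ 2 / (4 * S.lam) := by positivity
  calc _ ≤ (kappa0 K S ^ 2 + kappa5 P * c) * (‖x (i + 2) - x (i + 1)‖ ^ 2 / (4 * S.lam)
          + c / 8 * ∑ t, ‖P.ABlock t (x (i + 2) t - x (i + 1) t)‖ ^ 2) :=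
        DPADMM.sweepResidual_sq_le hP hlam hc.le (hT.mem_dom hP hlam _) (hT.mem_dom hP hlam _)
    _ ≤ (kappa0 K S ^ 2 + kappa5 P * c)
          * (1 / 2 * (potential P S c x p (i + 1) - potential P S c x p (i + 2))) := by
        gcongr
        have hdecrease := hT.potential_decrease hP hS hc i
        rw [div_mul_eq_mul_div, mul_div_assoc] at hdecrease
        linarith
    _ = _ := by ring

/-- The scalar sequence attached to a run of the static method. -/
def callSequence (hT : IsTrajectory P S c x p) (hP : Assumptions P K) (hS : S.Admissible K)
    (hc : 0 < c) (hp : ‖p 0‖ ≤ kappa1 P K S * c) : CallSequence where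
  θ := S.theta
  χ := S.chi
  c := c
  κ := kappa0 K S ^ 2 + kappa5 P * c
  κ₁ := kappa1 P K S
  κ₄ := kappa4 P K S
  G := K.Kh + Gf P
  lo := sInf (P.phi '' P.dom)
  hi := sSup (P.phi '' P.dom)
  multiplier i := ‖p i‖
  residual i := ‖sweepResidual P S c (x (i - 1)) (x i)‖
  infeasibility i := ‖P.A (x i) - P.d‖
  potential := potential P S c x p
  theta_pos := hS.theta_pos
  theta_le := hS.theta_le
  chi_pos := hS.chi_pos
  c_pos := hc
  kappa_pos := add_pos_of_pos_of_nonneg (pow_pos (hP.kappa0_pos hS.lam_pos) 2)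
    (mul_nonneg (kappa5_nonneg hP) hc.le)
  kappa4_pos := hP.kappa4_pos hS
  G_nonneg := add_nonneg hP.Kh_nonneg hP.Gf_nonneg
  multiplier_nonneg _ := norm_nonneg _
  multiplier_le := hT.norm_dual_le hP hS hc.le hp
  multiplier_succ_le i := (hT.sweep i).norm_dual_le hP hS hc (hT.mem_dom hP hS.lam_pos i)
    (hT.mem_range hP i) (hT.dual_succ i)
  residual_sq_le
    | i + 1, _ => hT.sweepResidual_sq_le hP hS hc i
  infeasibility_le i :=
    (hT.mul_infeasibility_le (mul_pos hS.chi_pos hc).le hS.theta_le i).trans <| by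
      linarith [mul_nonneg hS.theta_pos.le (norm_nonneg (p i))]
  potential_le i _ := hT.potential_le hP hS hc i
  le_potential i := hT.le_potential hP hS hc (i + 1)

end IsTrajectory

end Call

/-! ### The length of a call -/

section CallLength

variable {B : ℕ} {n : Fin B → ℕ} {l : ℕ} {P : Problem B n l} {K : Moduli n} {S : Params}
  {ρ η : ℝ}

namespace State

variable {s s' : State n l}

theorem v_congr (hc : s.c = s'.c) {k i : ℕ} (hx : ∀ i ≤ k, s.x i = s'.x i) (hi : i ≤ k) :
    s.v P S i = s'.v P S i := by
  rw [v_eq, v_eq, hx i hi, hx (i - 1) ((Nat.sub_le i 1).trans hi), hc]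

theorem returns_congr (hc : s.c = s'.c) (hk : s.k = s'.k) (hx : ∀ i ≤ s.k, s.x i = s'.x i) :
    s.Returns P S ρ η ↔ s'.Returns P S ρ η := by
  have hv : ∑ i ∈ Finset.Icc (s.k / 2) s.k, ‖s.v P S i‖ =
      ∑ i ∈ Finset.Icc (s.k / 2) s.k, ‖s'.v P S i‖ :=
    Finset.sum_congr rfl fun i hi => congrArg norm (v_congr hc hx (Finset.mem_Icc.1 hi).2)
  have hfeas : ∑ i ∈ Finset.Icc (s.k / 2) s.k, ‖P.A (s.x i) - P.d‖ =
      ∑ i ∈ Finset.Icc (s.k / 2) s.k, ‖P.A (s'.x i) - P.d‖ :=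
    Finset.sum_congr rfl fun i hi => by rw [hx i (Finset.mem_Icc.1 hi).2]
  refine or_congr ?_ ?_
  · rw [Successful, Successful, v_congr hc hx le_rfl, hx s.k le_rfl, hk]
  · rw [PassesErgodicTest, PassesErgodicTest, hv, hfeas, hc, hk]

theorem not_returns_start (c : ℝ) (z : Blocks n) (p : EuclideanSpace ℝ (Fin l)) (ρ η : ℝ) :
    ¬ (start c z p).Returns P S ρ η := by
  rintro (h | h)
  · exact Nat.not_succ_le_zero 0 h.1
  · exact Nat.not_succ_le_zero 2 h.2.1

theorem PassesErgodicTest.exists_successful (h : s.PassesErgodicTest P S ρ η) (hρ : 0 < ρ)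
    (hη : 0 < η) (hk : (s.k : ℝ) ≤ s.c ^ 3) :
    ∃ i ≤ s.k, (State.mk s.c i s.x s.p).Successful P S ρ η := by
  obtain ⟨heven, hthree, htest⟩ := h
  have hk_pos : (0 : ℝ) < s.k := by exact_mod_cast (by omega : 0 < s.k)
  have hsqrt : 1 ≤ Real.sqrt (s.c ^ 3 / s.k) := by rwa [Real.one_le_sqrt, one_le_div₀ hk_pos]
  have hmean :
      windowMean (fun i => 1 / ρ * ‖s.v P S i‖ + 1 / η * ‖P.A (s.x i) - P.d‖) s.k ≤ 1 := by
    rw [windowMean_add_smul]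
    refine le_trans (add_le_add_right ?_ _) htest
    exact mul_le_mul_of_nonneg_right (le_mul_of_one_le_right (one_div_pos.2 hη).le hsqrt)
      (windowMean_nonneg (fun i => norm_nonneg (P.A (s.x i) - P.d)) s.k)
  obtain ⟨i, hi, hle⟩ := exists_le_windowMean
    (fun i => 1 / ρ * ‖s.v P S i‖ + 1 / η * ‖P.A (s.x i) - P.d‖) heven
  have hi := Finset.mem_Icc.1 hi
  have hsum := hle.trans hmean
  have hv : 0 ≤ 1 / ρ * ‖s.v P S i‖ := by positivity
  have hfeas : 0 ≤ 1 / η * ‖P.A (s.x i) - P.d‖ := by positivity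
  refine ⟨i, hi.2, show 1 ≤ i by omega, ?_, ?_⟩
  · rw [← div_le_one hρ, ← one_div_mul_eq_div]
    exact (le_add_of_nonneg_right hfeas).trans hsum
  · rw [← div_le_one hη, ← one_div_mul_eq_div]
    exact (le_add_of_nonneg_left hv).trans hsum

end State

theorem kappa2_eq (hP : Assumptions P K) (hS : S.Admissible K) :
    kappa2 P K S = 1 / S.theta * (1 + 2 * (K.Kh + Gf P) / kappa4 P K S) + 1 := by
  have := hP.ddag_pos
  have := hP.Ddag_pos
  have := hP.sigmaPlus_pos
  have := hS.chi_pos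
  have := hS.theta_pos
  unfold kappa2 kappa4
  field_simp

theorem iterBound_eq (P : Problem B n l) (K : Moduli n) (S : Params) (c ρ η cLow : ℝ) :
    iterBound P K S c ρ η cLow (2 * kappa1 P K S) =
      48 * (3 + 8 * ((kappa0 K S ^ 2 + kappa5 P * c) *
          (deltaPhi P + 81 * kappa1 P K S ^ 2 * c / S.chi ^ 2) / kappa4 P K S ^ 2)
        + 3 * ((1 - S.theta) * (kappa1 P K S * c))
        + 3 * ((kappa0 K S ^ 2 + kappa5 P * c) * kappaTilde0 P K S cLow ^ 2 / ρ ^ 2)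
        + 108 * (kappa2 P K S ^ 2 * c / (S.chi ^ 2 * η ^ 2))) := by
  unfold iterBound kappa6 kappaTilde1 kappaTilde2 xi0 xi1 kappa3
  simp only [div_eq_mul_inv, mul_inv]
  ring

namespace Assumptions

theorem kappa1_nonneg (hP : Assumptions P K) (hS : S.Admissible K) : 0 ≤ kappa1 P K S := by
  have := hP.Ddag_pos
  have := hS.chi_pos
  have := hS.theta_pos
  unfold kappa1
  positivity

theorem kappa2_pos (hP : Assumptions P K) (hS : S.Admissible K) : 0 < kappa2 P K S := by
  have := hP.kappa4_pos hS
  have := hS.theta_pos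
  have := hP.Kh_nonneg
  have := hP.Gf_nonneg
  rw [kappa2_eq hP hS]
  positivity

theorem le_kappaTilde0_sq (hP : Assumptions P K) (hS : S.Admissible K) {c c₁ : ℝ} (hc₁ : 0 < c₁)
    (hc : c₁ ≤ c) : 4 * (deltaPhi P + 9 * kappa2 P K S ^ 2 / (S.chi ^ 2 * c)) ≤
      kappaTilde0 P K S c₁ ^ 2 := by
  have hκ₂ := hP.kappa2_pos hS
  have hχ := hS.chi_pos
  unfold kappaTilde0
  set a := Real.sqrt (deltaPhi P)
  set b := 5 * kappa2 P K S / (S.chi * Real.sqrt c₁) with hb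
  have ha : deltaPhi P = a ^ 2 := (Real.sq_sqrt hP.deltaPhi_nonneg).symm
  have hb_le : 9 * kappa2 P K S ^ 2 / (S.chi ^ 2 * c) ≤ b ^ 2 := by
    rw [hb, div_pow, mul_pow, mul_pow, Real.sq_sqrt hc₁.le]
    gcongr
    norm_num
  have hab : 0 ≤ a * b := mul_nonneg (Real.sqrt_nonneg _) (by positivity)
  calc 4 * (deltaPhi P + 9 * kappa2 P K S ^ 2 / (S.chi ^ 2 * c)) ≤ 4 * (a ^ 2 + b ^ 2) := by
        rw [ha]
        gcongr
    _ ≤ (2 * (a + b)) ^ 2 := by linarith [show (2 * (a + b)) ^ 2 =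
        4 * (a ^ 2 + b ^ 2) + 8 * (a * b) by ring]

theorem callLength_le_iterBound (hP : Assumptions P K) (hS : S.Admissible K) {c c₁ : ℝ}
    (hc₁ : 0 < c₁) (hc : c₁ ≤ c) (ρ η : ℝ) :
    18 + 4 * (2 * (kappa0 K S ^ 2 + kappa5 P * c) *
          (deltaPhi P + 5 / 2 * kappa1 P K S ^ 2 * c / S.chi ^ 2) / kappa4 P K S ^ 2
          + (1 - S.theta) * (kappa1 P K S * c))
        + 2 * (2 * (kappa0 K S ^ 2 + kappa5 P * c) *
          (deltaPhi P + 9 * kappa2 P K S ^ 2 / (S.chi ^ 2 * c)) / ρ ^ 2)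
        + 2 * (8 * kappa2 P K S ^ 2 * c / (S.chi ^ 2 * η ^ 2)) ≤
      iterBound P K S c ρ η c₁ (2 * kappa1 P K S) / 4 := by
  have hc_pos : 0 < c := hc₁.trans_le hc
  have hχ := hS.chi_pos
  have hκ : 0 ≤ kappa0 K S ^ 2 + kappa5 P * c :=
    add_nonneg (sq_nonneg _) (mul_nonneg (kappa5_nonneg hP) hc_pos.le)
  have hκ₁ := hP.kappa1_nonneg hS
  have hθκ₁ : 0 ≤ (1 - S.theta) * (kappa1 P K S * c) :=
    mul_nonneg (sub_nonneg.2 hS.theta_le) (by positivity)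
  have hcrude : 2 * (kappa0 K S ^ 2 + kappa5 P * c) *
        (deltaPhi P + 5 / 2 * kappa1 P K S ^ 2 * c / S.chi ^ 2) / kappa4 P K S ^ 2 ≤
      2 * ((kappa0 K S ^ 2 + kappa5 P * c) *
        (deltaPhi P + 81 * kappa1 P K S ^ 2 * c / S.chi ^ 2) / kappa4 P K S ^ 2) := by
    rw [← mul_div_assoc, ← mul_assoc]
    gcongr
    norm_num
  have hcrude_nonneg : 0 ≤ (kappa0 K S ^ 2 + kappa5 P * c) *
      (deltaPhi P + 81 * kappa1 P K S ^ 2 * c / S.chi ^ 2) / kappa4 P K S ^ 2 := by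
    have := hP.deltaPhi_nonneg
    positivity
  have hsharp : 2 * (kappa0 K S ^ 2 + kappa5 P * c) *
        (deltaPhi P + 9 * kappa2 P K S ^ 2 / (S.chi ^ 2 * c)) / ρ ^ 2 ≤
      1 / 2 * ((kappa0 K S ^ 2 + kappa5 P * c) * kappaTilde0 P K S c₁ ^ 2 / ρ ^ 2) :=
    calc _ = 1 / 2 * ((kappa0 K S ^ 2 + kappa5 P * c) *
            (4 * (deltaPhi P + 9 * kappa2 P K S ^ 2 / (S.chi ^ 2 * c))) / ρ ^ 2) := by ring
      _ ≤ _ := by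
          gcongr
          exact hP.le_kappaTilde0_sq hS hc₁ hc
  have hsharp_nonneg : 0 ≤ (kappa0 K S ^ 2 + kappa5 P * c) * kappaTilde0 P K S c₁ ^ 2 / ρ ^ 2 := by
    positivity
  have hfeas_nonneg : 0 ≤ kappa2 P K S ^ 2 * c / (S.chi ^ 2 * η ^ 2) := by positivity
  rw [iterBound_eq, mul_assoc 8, mul_div_assoc 8]
  linarith

end Assumptions

theorem IsTrajectory.exists_passesErgodicTest {c c₁ : ℝ} {x : ℕ → Blocks n}
    {p : ℕ → EuclideanSpace ℝ (Fin l)} (hT : IsTrajectory P S c x p) (hP : Assumptions P K)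
    (hS : S.Admissible K) (hc₁ : 0 < c₁) (hc : c₁ ≤ c) (hp : ‖p 0‖ ≤ kappa1 P K S * c)
    (hρ : 0 < ρ) (hη : 0 < η) :
    ∃ k : ℕ, (k : ℝ) ≤ iterBound P K S c ρ η c₁ (2 * kappa1 P K S) / 4 ∧
      (State.mk c k x p).PassesErgodicTest P S ρ η := by
  let Q := hT.callSequence hP hS (hc₁.trans_le hc) hp
  obtain ⟨k, heven, hthree, htest, hk⟩ := Q.exists_even_ergodic_test_le_one hρ hη
  have hκ₂ : Q.κ₂ = kappa2 P K S := (kappa2_eq hP hS).symm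
  refine ⟨k, le_trans ?_ (hP.callLength_le_iterBound hS hc₁ hc ρ η), heven, hthree, htest⟩
  rw [CallSequence.sharpGap, hκ₂] at hk
  exact hk

namespace Assumptions

theorem exists_trajectory (hP : Assumptions P K) (hlam : 0 < S.lam) (c : ℝ) {z : Blocks n}
    (hz : z ∈ P.dom) {p₀ : EuclideanSpace ℝ (Fin l)} (hp₀ : p₀ ∈ P.A.range) :
    ∃ x p, IsTrajectory P S c x p ∧ x 0 = z ∧ p 0 = p₀ := by
  choose g hg using fun a : P.dom × EuclideanSpace ℝ (Fin l) =>
    hP.exists_sweep hlam c a.2 a.1.2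
  let step (a : P.dom × EuclideanSpace ℝ (Fin l)) : P.dom × EuclideanSpace ℝ (Fin l) :=
    (⟨g a, (hg a).mem_dom hP hlam a.1.2⟩,
      (1 - S.theta) • a.2 + (S.chi * c) • (P.A (g a) - P.d))
  refine ⟨fun i => (step^[i] (⟨z, hz⟩, p₀)).1, fun i => (step^[i] (⟨z, hz⟩, p₀)).2,
    ⟨hz, hp₀, fun i => ?_, fun i => ?_⟩, rfl, rfl⟩
  · rw [Function.iterate_succ_apply']
    exact hg _
  · simp only [Function.iterate_succ_apply', step]

end Assumptions

end CallLength

/-! ### The cost of all calls -/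

section CallCosts

theorem geom_sum_le_two_mul_pow {r : ℝ} (hr : 2 ≤ r) (j : ℕ) :
    ∑ i ∈ Finset.range (j + 1), r ^ i ≤ 2 * r ^ j := by
  induction j with
  | zero => norm_num
  | succ j ih =>
    have : 2 * r ^ j ≤ r ^ (j + 1) := by
      rw [pow_succ']
      gcongr
    rw [Finset.sum_range_succ]
    linarith

theorem le_add_of_sq_le_mul_add_sq {s a b : ℝ} (ha : 0 ≤ a) (hb : 0 ≤ b)
    (h : s ^ 2 ≤ a * s + b ^ 2) : s ≤ a + b := by
  by_contra! hlt
  nlinarith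

variable {T c₁ ε : ℝ}

theorem le_of_cube_lt_call_cost {s : ℝ} (hT : 0 ≤ T) (hc₁ : 0 < c₁) (hε : 0 < ε) (hs : 0 < s)
    (h : (c₁ * s) ^ 3 < T / 4 * (s / ε ^ 2 + s ^ 2)) :
    s ≤ T / c₁ ^ 3 / 4 + Real.sqrt (T / c₁ ^ 3) / (2 * ε) := by
  refine le_add_of_sq_le_mul_add_sq (by positivity) (by positivity) ?_
  have hsq : (Real.sqrt (T / c₁ ^ 3) / (2 * ε)) ^ 2 = T / c₁ ^ 3 / 4 / ε ^ 2 := by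
    rw [div_pow, Real.sq_sqrt (by positivity)]
    ring
  rw [hsq]
  refine le_of_mul_le_mul_left ?_ (by positivity : 0 < c₁ ^ 3 * s)
  calc c₁ ^ 3 * s * s ^ 2 = (c₁ * s) ^ 3 := by ring
    _ ≤ T / 4 * (s / ε ^ 2 + s ^ 2) := h.le
    _ = c₁ ^ 3 * s * (T / c₁ ^ 3 / 4 * s + T / c₁ ^ 3 / 4 / ε ^ 2) := by
        field_simp
        ring

theorem call_cost_le {r E₀ E₁ : ℝ} (hE₀ : 0 ≤ E₀) (hE₁ : 0 ≤ E₁) (hε : 0 < ε) (hr₀ : 0 ≤ r)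
    (hr : r ≤ E₀ / 2 + E₁ / 2 / ε) :
    r / ε ^ 2 + r ^ 2 ≤ 2 * (2 * E₀ ^ 2 + (E₀ + 2 * E₁ ^ 2) / ε ^ 2 + E₁ / ε ^ 3) := by
  have hsq : r ^ 2 ≤ 2 * ((E₀ / 2) ^ 2 + (E₁ / 2 / ε) ^ 2) :=
    (pow_le_pow_left₀ hr₀ hr 2).trans add_sq_le
  calc r / ε ^ 2 + r ^ 2
      ≤ (E₀ / 2 + E₁ / 2 / ε) / ε ^ 2 + 2 * ((E₀ / 2) ^ 2 + (E₁ / 2 / ε) ^ 2) := by gcongr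
    _ = 1 / 2 * E₀ ^ 2 + (1 / 2 * E₀ + 1 / 2 * E₁ ^ 2) / ε ^ 2 + 1 / 2 * E₁ / ε ^ 3 := by
        field_simp
        ring
    _ ≤ 4 * E₀ ^ 2 + (2 * E₀ + 4 * E₁ ^ 2) / ε ^ 2 + 2 * E₁ / ε ^ 3 := by
        gcongr <;> norm_num
    _ = _ := by ring

theorem penalty_factor_le {r E₀ E₁ : ℝ} (hT : 1 ≤ T) (hc₁ : 0 < c₁) (hε : 0 < ε)
    (hE₀ : E₀ = 2 * (1 + T ^ 2 / c₁ ^ 3)) (hE₁ : E₁ = 2 * Real.sqrt (T / c₁ ^ 3))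
    (hr : r ≤ 1 ∨ r ≤ T / c₁ ^ 3 / 2 + Real.sqrt (T / c₁ ^ 3) / ε) :
    r ≤ E₀ / 2 + E₁ / 2 / ε := by
  have : 0 < T := zero_lt_one.trans_le hT
  have hτ : T / c₁ ^ 3 ≤ T ^ 2 / c₁ ^ 3 := by
    gcongr
    exact le_self_pow₀ hT two_ne_zero
  have hτ₀ : 0 ≤ T / c₁ ^ 3 := by positivity
  have hsqrt : 0 ≤ Real.sqrt (T / c₁ ^ 3) / ε := by positivity
  rw [hE₀, hE₁, mul_div_cancel_left₀ _ two_ne_zero, mul_div_cancel_left₀ _ two_ne_zero]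
  rcases hr with hr | hr <;> linarith

theorem sum_call_cost_le {E₀ E₁ : ℝ} (hT : 1 ≤ T) (hc₁ : 0 < c₁) (hε : 0 < ε)
    (hE₀ : E₀ = 2 * (1 + T ^ 2 / c₁ ^ 3)) (hE₁ : E₁ = 2 * Real.sqrt (T / c₁ ^ 3)) (j : ℕ)
    (hj : j = 0 ∨ (c₁ * 2 ^ (j - 1)) ^ 3 <
      T / 4 * ((2 : ℝ) ^ (j - 1) / ε ^ 2 + ((2 : ℝ) ^ (j - 1)) ^ 2)) :
    ∑ i ∈ Finset.range (j + 1), T / 4 * ((2 : ℝ) ^ i / ε ^ 2 + ((2 : ℝ) ^ i) ^ 2) ≤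
      T * (2 * E₀ ^ 2 + (E₀ + 2 * E₁ ^ 2) / ε ^ 2 + E₁ / ε ^ 3) := by
  have hT₀ : 0 ≤ T := zero_le_one.trans hT
  have hlast : (2 : ℝ) ^ j ≤ 1 ∨
      (2 : ℝ) ^ j ≤ T / c₁ ^ 3 / 2 + Real.sqrt (T / c₁ ^ 3) / ε := by
    rcases j with _ | j
    · exact Or.inl (pow_zero 2).le
    · have hcube := hj.resolve_left j.succ_ne_zero
      rw [Nat.add_sub_cancel] at hcube
      have := le_of_cube_lt_call_cost hT₀ hc₁ hε (by positivity) hcube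
      right
      calc (2 : ℝ) ^ (j + 1) = 2 * 2 ^ j := pow_succ' 2 j
        _ ≤ 2 * (T / c₁ ^ 3 / 4 + Real.sqrt (T / c₁ ^ 3) / (2 * ε)) := by gcongr
        _ = _ := by
            field_simp
            ring
  have hsum : ∑ i ∈ Finset.range (j + 1), ((2 : ℝ) ^ i) ^ 2 ≤ 2 * (2 ^ j) ^ 2 := by
    have hsq (i : ℕ) : ((2 : ℝ) ^ i) ^ 2 = 4 ^ i := by
      rw [pow_right_comm]
      norm_num
    simp only [hsq]
    exact geom_sum_le_two_mul_pow (by norm_num) j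
  calc ∑ i ∈ Finset.range (j + 1), T / 4 * ((2 : ℝ) ^ i / ε ^ 2 + ((2 : ℝ) ^ i) ^ 2)
      = T / 4 * ((∑ i ∈ Finset.range (j + 1), (2 : ℝ) ^ i) / ε ^ 2 +
          ∑ i ∈ Finset.range (j + 1), ((2 : ℝ) ^ i) ^ 2) := by
        rw [← Finset.mul_sum, Finset.sum_add_distrib, Finset.sum_div]
    _ ≤ T / 4 * (2 * 2 ^ j / ε ^ 2 + 2 * (2 ^ j) ^ 2) := by
        gcongr
        exact geom_sum_le_two_mul_pow le_rfl j
    _ = T / 2 * (2 ^ j / ε ^ 2 + (2 ^ j) ^ 2) := by ring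
    _ ≤ T / 2 * (2 * (2 * E₀ ^ 2 + (E₀ + 2 * E₁ ^ 2) / ε ^ 2 + E₁ / ε ^ 3)) := by
        gcongr
        exact call_cost_le (hE₀ ▸ by positivity) (hE₁ ▸ by positivity) hε (by positivity)
          (penalty_factor_le hT hc₁ hε hE₀ hE₁ hlast)
    _ = _ := by ring

end CallCosts

namespace Assumptions

variable {B : ℕ} {n : Fin B → ℕ} {l : ℕ} {P : Problem B n l} {K : Moduli n} {S : Params}
  {c₁ : ℝ}

theorem one_le_T1 (hP : Assumptions P K) (hS : S.Admissible K) (hc₁ : 0 < c₁) :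
    1 ≤ T1 P K S c₁ := by
  have := hP.deltaPhi_nonneg
  have := hS.chi_pos
  have hθ : 0 ≤ 1 - S.theta := sub_nonneg.2 hS.theta_le
  have := hP.kappa1_nonneg hS
  have := kappa5_nonneg hP
  have hscale : ∀ X : ℝ, 0 ≤ X → 1 ≤ 48 * (3 + X) := fun X hX => by linarith
  rw [T1, iterBound_eq, add_assoc 3, add_assoc 3, add_assoc 3]
  exact hscale _ (by positivity)

theorem kappa_mul_le (P : Problem B n l) (K : Moduli n) (S : Params) {r : ℝ} (hr : 1 ≤ r) :
    kappa0 K S ^ 2 + kappa5 P * (c₁ * r) ≤ r * (kappa0 K S ^ 2 + kappa5 P * c₁) := by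
  linarith [le_mul_of_one_le_left (sq_nonneg (kappa0 K S)) hr]

theorem crude_term_mul_le (hP : Assumptions P K) (S : Params) {r : ℝ} (hc₁ : 0 < c₁)
    (hr : 1 ≤ r) :
    (kappa0 K S ^ 2 + kappa5 P * (c₁ * r)) *
        (deltaPhi P + 81 * kappa1 P K S ^ 2 * (c₁ * r) / S.chi ^ 2) / kappa4 P K S ^ 2 ≤
      (kappa0 K S ^ 2 + kappa5 P * c₁) *
        (deltaPhi P + 81 * kappa1 P K S ^ 2 * c₁ / S.chi ^ 2) / kappa4 P K S ^ 2 * r ^ 2 := by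
  have : 0 < r := zero_lt_one.trans_le hr
  have hΔ := hP.deltaPhi_nonneg
  have hκ₅ := kappa5_nonneg hP
  have hgap : deltaPhi P + 81 * kappa1 P K S ^ 2 * (c₁ * r) / S.chi ^ 2 ≤
      r * (deltaPhi P + 81 * kappa1 P K S ^ 2 * c₁ / S.chi ^ 2) := by
    rw [mul_add, ← mul_div_assoc]
    exact add_le_add (le_mul_of_one_le_left hΔ hr) (le_of_eq (by ring))
  calc _ ≤ r * (kappa0 K S ^ 2 + kappa5 P * c₁) *
          (r * (deltaPhi P + 81 * kappa1 P K S ^ 2 * c₁ / S.chi ^ 2)) / kappa4 P K S ^ 2 := by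
        gcongr ?_ * ?_ / _
        exact kappa_mul_le P K S hr
    _ = _ := by ring

theorem sharp_term_mul_le (hP : Assumptions P K) (S : Params) {ρ η r : ℝ} (hc₁ : 0 < c₁)
    (hρ : 0 < ρ) (hη : 0 < η) (hr : 1 ≤ r) :
    (kappa0 K S ^ 2 + kappa5 P * (c₁ * r)) * kappaTilde0 P K S c₁ ^ 2 / ρ ^ 2 ≤
      (kappa0 K S ^ 2 + kappa5 P * c₁) * kappaTilde0 P K S c₁ ^ 2 * (r / min ρ η ^ 2) := by
  have hκ₅ := kappa5_nonneg hP
  have : 0 < min ρ η := lt_min hρ hη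
  calc _ ≤ r * (kappa0 K S ^ 2 + kappa5 P * c₁) * kappaTilde0 P K S c₁ ^ 2 / min ρ η ^ 2 := by
        gcongr
        · exact kappa_mul_le P K S hr
        · exact min_le_left ρ η
    _ = _ := by ring

theorem iterBound_mul_le (hP : Assumptions P K) (hS : S.Admissible K) {ρ η r : ℝ}
    (hc₁ : 0 < c₁) (hρ : 0 < ρ) (hη : 0 < η) (hr : 1 ≤ r) :
    iterBound P K S (c₁ * r) ρ η c₁ (2 * kappa1 P K S) ≤
      T1 P K S c₁ * (r / min ρ η ^ 2 + r ^ 2) := by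
  have : 0 < r := zero_lt_one.trans_le hr
  have : 0 < min ρ η := lt_min hρ hη
  have hχ := hS.chi_pos
  have hΔ := hP.deltaPhi_nonneg
  have hκ₁ := hP.kappa1_nonneg hS
  have hκ₅ := kappa5_nonneg hP
  have hθ : 0 ≤ 1 - S.theta := sub_nonneg.2 hS.theta_le
  have hcrude := crude_term_mul_le hP S hc₁ hr
  have hsharp := sharp_term_mul_le hP S hc₁ hρ hη hr
  have hdual : (1 - S.theta) * (kappa1 P K S * (c₁ * r)) ≤
      (1 - S.theta) * (kappa1 P K S * c₁) * r ^ 2 := by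
    rw [mul_assoc (1 - S.theta), mul_assoc (kappa1 P K S)]
    gcongr
    exact le_self_pow₀ hr two_ne_zero
  have hfeas : kappa2 P K S ^ 2 * (c₁ * r) / (S.chi ^ 2 * η ^ 2) ≤
      kappa2 P K S ^ 2 * c₁ / S.chi ^ 2 * (r / min ρ η ^ 2) := by
    rw [div_mul_div_comm, ← mul_assoc]
    gcongr
    exact min_le_right ρ η
  rw [T1, iterBound_eq, iterBound_eq, one_pow, div_one, mul_one]
  set crude := (kappa0 K S ^ 2 + kappa5 P * c₁) *
    (deltaPhi P + 81 * kappa1 P K S ^ 2 * c₁ / S.chi ^ 2) / kappa4 P K S ^ 2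
  set dual := (1 - S.theta) * (kappa1 P K S * c₁)
  set sharp := (kappa0 K S ^ 2 + kappa5 P * c₁) * kappaTilde0 P K S c₁ ^ 2
  set feas := kappa2 P K S ^ 2 * c₁ / S.chi ^ 2
  have hpenalty : 0 ≤ (3 + 8 * crude + 3 * dual) * (r / min ρ η ^ 2) := by positivity
  have htolerance : 0 ≤ (3 * sharp + 108 * feas) * r ^ 2 := by positivity
  linarith [one_le_pow₀ hr (n := 2)]

theorem totalBound_le_div_cube (hP : Assumptions P K) (hS : S.Admissible K) {ε : ℝ}
    (hc₁ : 0 < c₁) (hε : 0 < ε) (hε₁ : ε ≤ 1) :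
    totalBound P K S c₁ ε ≤ totalBound P K S c₁ 1 / ε ^ 3 := by
  have hT : 0 ≤ T1 P K S c₁ := zero_le_one.trans (hP.one_le_T1 hS hc₁)
  have hE₀ : 0 ≤ E0 P K S c₁ := by
    unfold E0
    positivity
  have : 0 ≤ E1 P K S c₁ := by
    unfold E1
    positivity
  have hε_sq : ε ^ 3 ≤ ε ^ 2 := pow_le_pow_of_le_one hε.le hε₁ (Nat.le_succ 2)
  simp only [totalBound, one_pow, div_one]
  rw [mul_div_assoc, add_div _ (E1 P K S c₁), add_div (2 * E0 P K S c₁ ^ 2)]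
  gcongr
  exact le_div_self (by positivity) (by positivity) (pow_le_one₀ hε.le hε₁)

end Assumptions

/-! ### The dynamic method -/

section DynamicMethod

variable {B : ℕ} {n : Fin B → ℕ} {l : ℕ} {P : Problem B n l} {K : Moduli n} {S : Params}
  {ρ η c₁ : ℝ}

/-- The bound on the length of the call with penalty parameter `c₁ * 2 ^ j`. -/
def callBound (P : Problem B n l) (K : Moduli n) (S : Params) (ρ η c₁ : ℝ) (j : ℕ) : ℝ :=
  iterBound P K S (c₁ * 2 ^ j) ρ η c₁ (2 * kappa1 P K S) / 4

theorem callBound_le (hP : Assumptions P K) (hS : S.Admissible K) (hc₁ : 0 < c₁) (hρ : 0 < ρ)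
    (hη : 0 < η) (j : ℕ) :
    callBound P K S ρ η c₁ j ≤
      T1 P K S c₁ / 4 * ((2 : ℝ) ^ j / min ρ η ^ 2 + ((2 : ℝ) ^ j) ^ 2) := by
  have := hP.iterBound_mul_le hS hc₁ hρ hη (one_le_pow₀ one_le_two (n := j))
  unfold callBound
  linarith

/-- The invariant of the dynamic method: after `N` iterations it is in state `s` of call number
`j` (counted from `0`), whose iterates so far agree with the trajectory `(x, p)`. -/
structure CallInvariant (P : Problem B n l) (K : Moduli n) (S : Params) (ρ η c₁ : ℝ) (N : ℕ)
    (s : State n l) (j : ℕ) (x : ℕ → Blocks n) (p : ℕ → EuclideanSpace ℝ (Fin l)) : Prop where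
  c_eq : s.c = c₁ * 2 ^ j
  isTrajectory : IsTrajectory P S s.c x p
  norm_dual_zero_le : ‖p 0‖ ≤ kappa1 P K S * s.c
  x_eq : ∀ i ≤ s.k, s.x i = x i
  p_eq : ∀ i ≤ s.k, s.p i = p i
  not_returns : ∀ i < s.k, ¬ (State.mk s.c i x p).Returns P S ρ η
  count_le : (N : ℝ) ≤ ∑ i ∈ Finset.range j, callBound P K S ρ η c₁ i + s.k
  previous : j = 0 ∨ (c₁ * 2 ^ (j - 1)) ^ 3 < callBound P K S ρ η c₁ (j - 1)

namespace CallInvariant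

variable {N : ℕ} {s : State n l} {j : ℕ} {x : ℕ → Blocks n} {p : ℕ → EuclideanSpace ℝ (Fin l)}

theorem c_pos (h : CallInvariant P K S ρ η c₁ N s j x p) (hc₁ : 0 < c₁) : 0 < s.c := by
  rw [h.c_eq]
  positivity

theorem le_c (h : CallInvariant P K S ρ η c₁ N s j x p) (hc₁ : 0 < c₁) : c₁ ≤ s.c := by
  rw [h.c_eq]
  exact le_mul_of_one_le_right hc₁.le (one_le_pow₀ one_le_two)

theorem x_mem_dom (h : CallInvariant P K S ρ η c₁ N s j x p) (hP : Assumptions P K)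
    (hlam : 0 < S.lam) {i : ℕ} (hi : i ≤ s.k) : s.x i ∈ P.dom := by
  rw [h.x_eq i hi]
  exact h.isTrajectory.mem_dom hP hlam i

theorem isProxSweep (h : CallInvariant P K S ρ η c₁ N s j x p) {i : ℕ} (hi : i ≤ s.k) :
    IsProxSweep P S s.c (s.x i) (s.p i) (x (i + 1)) := by
  rw [h.x_eq i hi, h.p_eq i hi]
  exact h.isTrajectory.sweep i

theorem k_le (h : CallInvariant P K S ρ η c₁ N s j x p) (hP : Assumptions P K)
    (hS : S.Admissible K) (hc₁ : 0 < c₁) (hρ : 0 < ρ) (hη : 0 < η) :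
    (s.k : ℝ) ≤ callBound P K S ρ η c₁ j := by
  obtain ⟨k, hk, htest⟩ := h.isTrajectory.exists_passesErgodicTest hP hS hc₁ (h.le_c hc₁)
    h.norm_dual_zero_le hρ hη
  rw [h.c_eq] at hk
  refine le_trans ?_ hk
  by_contra! hlt
  exact h.not_returns k (Nat.cast_lt.1 hlt) (Or.inr htest)

theorem count_le_totalBound (h : CallInvariant P K S ρ η c₁ N s j x p) (hP : Assumptions P K)
    (hS : S.Admissible K) (hc₁ : 0 < c₁) (hρ : 0 < ρ) (hη : 0 < η) :
    (N : ℝ) ≤ totalBound P K S c₁ (min ρ η) := by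
  have hcall := callBound_le hP hS hc₁ hρ hη
  calc (N : ℝ) ≤ ∑ i ∈ Finset.range (j + 1), callBound P K S ρ η c₁ i := by
        rw [Finset.sum_range_succ]
        exact h.count_le.trans (add_le_add_right (h.k_le hP hS hc₁ hρ hη) _)
    _ ≤ ∑ i ∈ Finset.range (j + 1),
          T1 P K S c₁ / 4 * ((2 : ℝ) ^ i / min ρ η ^ 2 + ((2 : ℝ) ^ i) ^ 2) :=
        Finset.sum_le_sum fun i _ => hcall i
    _ ≤ totalBound P K S c₁ (min ρ η) :=
        sum_call_cost_le (hP.one_le_T1 hS hc₁) hc₁ (lt_min hρ hη) rfl rfl j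
          (h.previous.imp_right fun hcube => hcube.trans_le (hcall _))

theorem c_cube_lt (h : CallInvariant P K S ρ η c₁ N s j x p) (hP : Assumptions P K)
    (hS : S.Admissible K) (hc₁ : 0 < c₁) (hρ : 0 < ρ) (hη : 0 < η)
    (hret : s.Returns P S ρ η) (hns : ¬ s.Successful P S ρ η) :
    s.c ^ 3 < callBound P K S ρ η c₁ j := by
  refine lt_of_lt_of_le ?_ (h.k_le hP hS hc₁ hρ hη)
  by_contra! hle
  obtain ⟨i, hi, hsucc⟩ := (hret.resolve_left hns).exists_successful hρ hη hle
  rcases hi.eq_or_lt with rfl | hlt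
  · exact hns hsucc
  · have hagree : ∀ m ≤ i, s.x m = x m := fun m hm => h.x_eq m (hm.trans hi)
    exact h.not_returns i hlt ((State.returns_congr (s := State.mk s.c i s.x s.p)
      (s' := State.mk s.c i x p) rfl rfl hagree).1 (Or.inl hsucc))

theorem exists_start (hP : Assumptions P K) (hlam : 0 < S.lam) {z : Blocks n} (hz : z ∈ P.dom)
    {p₀ : EuclideanSpace ℝ (Fin l)} (hp₀ : ‖p₀‖ ≤ kappa1 P K S * (c₁ * 2 ^ j))
    (hp₀_mem : p₀ ∈ P.A.range)
    (hN : (N : ℝ) ≤ ∑ i ∈ Finset.range j, callBound P K S ρ η c₁ i)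
    (hprev : j = 0 ∨ (c₁ * 2 ^ (j - 1)) ^ 3 < callBound P K S ρ η c₁ (j - 1)) :
    ∃ x p, CallInvariant P K S ρ η c₁ N (State.start (c₁ * 2 ^ j) z p₀) j x p := by
  obtain ⟨x, p, hT, rfl, rfl⟩ := hP.exists_trajectory hlam (c₁ * 2 ^ j) hz hp₀_mem
  exact ⟨x, p, {
    c_eq := rfl
    isTrajectory := hT
    norm_dual_zero_le := hp₀
    x_eq := fun i hi => by rw [Nat.le_zero.1 hi]; rfl
    p_eq := fun i hi => by rw [Nat.le_zero.1 hi]; rfl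
    not_returns := fun i hi => absurd hi (Nat.not_lt_zero i)
    count_le := hN.trans_eq (by rw [State.start, Nat.cast_zero, add_zero])
    previous := hprev }⟩

theorem next (h : CallInvariant P K S ρ η c₁ N s j x p) (hP : Assumptions P K)
    (hS : S.Admissible K) (hc₁ : 0 < c₁) {y : Blocks n} (hret : ¬ s.Returns P S ρ η)
    (hy : IsProxSweep P S s.c (s.x s.k) (s.p s.k) y) :
    CallInvariant P K S ρ η c₁ (N + 1) (s.next P S y) j x p := by
  obtain rfl : y = x (s.k + 1) :=
    hy.unique (h.isProxSweep le_rfl) hP hS (h.c_pos hc₁).le (h.x_mem_dom hP hS.lam_pos le_rfl)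
  exact {
    c_eq := h.c_eq
    isTrajectory := h.isTrajectory
    norm_dual_zero_le := h.norm_dual_zero_le
    x_eq := fun i hi => by
      rcases hi.eq_or_lt with rfl | hlt
      · exact Function.update_self ..
      · exact (Function.update_of_ne hlt.ne ..).trans (h.x_eq i (Nat.lt_succ_iff.1 hlt))
    p_eq := fun i hi => by
      rcases hi.eq_or_lt with rfl | hlt
      · refine (Function.update_self ..).trans ?_
        rw [h.p_eq s.k le_rfl]
        exact (h.isTrajectory.dual_succ s.k).symm
      · exact (Function.update_of_ne hlt.ne ..).trans (h.p_eq i (Nat.lt_succ_iff.1 hlt))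
    not_returns := fun i hi => by
      rcases (Nat.lt_succ_iff.1 hi).eq_or_lt with rfl | hlt
      · rwa [State.returns_congr (s := s) (s' := State.mk s.c s.k x p) rfl rfl h.x_eq] at hret
      · exact h.not_returns i hlt
    count_le := by
      rw [State.next, Nat.cast_succ, Nat.cast_succ, ← add_assoc]
      exact add_le_add_left h.count_le 1
    previous := h.previous }

theorem exists_newCall (h : CallInvariant P K S ρ η c₁ N s j x p) (hP : Assumptions P K)
    (hS : S.Admissible K) (hc₁ : 0 < c₁) (hρ : 0 < ρ) (hη : 0 < η)
    (hret : s.Returns P S ρ η) (hns : ¬ s.Successful P S ρ η) :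
    ∃ x' p', CallInvariant P K S ρ η c₁ N (State.start (2 * s.c) (s.x s.k) (s.p s.k)) (j + 1)
      x' p' := by
  have hc := h.c_pos hc₁
  have hdouble : 2 * s.c = c₁ * 2 ^ (j + 1) := by
    rw [h.c_eq]
    ring
  have hdual : ‖s.p s.k‖ ≤ kappa1 P K S * (c₁ * 2 ^ (j + 1)) := by
    rw [h.p_eq s.k le_rfl, ← hdouble]
    refine (h.isTrajectory.norm_dual_le hP hS hc.le h.norm_dual_zero_le s.k).trans ?_
    exact mul_le_mul_of_nonneg_left (by linarith) (hP.kappa1_nonneg hS)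
  have hmem : s.p s.k ∈ P.A.range := by
    rw [h.p_eq s.k le_rfl]
    exact h.isTrajectory.mem_range hP s.k
  have hcount : (N : ℝ) ≤ ∑ i ∈ Finset.range (j + 1), callBound P K S ρ η c₁ i := by
    rw [Finset.sum_range_succ]
    exact h.count_le.trans (add_le_add_right (h.k_le hP hS hc₁ hρ hη) _)
  have hcube : (c₁ * 2 ^ j) ^ 3 < callBound P K S ρ η c₁ j := by
    rw [← h.c_eq]
    exact h.c_cube_lt hP hS hc₁ hρ hη hret hns
  rw [hdouble]
  exact exists_start hP hS.lam_pos (h.x_mem_dom hP hS.lam_pos le_rfl) hdual hmem hcount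
    (Or.inr hcube)

end CallInvariant

theorem IsProxSweep.isStationaryPair {c : ℝ} {x y : Blocks n} {p : EuclideanSpace ℝ (Fin l)}
    (hy : IsProxSweep P S c x p y) (hP : Assumptions P K) (hlam : 0 < S.lam) (hx : x ∈ P.dom)
    (hv : ‖sweepResidual P S c x y‖ ≤ ρ) (hfeas : ‖P.A y - P.d‖ ≤ η) :
    P.IsStationaryPair ρ η y ((1 - S.theta) • p + c • (P.A y - P.d)) := by
  have hy_mem := hy.mem_dom hP hlam hx
  set q := (1 - S.theta) • p + c • (P.A y - P.d)
  have hsub : sweepResidual P S c x y - P.grad y - ContinuousLinearMap.adjoint P.A q ∈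
      subdiff P.h y := by
    intro u
    by_cases hu : u ∈ P.dom
    · rw [← hP.coe_toReal_h hy_mem, ← hP.coe_toReal_h hu, ← EReal.coe_add, EReal.coe_le_coe_iff]
      exact hy.h_add_inner_le hP hlam hx hu
    · rw [hP.h_eq_top hu]
      exact le_top
  refine ⟨hy_mem, (Metric.infEDist_le_edist_of_mem (Set.mem_image_of_mem _ hsub)).trans ?_, hfeas⟩
  rw [edist_dist, dist_zero_left, sub_sub, add_sub_cancel]
  exact ENNReal.ofReal_le_ofReal hv

namespace Reach

variable {z₀ : Blocks n} {N : ℕ} {s : State n l}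

theorem exists_callInvariant (h : Reach P S ρ η c₁ z₀ N s) (hP : Assumptions P K)
    (hS : S.Admissible K) (hc₁ : 0 < c₁) (hρ : 0 < ρ) (hη : 0 < η) (hz₀ : z₀ ∈ P.dom) :
    ∃ j x p, CallInvariant P K S ρ η c₁ N s j x p := by
  induction h with
  | init =>
    have hdual : ‖(0 : EuclideanSpace ℝ (Fin l))‖ ≤ kappa1 P K S * (c₁ * 2 ^ 0) := by
      rw [norm_zero]
      exact mul_nonneg (hP.kappa1_nonneg hS) (by positivity)
    have := CallInvariant.exists_start (N := 0) (ρ := ρ) (η := η) hP hS.lam_pos hz₀ hdual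
      (zero_mem _) (by rw [Nat.cast_zero, Finset.sum_range_zero]) (Or.inl rfl)
    rw [pow_zero, mul_one] at this
    exact ⟨0, this⟩
  | iterate _ hret hy ih =>
    obtain ⟨j, x, p, h⟩ := ih
    exact ⟨j, x, p, h.next hP hS hc₁ hret hy⟩
  | newCall _ hret hns ih =>
    obtain ⟨j, x, p, h⟩ := ih
    exact ⟨j + 1, h.exists_newCall hP hS hc₁ hρ hη hret hns⟩

theorem existsUnique_sweep (h : Reach P S ρ η c₁ z₀ N s) (hP : Assumptions P K)
    (hS : S.Admissible K) (hc₁ : 0 < c₁) (hρ : 0 < ρ) (hη : 0 < η) (hz₀ : z₀ ∈ P.dom) :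
    ∃! y, IsProxSweep P S s.c (s.x s.k) (s.p s.k) y := by
  obtain ⟨j, x, p, h⟩ := h.exists_callInvariant hP hS hc₁ hρ hη hz₀
  exact hP.existsUnique_sweep hS (h.c_pos hc₁).le (h.x_mem_dom hP hS.lam_pos le_rfl) _

theorem count_le_totalBound (h : Reach P S ρ η c₁ z₀ N s) (hP : Assumptions P K)
    (hS : S.Admissible K) (hc₁ : 0 < c₁) (hρ : 0 < ρ) (hη : 0 < η) (hz₀ : z₀ ∈ P.dom) :
    (N : ℝ) ≤ totalBound P K S c₁ (min ρ η) := by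
  obtain ⟨j, x, p, h⟩ := h.exists_callInvariant hP hS hc₁ hρ hη hz₀
  exact h.count_le_totalBound hP hS hc₁ hρ hη

theorem count_le_div_cube (h : Reach P S ρ η c₁ z₀ N s) (hP : Assumptions P K)
    (hS : S.Admissible K) (hc₁ : 0 < c₁) (hρ : 0 < ρ) (hη : 0 < η) (hε : min ρ η ≤ 1)
    (hz₀ : z₀ ∈ P.dom) : (N : ℝ) ≤ totalBound P K S c₁ 1 / min ρ η ^ 3 :=
  (h.count_le_totalBound hP hS hc₁ hρ hη hz₀).trans
    (hP.totalBound_le_div_cube hS hc₁ (lt_min hρ hη) hε)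

theorem isStationaryPair (h : Reach P S ρ η c₁ z₀ N s) (hP : Assumptions P K)
    (hS : S.Admissible K) (hc₁ : 0 < c₁) (hρ : 0 < ρ) (hη : 0 < η) (hz₀ : z₀ ∈ P.dom)
    (hs : s.Successful P S ρ η) : P.IsStationaryPair ρ η (s.x s.k) (s.q P S s.k) := by
  obtain ⟨j, x, p, hI⟩ := h.exists_callInvariant hP hS hc₁ hρ hη hz₀
  obtain ⟨hk, hv, hfeas⟩ := hs
  have hsweep := hI.isProxSweep (Nat.sub_le s.k 1)
  rw [Nat.sub_add_cancel hk, ← hI.x_eq s.k le_rfl] at hsweep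
  exact hsweep.isStationaryPair hP hS.lam_pos (hI.x_mem_dom hP hS.lam_pos (Nat.sub_le s.k 1))
    hv hfeas

end Reach

theorem Assumptions.exists_reach_successful (hP : Assumptions P K) (hS : S.Admissible K)
    (hc₁ : 0 < c₁) (hρ : 0 < ρ) (hη : 0 < η) {z₀ : Blocks n} (hz₀ : z₀ ∈ P.dom) :
    ∃ (N : ℕ) (s : State n l), Reach P S ρ η c₁ z₀ N s ∧ s.Successful P S ρ η := by
  by_contra! hfail
  have hrun : ∀ N : ℕ, ∃ s : State n l, Reach P S ρ η c₁ z₀ N s ∧ ¬ s.Returns P S ρ η := by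
    intro N
    induction N with
    | zero => exact ⟨_, Reach.init, State.not_returns_start _ _ _ _ _⟩
    | succ N ih =>
      obtain ⟨s, hs, hret⟩ := ih
      obtain ⟨y, hy, -⟩ := hs.existsUnique_sweep hP hS hc₁ hρ hη hz₀
      have hnext := hs.iterate hret hy
      by_cases hret' : (s.next P S y).Returns P S ρ η
      · exact ⟨_, hnext.newCall hret' (hfail _ _ hnext), State.not_returns_start _ _ _ _ _⟩
      · exact ⟨_, hnext, hret'⟩
  obtain ⟨N, hN⟩ := exists_nat_gt (totalBound P K S c₁ (min ρ η))
  obtain ⟨s, hs, -⟩ := hrun N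
  exact hN.not_ge (hs.count_le_totalBound hP hS hc₁ hρ hη hz₀)

end DynamicMethod

end DPADMM

end

theorem theorem2p2_general {B l : ℕ} {n : Fin B → ℕ} (P : DPADMM.Problem B n l)
    (K : DPADMM.Moduli n) (S : DPADMM.Params) (hP : DPADMM.Assumptions P K)
    (hS : S.Admissible K) (c₁ : ℝ) (hc₁ : 0 < c₁) :
    (∀ (ρ η : ℝ) (z₀ : DPADMM.Blocks n), 0 < ρ → 0 < η → z₀ ∈ P.dom →
      (∀ (N : ℕ) (s : DPADMM.State n l), DPADMM.Reach P S ρ η c₁ z₀ N s →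
        ∃! y, DPADMM.IsProxSweep P S s.c (s.x s.k) (s.p s.k) y) ∧
      (∀ (N : ℕ) (s : DPADMM.State n l), DPADMM.Reach P S ρ η c₁ z₀ N s →
        (N : ℝ) ≤ DPADMM.totalBound P K S c₁ (min ρ η)) ∧
      (∃ (N : ℕ) (s : DPADMM.State n l), DPADMM.Reach P S ρ η c₁ z₀ N s ∧
        s.Successful P S ρ η) ∧
      (∀ (N : ℕ) (s : DPADMM.State n l), DPADMM.Reach P S ρ η c₁ z₀ N s →
        s.Successful P S ρ η → P.IsStationaryPair ρ η (s.x s.k) (s.q P S s.k))) ∧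
    (∃ C : ℝ, ∀ (ρ η : ℝ) (z₀ : DPADMM.Blocks n), 0 < ρ → 0 < η → min ρ η ≤ 1 → z₀ ∈ P.dom →
      ∀ (N : ℕ) (s : DPADMM.State n l), DPADMM.Reach P S ρ η c₁ z₀ N s →
        (N : ℝ) ≤ C / (min ρ η) ^ 3) :=
  ⟨fun _ _ _ hρ hη hz₀ =>
    ⟨fun _ _ hs => hs.existsUnique_sweep hP hS hc₁ hρ hη hz₀,
      fun _ _ hs => hs.count_le_totalBound hP hS hc₁ hρ hη hz₀,
      hP.exists_reach_successful hS hc₁ hρ hη hz₀,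
      fun _ _ hs => hs.isStationaryPair hP hS hc₁ hρ hη hz₀⟩,
    DPADMM.totalBound P K S c₁ 1,
    fun _ _ _ hρ hη hε hz₀ _ _ hs => hs.count_le_div_cube hP hS hc₁ hρ hη hε hz₀⟩

theorem theorem2p2 {B l : ℕ} {n : Fin B → ℕ} (P : DPADMM.Problem B n l) (K : DPADMM.Moduli n)
    (S : DPADMM.Params) (hP : DPADMM.Assumptions P K) (hS : S.Admissible K)
    (c₁ : ℝ) (hc₁ : 0 < c₁) :
    (∀ (ρ η : ℝ) (z₀ : DPADMM.Blocks n), 0 < ρ → ρ < 1 → 0 < η → η < 1 → z₀ ∈ P.dom →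
      -- every iteration the method asks for can be carried out, in exactly one way
      (∀ (N : ℕ) (s : DPADMM.State n l), DPADMM.Reach P S ρ η c₁ z₀ N s →
        ¬ s.Returns P S ρ η → ∃! y, DPADMM.IsProxSweep P S s.c (s.x s.k) (s.p s.k) y) ∧
      -- the total number of static iterations never exceeds the bound
      (∀ (N : ℕ) (s : DPADMM.State n l), DPADMM.Reach P S ρ η c₁ z₀ N s →
        (N : ℝ) ≤ DPADMM.totalBound P K S c₁ (min ρ η)) ∧
      -- the method stops
      (∃ (N : ℕ) (s : DPADMM.State n l), DPADMM.Reach P S ρ η c₁ z₀ N s ∧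
        s.Successful P S ρ η) ∧
      -- whenever it stops, its output is a `(ρ, η)`-stationary pair
      (∀ (N : ℕ) (s : DPADMM.State n l), DPADMM.Reach P S ρ η c₁ z₀ N s →
        s.Successful P S ρ η → P.IsStationaryPair ρ η (s.x s.k) (s.q P S s.k))) ∧
    -- the complexity is `O(ε⁻³)`, with a constant independent of the tolerances and of `z₀`
    (∃ C : ℝ, ∀ (ρ η : ℝ) (z₀ : DPADMM.Blocks n), 0 < ρ → ρ < 1 → 0 < η → η < 1 → z₀ ∈ P.dom →
      ∀ (N : ℕ) (s : DPADMM.State n l), DPADMM.Reach P S ρ η c₁ z₀ N s →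
        (N : ℝ) ≤ C / (min ρ η) ^ 3) :=
  have ⟨h, C, hC⟩ := theorem2p2_general P K S hP hS c₁ hc₁
  ⟨fun ρ η z₀ hρ _ hη _ hz₀ => (h ρ η z₀ hρ hη hz₀).imp_left fun huniq N s hs _ => huniq N s hs,
    C, fun ρ η z₀ hρ hρ₁ hη _ => hC ρ η z₀ hρ hη ((min_le_left ρ η).trans hρ₁.le)⟩
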